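/- Let $k$ be a commutative ring; all algebras are associative unital $k$-algebras and all maps are $k$-linear. Let $\mathcal H=(\mathcal H_L,\mathcal H_R,S)$ be a Hopf algebroid with total algebra $H$: a left bialgebroid $(H,L,s_L,t_L,\gamma_L,\pi_L)$ and a right bialgebroid $(H,R,s_R,t_R,\gamma_R,\pi_R)$ on the same algebra $H$, with compatible source and target maps, with $(\gamma_L\otimes_R H)\gamma_R=(H\otimes_L\gamma_R)\gamma_L$ and $(\gamma_R\otimes_L H)\gamma_L=(H\otimes_R\gamma_L)\gamma_R$, and with an antipode $S$. Here $H$ is an $L$-coring via $l\cdot h\cdot l'=s_L(l)t_L(l')h$ and an $R$-coring via $r\cdot h\cdot r'=h\,s_R(r')t_R(r)$; it is also regarded as an $L$-$R$ and an $R$-$L$ bimodule through these actions. An $L$-coring $\mathcal D$ is a *right extension* of an $A$-coring $\mathcal C$ if $\mathcal C$ is a $\mathcal C$-$\mathcal D$ bicomodule via its coproduct $c\mapsto c^{(1)}\otimes_A c^{(2)}$ and some right $\mathcal D$-coaction $\tau_{\mathcal C}\colon c\mapsto c_{[0]}\otimes_L c_{[1]}$. A right $\mathcal C$-comodule $(M,\varrho\colon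 m\mapsto m^{[0]}\otimes_A m^{[1]})$ is then a right $L$-module via $ml=m^{[0]}\epsilon_{\mathcal C}(m^{[1]}l)$. The extension is *pure* if, for every right $\mathcal C$-comodule $(M,\varrho)$, the equaliser $M\to M\otimes_A\mathcal C\rightrightarrows M\otimes_A\mathcal C\otimes_A\mathcal C$ of $\varrho\otimes_A\mathcal C$ and $M\otimes_A\Delta_{\mathcal C}$ in right $L$-modules is preserved by $-\otimes_L\mathcal D\otimes_L\mathcal D$; in this case there is a unique map $\tau_M\colon M\to M\otimes_L\mathcal D$ with $(\varrho\otimes_L\mathcal D)\tau_M=(M\otimes_A\tau_{\mathcal C})\varrho$, and $M$ is a right $\mathcal D$-comodule via $\tau_M$. The Hopf algebroid $\mathcal H$ is *pure* if the coring of $\mathcal H_L$, as a right extension (via $\gamma_L$) of the coring of $\mathcal H_R$, and the coring of $\mathcal H_R$, as a right extension (via $\gamma_R$) of the coring of $\mathcal H_L$, are both pure. An $L$-$\mathcal C$ bicomodule $\Sigma$ (an $L$-$A$ bimodule and right $\mathcal C$-comodule with left $L$-linear coaction) for a pure right extension $\mathcal D$ of $\mathcal C$ is *cleft* if there are * a left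 $L$-linear right $\mathcal D$-colinear map $j\colon\mathcal D\to\Sigma$, and * an $A$-$L$ bilinear map $\tilde\jmath\colon\mathcal C\to\mathrm{Hom}_A(\Sigma,A)$ with $c^{(1)}\tilde\jmath(c^{(2)})(x)=\tilde\jmath(c)(x^{[0]})x^{[1]}$ for all $c\in\mathcal C$, $x\in\Sigma$, such that $c^{(1)}\,\tilde\jmath\big({c^{(2)}}_{[0]}\big)\big(j({c^{(2)}}_{[1]})\big)=c$ for all $c\in\mathcal C$ and $j(d)^{[0]}\,\tilde\jmath\big(j(d)^{[1]}\big)(x)=\epsilon_{\mathcal D}(d)x$ for all $d\in\mathcal D$, $x\in\Sigma$. Let $A$ be a right $\mathcal H_R$-comodule algebra, i.e. an algebra in the monoidal category of right $\mathcal H_R$-comodules, with $R$-ring structure $\eta_R\colon R\to A$ and coaction $a\mapsto a^{[0]}\otimes_R a^{[1]}$, and let $T=\{t\in A\mid t^{[0]}\otimes_R t^{[1]}=t\otimes_R 1_H\}$ be its coinvariant subalgebra. $A$ is an *$\mathcal H$-cleft extension* of $T$ if * $A$ is an $L$-ring with unit map an algebra map $\eta_L\colon L\to A$, and $T$ is an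 $L$-subring, i.e. $\eta_L(L)\subseteq T$; * there are a left $L$-linear right $\mathcal H_R$-colinear map $\lambda\colon H\to A$ and a left $R$-linear right $L$-linear map $\bar\lambda\colon H\to A$ such that $\mu_A(\lambda\otimes_R\bar\lambda)\gamma_R=\eta_L\pi_L$ and $\mu_A(\bar\lambda\otimes_L\lambda)\gamma_L=\eta_R\pi_R$. Let $\mathcal C=A\otimes_R H$ be the associated $A$-coring, with $a(b\otimes h)a'=ab\,a'^{[0]}\otimes h\,a'^{[1]}$, coproduct $A\otimes_R\gamma_R$ and counit $A\otimes_R\pi_R$; the coring of $\mathcal H_L$ is a right extension of $\mathcal C$ via the coaction $A\otimes_R\gamma_L$. **Proposition.** Let $\mathcal H$ be a pure Hopf algebroid and $A$ a right $\mathcal H_R$-comodule algebra. Then $A$ is an $\mathcal H$-cleft extension of its $\mathcal H_R$-coinvariant subalgebra if and only if 1. $A$ is an $L$-ring, with some unit map $\eta_L\colon L\to A$, and 2. $A$, with the left $L$-module structure given by $\eta_L$, the right regular $A$-module structure and the given $\mathcal H_R$-coaction, is an $L$-$\mathcal C$ bicomodule, the coring extension $\mathcal H_L$ of $\mathcal C$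 is pure, and this bicomodule is cleft for it. More precisely, for each given $L$-ring structure $\eta_L$ of $A$, the conditions for an $\mathcal H$-cleft extension hold with $\eta_L$ if and only if (2) holds with $\eta_L$. -/

import Mathlib

open scoped TensorProduct
open MulOpposite (op)

universe u

namespace NC

/-- A `k`-linear `B`-`C` bimodule structure on the `k`-module `M`: `l b m` is the left action
`b m` and `r c m` is the right action `m c`. -/
structure Bimod (k B C M : Type u) [CommRing k] [Ring B] [Algebra k B] [Ring C] [Algebra k C]
    [AddCommGroup M] [Module k M] where
  l : B →ₗ[k] M →ₗ[k] M
  r : C →ₗ[k] M →ₗ[k] M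
  l_one : ∀ m, l 1 m = m
  l_mul : ∀ b b' m, l (b * b') m = l b (l b' m)
  r_one : ∀ m, r 1 m = m
  r_mul : ∀ c c' m, r (c * c') m = r c' (r c m)
  lr : ∀ b c m, l b (r c m) = r c (l b m)

section Balanced

variable {k C M N M' N' P : Type u} [CommRing k] [Ring C] [Algebra k C]
  [AddCommGroup M] [Module k M] [AddCommGroup N] [Module k N]
  [AddCommGroup M'] [Module k M'] [AddCommGroup N'] [Module k N']
  [AddCommGroup P] [Module k P]

/-- The submodule of `M ⊗[k] N` generated by the elements `m c ⊗ n - m ⊗ c n`, for a right action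
`ρ` of `C` on `M` and a left action `lam` of `C` on `N`. -/
def BT.rel (ρ : C →ₗ[k] M →ₗ[k] M) (lam : C →ₗ[k] N →ₗ[k] N) : Submodule k (M ⊗[k] N) :=
  Submodule.span k {z | ∃ m c n, z = ρ c m ⊗ₜ[k] n - m ⊗ₜ[k] lam c n}

/-- The balanced tensor product `M ⊗_C N` over the (not necessarily commutative) algebra `C`, for a
right action `ρ` of `C` on `M` and a left action `lam` of `C` on `N`. -/
def BT (ρ : C →ₗ[k] M →ₗ[k] M) (lam : C →ₗ[k] N →ₗ[k] N) : Type u :=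
  (M ⊗[k] N) ⧸ BT.rel ρ lam

namespace BT

variable (ρ : C →ₗ[k] M →ₗ[k] M) (lam : C →ₗ[k] N →ₗ[k] N)

noncomputable instance : AddCommGroup (BT ρ lam) :=
  inferInstanceAs (AddCommGroup ((M ⊗[k] N) ⧸ BT.rel ρ lam))

noncomputable instance : Module k (BT ρ lam) :=
  inferInstanceAs (Module k ((M ⊗[k] N) ⧸ BT.rel ρ lam))

/-- The canonical projection `M ⊗[k] N → M ⊗_C N`. -/
noncomputable def mk : M ⊗[k] N →ₗ[k] BT ρ lam := (BT.rel ρ lam).mkQ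

/-- The canonical bilinear map `(m, n) ↦ m ⊗_C n`. -/
noncomputable def t : M →ₗ[k] N →ₗ[k] BT ρ lam := (TensorProduct.mk k M N).compr₂ (mk ρ lam)

theorem mk_tmul (m : M) (n : N) : mk ρ lam (m ⊗ₜ[k] n) = t ρ lam m n := rfl

theorem mk_surjective : Function.Surjective (mk ρ lam) := Submodule.mkQ_surjective _

variable {ρ lam}

theorem t_bal (c : C) (m : M) (n : N) : t ρ lam (ρ c m) n = t ρ lam m (lam c n) := by
  rw [← mk_tmul, ← mk_tmul, ← sub_eq_zero, ← map_sub]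
  exact (Submodule.Quotient.mk_eq_zero _).2 (Submodule.subset_span ⟨m, c, n, rfl⟩)

theorem ind {motive : BT ρ lam → Prop} (z : BT ρ lam)
    (ht : ∀ m n, motive (t ρ lam m n)) (hadd : ∀ x y, motive x → motive y → motive (x + y)) :
    motive z := by
  obtain ⟨u, rfl⟩ := mk_surjective ρ lam z
  induction u using TensorProduct.induction_on with
  | zero => simpa using ht 0 0
  | tmul m n => exact ht m n
  | add x y hx hy => rw [map_add]; exact hadd _ _ hx hy

theorem ext {f g : BT ρ lam →ₗ[k] P} (h : ∀ m n, f (t ρ lam m n) = g (t ρ lam m n)) : f = g := by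
  ext z
  induction z using ind with
  | ht m n => exact h m n
  | hadd x y hx hy => rw [map_add, map_add, hx, hy]

/-- The linear map out of `M ⊗_C N` defined by a `C`-balanced bilinear map. -/
noncomputable def lift (f : M →ₗ[k] N →ₗ[k] P) (hf : ∀ c m n, f (ρ c m) n = f m (lam c n)) :
    BT ρ lam →ₗ[k] P :=
  (BT.rel ρ lam).liftQ (TensorProduct.lift f) (by
    refine Submodule.span_le.2 ?_
    rintro z ⟨m, c, n, rfl⟩
    simp [hf])

@[simp] theorem lift_t (f : M →ₗ[k] N →ₗ[k] P) (hf : ∀ c m n, f (ρ c m) n = f m (lam c n))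
    (m : M) (n : N) : lift f hf (t ρ lam m n) = f m n := by
  exact (Submodule.liftQ_apply _ _ _).trans (TensorProduct.lift.tmul _ _)

variable {ρ' : C →ₗ[k] M' →ₗ[k] M'} {lam' : C →ₗ[k] N' →ₗ[k] N'}

/-- The map `f ⊗_C g`, for `f` right `C`-linear and `g` left `C`-linear. -/
noncomputable def map (f : M →ₗ[k] M') (g : N →ₗ[k] N') (hf : ∀ c m, f (ρ c m) = ρ' c (f m))
    (hg : ∀ c n, g (lam c n) = lam' c (g n)) : BT ρ lam →ₗ[k] BT ρ' lam' :=
  lift ((t ρ' lam').compl₁₂ f g) (by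
    intro c m n
    simp only [LinearMap.compl₁₂_apply]
    rw [hf, hg, t_bal])

@[simp] theorem map_t (f : M →ₗ[k] M') (g : N →ₗ[k] N') (hf : ∀ c m, f (ρ c m) = ρ' c (f m))
    (hg : ∀ c n, g (lam c n) = lam' c (g n)) (m : M) (n : N) :
    map f g hf hg (t ρ lam m n) = t ρ' lam' (f m) (g n) := by
  simp [map]

end BT

end Balanced

section Actions

variable {k B C D M N P : Type u} [CommRing k] [Ring B] [Algebra k B] [Ring C] [Algebra k C]
  [Ring D] [Algebra k D] [AddCommGroup M] [Module k M] [AddCommGroup N] [Module k N]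
  [AddCommGroup P] [Module k P]

/-- The left action of `B` on `M ⊗_C N`, for a `B`-`C` bimodule `M`. -/
noncomputable def BT.lact (X : Bimod k B C M) (lam : C →ₗ[k] N →ₗ[k] N) :
    B →ₗ[k] BT X.r lam →ₗ[k] BT X.r lam where
  toFun b := BT.map (X.l b) LinearMap.id (fun c m => X.lr b c m) (fun _ _ => rfl)
  map_add' b b' := BT.ext (by simp)
  map_smul' a b := BT.ext (by simp)

@[simp] theorem BT.lact_t (X : Bimod k B C M) (lam : C →ₗ[k] N →ₗ[k] N) (b : B) (m : M) (n : N) :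
    BT.lact X lam b (BT.t X.r lam m n) = BT.t X.r lam (X.l b m) n := by
  simp [BT.lact]

/-- The right action of `D` on `M ⊗_C N`, for a `C`-`D` bimodule `N`. -/
noncomputable def BT.ract (ρ : C →ₗ[k] M →ₗ[k] M) (Y : Bimod k C D N) :
    D →ₗ[k] BT ρ Y.l →ₗ[k] BT ρ Y.l where
  toFun d := BT.map LinearMap.id (Y.r d) (fun _ _ => rfl) (fun c n => (Y.lr c d n).symm)
  map_add' b b' := BT.ext (by simp)
  map_smul' a b := BT.ext (by simp)

@[simp] theorem BT.ract_t (ρ : C →ₗ[k] M →ₗ[k] M) (Y : Bimod k C D N) (d : D) (m : M) (n : N) :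
    BT.ract ρ Y d (BT.t ρ Y.l m n) = BT.t ρ Y.l m (Y.r d n) := by
  simp [BT.ract]

/-- The tensor product of bimodules. -/
@[reducible] noncomputable def Bimod.tensor (X : Bimod k B C M) (Y : Bimod k C D N) :
    Bimod k B D (BT X.r Y.l) where
  l := BT.lact X Y.l
  r := BT.ract X.r Y
  l_one z := by
    induction z using BT.ind with
    | ht m n => simp [X.l_one]
    | hadd x y hx hy => rw [map_add, hx, hy]
  l_mul b b' z := by
    induction z using BT.ind with
    | ht m n => simp [X.l_mul]
    | hadd x y hx hy => simp only [map_add, hx, hy]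
  r_one z := by
    induction z using BT.ind with
    | ht m n => simp [Y.r_one]
    | hadd x y hx hy => rw [map_add, hx, hy]
  r_mul b b' z := by
    induction z using BT.ind with
    | ht m n => simp [Y.r_mul]
    | hadd x y hx hy => simp only [map_add, hx, hy]
  lr b d z := by
    induction z using BT.ind with
    | ht m n => simp
    | hadd x y hx hy => simp only [map_add, hx, hy]

theorem BT.ract_tensor_t {Q : Type u} [AddCommGroup Q] [Module k Q]
    (ρ : B →ₗ[k] Q →ₗ[k] Q) (X : Bimod k B C M)
    (Y : Bimod k C D N) (d : D) (m : Q) (z : BT X.r Y.l) :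
    BT.ract ρ (X.tensor Y) d (BT.t ρ (BT.lact X Y.l) m z)
      = BT.t ρ (BT.lact X Y.l) m (BT.ract X.r Y d z) :=
  BT.ract_t ρ (X.tensor Y) d m z

/-- The associativity map `(M ⊗_C N) ⊗_D P → M ⊗_C (N ⊗_D P)`. -/
noncomputable def BT.assoc (ρ : C →ₗ[k] M →ₗ[k] M) (Y : Bimod k C D N)
    (mu : D →ₗ[k] P →ₗ[k] P) :
    BT (BT.ract ρ Y) mu →ₗ[k] BT ρ (BT.lact Y mu) :=
  BT.lift
    (BT.lift
      (LinearMap.mk₂ k (fun m n => (BT.t ρ (BT.lact Y mu) m).comp (BT.t Y.r mu n))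
        (by intros; ext; simp) (by intros; ext; simp) (by intros; ext; simp)
        (by intros; ext; simp))
      (by
        intro c m n
        ext p
        simp only [LinearMap.mk₂_apply, LinearMap.comp_apply]
        rw [BT.t_bal, BT.lact_t]))
    (by
      intro d z p
      induction z using BT.ind with
      | ht m n => simp [BT.t_bal]
      | hadd x y hx hy => simp only [map_add, LinearMap.add_apply, hx, hy])

@[simp] theorem BT.assoc_t (ρ : C →ₗ[k] M →ₗ[k] M) (Y : Bimod k C D N)
    (mu : D →ₗ[k] P →ₗ[k] P) (m : M) (n : N) (p : P) :
    BT.assoc ρ Y mu (BT.t _ mu (BT.t ρ Y.l m n) p)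
      = BT.t ρ (BT.lact Y mu) m (BT.t Y.r mu n p) := by
  simp [BT.assoc]

/-- The map `N ⊗_D P → (M ⊗_C N) ⊗_D P`, `n ⊗ p ↦ (m ⊗ n) ⊗ p`. -/
noncomputable def BT.assocInvAux (ρ : C →ₗ[k] M →ₗ[k] M) (Y : Bimod k C D N)
    (mu : D →ₗ[k] P →ₗ[k] P) (m : M) : BT Y.r mu →ₗ[k] BT (BT.ract ρ Y) mu :=
  BT.map (BT.t ρ Y.l m) LinearMap.id
    (fun d n => (BT.ract_t ρ Y d m n).symm) (fun _ _ => rfl)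

@[simp] theorem BT.assocInvAux_t (ρ : C →ₗ[k] M →ₗ[k] M) (Y : Bimod k C D N)
    (mu : D →ₗ[k] P →ₗ[k] P) (m : M) (n : N) (p : P) :
    BT.assocInvAux ρ Y mu m (BT.t Y.r mu n p) = BT.t _ mu (BT.t ρ Y.l m n) p := by
  simp [BT.assocInvAux]

/-- The associativity map `M ⊗_C (N ⊗_D P) → (M ⊗_C N) ⊗_D P`. -/
noncomputable def BT.assocInv (ρ : C →ₗ[k] M →ₗ[k] M) (Y : Bimod k C D N)
    (mu : D →ₗ[k] P →ₗ[k] P) :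
    BT ρ (BT.lact Y mu) →ₗ[k] BT (BT.ract ρ Y) mu :=
  BT.lift
    { toFun := BT.assocInvAux ρ Y mu
      map_add' := fun m m' => BT.ext (by simp)
      map_smul' := fun a m => BT.ext (by simp) }
    (by
      intro c m z
      simp only [LinearMap.coe_mk, AddHom.coe_mk]
      induction z using BT.ind with
      | ht n p => rw [BT.lact_t, BT.assocInvAux_t, BT.assocInvAux_t, BT.t_bal]
      | hadd x y hx hy => rw [map_add, hx, hy, map_add, map_add])

@[simp] theorem BT.assocInv_t (ρ : C →ₗ[k] M →ₗ[k] M) (Y : Bimod k C D N)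
    (mu : D →ₗ[k] P →ₗ[k] P) (m : M) (n : N) (p : P) :
    BT.assocInv ρ Y mu (BT.t ρ (BT.lact Y mu) m (BT.t Y.r mu n p))
      = BT.t _ mu (BT.t ρ Y.l m n) p := by
  simp [BT.assocInv]

theorem BT.assocInv_assoc (ρ : C →ₗ[k] M →ₗ[k] M) (Y : Bimod k C D N)
    (mu : D →ₗ[k] P →ₗ[k] P) (z : BT (BT.ract ρ Y) mu) :
    BT.assocInv ρ Y mu (BT.assoc ρ Y mu z) = z := by
  induction z using BT.ind with
  | ht w p =>
    induction w using BT.ind with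
    | ht m n => simp
    | hadd x y hx hy => simp only [map_add, LinearMap.add_apply, hx, hy]
  | hadd x y hx hy => simp only [map_add, hx, hy]

theorem BT.assoc_assocInv (ρ : C →ₗ[k] M →ₗ[k] M) (Y : Bimod k C D N)
    (mu : D →ₗ[k] P →ₗ[k] P) (z : BT ρ (BT.lact Y mu)) :
    BT.assoc ρ Y mu (BT.assocInv ρ Y mu z) = z := by
  induction z using BT.ind with
  | ht m w =>
    induction w using BT.ind with
    | ht n p => simp
    | hadd x y hx hy => simp only [map_add, hx, hy]
  | hadd x y hx hy => simp only [map_add, hx, hy]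

/-- For a right `C`-module `M` and a left `C`-linear map `f : N → C`, the map
`M ⊗_C N → M`, `m ⊗ n ↦ m f(n)`. -/
noncomputable def BT.contrR (ρ : C →ₗ[k] M →ₗ[k] M) (lam : C →ₗ[k] N →ₗ[k] N)
    (hρ : ∀ c c' m, ρ (c * c') m = ρ c' (ρ c m)) (f : N →ₗ[k] C)
    (hf : ∀ c n, f (lam c n) = c * f n) : BT ρ lam →ₗ[k] M :=
  BT.lift (LinearMap.mk₂ k (fun m n => ρ (f n) m) (by simp) (by simp) (by simp) (by simp)) (by
    intro c m n
    simp [hf, hρ])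

@[simp] theorem BT.contrR_t (ρ : C →ₗ[k] M →ₗ[k] M) (lam : C →ₗ[k] N →ₗ[k] N)
    (hρ : ∀ c c' m, ρ (c * c') m = ρ c' (ρ c m)) (f : N →ₗ[k] C)
    (hf : ∀ c n, f (lam c n) = c * f n) (m : M) (n : N) :
    BT.contrR ρ lam hρ f hf (BT.t ρ lam m n) = ρ (f n) m := by
  exact BT.lift_t _ _ m n

/-- For a left `C`-module `N` and a right `C`-linear map `f : M → C`, the map
`M ⊗_C N → N`, `m ⊗ n ↦ f(m) n`. -/
noncomputable def BT.contrL (ρ : C →ₗ[k] M →ₗ[k] M) (lam : C →ₗ[k] N →ₗ[k] N)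
    (hlam : ∀ c c' n, lam (c * c') n = lam c (lam c' n)) (f : M →ₗ[k] C)
    (hf : ∀ c m, f (ρ c m) = f m * c) : BT ρ lam →ₗ[k] N :=
  BT.lift (LinearMap.mk₂ k (fun m n => lam (f m) n) (by simp) (by simp) (by simp) (by simp)) (by
    intro c m n
    simp [hf, hlam])

@[simp] theorem BT.contrL_t (ρ : C →ₗ[k] M →ₗ[k] M) (lam : C →ₗ[k] N →ₗ[k] N)
    (hlam : ∀ c c' n, lam (c * c') n = lam c (lam c' n)) (f : M →ₗ[k] C)
    (hf : ∀ c m, f (ρ c m) = f m * c) (m : M) (n : N) :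
    BT.contrL ρ lam hlam f hf (BT.t ρ lam m n) = lam (f m) n := by
  exact BT.lift_t _ _ m n

end Actions

section Corings

variable {k A L C D M : Type u} [CommRing k] [Ring A] [Algebra k A] [Ring L] [Algebra k L]
  [AddCommGroup C] [Module k C] [AddCommGroup D] [Module k D] [AddCommGroup M] [Module k M]

variable (k A C) in
/-- An `A`-coring structure on `C`: a comonoid in the monoidal category of `A`-`A` bimodules. -/
structure Coring extends Bimod k A A C where
  comul : C →ₗ[k] BT r l
  comul_l : ∀ a c, comul (l a c) = BT.lact toBimod l a (comul c)
  comul_r : ∀ a c, comul (r a c) = BT.ract r toBimod a (comul c)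
  counit : C →ₗ[k] A
  counit_l : ∀ a c, counit (l a c) = a * counit c
  counit_r : ∀ a c, counit (r a c) = counit c * a
  coassoc : ∀ c, BT.assoc r toBimod l
      (BT.map comul LinearMap.id comul_r (fun _ _ => rfl) (comul c))
    = BT.map LinearMap.id comul (fun _ _ => rfl) comul_l (comul c)
  counit_comul : ∀ c, BT.contrL r l l_mul counit counit_r (comul c) = c
  comul_counit : ∀ c, BT.contrR r l r_mul counit counit_l (comul c) = c

/-- A right comodule structure on `M` over the `A`-coring `𝒞` (including the right `A`-module
structure of `M`). -/
structure RightComodule (𝒞 : Coring k A C) (M : Type u) [AddCommGroup M] [Module k M] where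
  ract : A →ₗ[k] M →ₗ[k] M
  ract_one : ∀ m, ract 1 m = m
  ract_mul : ∀ a a' m, ract (a * a') m = ract a' (ract a m)
  coact : M →ₗ[k] BT ract 𝒞.l
  coact_r : ∀ a m, coact (ract a m) = BT.ract ract 𝒞.toBimod a (coact m)
  coassoc : ∀ m, BT.assoc ract 𝒞.toBimod 𝒞.l
      (BT.map coact LinearMap.id coact_r (fun _ _ => rfl) (coact m))
    = BT.map LinearMap.id 𝒞.comul (fun _ _ => rfl) 𝒞.comul_l (coact m)
  counit : ∀ m, BT.contrR ract 𝒞.l ract_mul 𝒞.counit 𝒞.counit_l (coact m) = m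

/-- The data of a right coring extension: the `L`-coring `𝒟` is a right extension of the `A`-coring
`𝒞` if `𝒞` is a `𝒞`-`𝒟` bicomodule with the left regular `𝒞`-coaction and some right
`𝒟`-coaction. -/
structure RightExtension (𝒞 : Coring k A C) (𝒟 : Coring k L D) extends RightComodule 𝒟 C where
  lr : ∀ a l c, 𝒞.l a (ract l c) = ract l (𝒞.l a c)
  coact_l : ∀ a c, coact (𝒞.l a c)
    = BT.lact ⟨𝒞.l, ract, 𝒞.l_one, 𝒞.l_mul, ract_one, ract_mul, lr⟩ 𝒟.l a (coact c)
  comul_ract : ∀ l c, 𝒞.comul (ract l c)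
    = BT.ract 𝒞.r ⟨𝒞.l, ract, 𝒞.l_one, 𝒞.l_mul, ract_one, ract_mul, lr⟩ l (𝒞.comul c)
  colinear : ∀ c,
    BT.assoc 𝒞.r ⟨𝒞.l, ract, 𝒞.l_one, 𝒞.l_mul, ract_one, ract_mul, lr⟩ 𝒟.l
      (BT.map 𝒞.comul LinearMap.id comul_ract (fun _ _ => rfl) (coact c))
    = BT.map LinearMap.id coact (fun _ _ => rfl) coact_l (𝒞.comul c)

namespace RightExtension

variable {𝒞 : Coring k A C} {𝒟 : Coring k L D}

/-- The `A`-`L` bimodule structure of `𝒞`. -/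
@[reducible] def bimod (E : RightExtension 𝒞 𝒟) : Bimod k A L C :=
  ⟨𝒞.l, E.ract, 𝒞.l_one, 𝒞.l_mul, E.ract_one, E.ract_mul, E.lr⟩

/-- The map `c ↦ ε(c l)`, which is left `A`-linear. -/
noncomputable def counitAct (E : RightExtension 𝒞 𝒟) : L →ₗ[k] C →ₗ[k] A :=
  E.ract.compr₂ 𝒞.counit

theorem counitAct_l (E : RightExtension 𝒞 𝒟) (l : L) (a : A) (c : C) :
    E.counitAct l (𝒞.l a c) = a * E.counitAct l c := by
  simp [counitAct, ← E.lr, 𝒞.counit_l]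

/-- The right `L`-action `m l = m^[0] ε(m^[1] l)` on a right `𝒞`-comodule. -/
noncomputable def indAct (E : RightExtension 𝒞 𝒟) (S : RightComodule 𝒞 M) :
    L →ₗ[k] M →ₗ[k] M where
  toFun l := (BT.contrR S.ract 𝒞.l S.ract_mul (E.counitAct l) (E.counitAct_l l)).comp S.coact
  map_add' l l' := by
    rw [← LinearMap.add_comp]
    congr 1
    exact BT.ext (by simp)
  map_smul' a l := by
    rw [RingHom.id_apply, ← LinearMap.smul_comp]
    congr 1
    exact BT.ext (by simp)

theorem indAct_apply (E : RightExtension 𝒞 𝒟) (S : RightComodule 𝒞 M) (l : L) (m : M) :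
    E.indAct S l m
      = BT.contrR S.ract 𝒞.l S.ract_mul (E.counitAct l) (E.counitAct_l l) (S.coact m) := rfl

theorem contr_comul (E : RightExtension 𝒞 𝒟) (l : L) (c : C) :
    BT.contrR 𝒞.r 𝒞.l 𝒞.r_mul (E.counitAct l) (E.counitAct_l l) (𝒞.comul c) = E.ract l c := by
  rw [← 𝒞.comul_counit (E.ract l c), E.comul_ract]
  generalize 𝒞.comul c = z
  induction z using BT.ind with
  | ht x y =>
    rw [BT.contrR_t, BT.ract_t, BT.contrR_t]
    rfl
  | hadd x y hx hy => rw [map_add, hx, hy, map_add, map_add]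

/-- The `𝒞`-coaction is right `L`-linear. -/
theorem coact_indAct (E : RightExtension 𝒞 𝒟) (S : RightComodule 𝒞 M) (l : L) (m : M) :
    S.coact (E.indAct S l m) = BT.ract S.ract E.bimod l (S.coact m) := by
  have h1 : ∀ z : BT S.ract 𝒞.l,
      S.coact (BT.contrR S.ract 𝒞.l S.ract_mul (E.counitAct l) (E.counitAct_l l) z)
      = BT.map (ρ' := S.ract) (lam' := 𝒞.l) LinearMap.id
          (BT.contrR 𝒞.r 𝒞.l 𝒞.r_mul (E.counitAct l) (E.counitAct_l l))
          (fun _ _ => rfl) (by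
            intro a z
            induction z using BT.ind with
            | ht x y => simp [𝒞.lr]
            | hadd x y hx hy => simp only [map_add, hx, hy])
        (BT.assoc S.ract 𝒞.toBimod 𝒞.l
          (BT.map S.coact LinearMap.id S.coact_r (fun _ _ => rfl) z)) := by
    intro z
    induction z using BT.ind with
    | ht x y =>
      rw [BT.contrR_t, S.coact_r, BT.map_t]
      generalize S.coact x = w
      induction w using BT.ind with
      | ht x c => simp
      | hadd x y hx hy => simp only [map_add, LinearMap.add_apply, hx, hy]
    | hadd x y hx hy => simp only [map_add, hx, hy]
  rw [indAct_apply, h1, S.coassoc]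
  generalize S.coact m = w
  induction w using BT.ind with
  | ht x c => simp [contr_comul]
  | hadd x y hx hy => simp only [map_add, hx, hy]

/-- The map `m ⊗ c ↦ m^[0] ⊗ m^[1] ⊗ c`, that is `ϱ ⊗_A 𝒞`. -/
noncomputable def coactTensor (S : RightComodule 𝒞 M) :
    BT S.ract 𝒞.l →ₗ[k] BT S.ract (BT.lact 𝒞.toBimod 𝒞.l) :=
  (BT.assoc S.ract 𝒞.toBimod 𝒞.l).comp
    (BT.map S.coact LinearMap.id S.coact_r (fun _ _ => rfl))

/-- The map `m ⊗ c ↦ m ⊗ c^(1) ⊗ c^(2)`, that is `M ⊗_A Δ`. -/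
noncomputable def tensorComul (S : RightComodule 𝒞 M) :
    BT S.ract 𝒞.l →ₗ[k] BT S.ract (BT.lact 𝒞.toBimod 𝒞.l) :=
  BT.map LinearMap.id 𝒞.comul (fun _ _ => rfl) 𝒞.comul_l

theorem coactTensor_ract (E : RightExtension 𝒞 𝒟) (S : RightComodule 𝒞 M) (l : L)
    (z : BT S.ract 𝒞.l) :
    coactTensor S (BT.ract S.ract E.bimod l z)
      = BT.ract S.ract (𝒞.toBimod.tensor E.bimod) l (coactTensor S z) := by
  induction z using BT.ind with
  | ht x c =>
    rw [BT.ract_t]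
    simp only [coactTensor, LinearMap.comp_apply, BT.map_t, LinearMap.id_apply]
    generalize S.coact x = w
    induction w using BT.ind with
    | ht x c' =>
      rw [BT.assoc_t, BT.assoc_t, BT.ract_tensor_t, BT.ract_t]
    | hadd x y hx hy => simp only [map_add, LinearMap.add_apply, hx, hy]
  | hadd x y hx hy => simp only [map_add, hx, hy]

theorem tensorComul_ract (E : RightExtension 𝒞 𝒟) (S : RightComodule 𝒞 M) (l : L)
    (z : BT S.ract 𝒞.l) :
    tensorComul S (BT.ract S.ract E.bimod l z)
      = BT.ract S.ract (𝒞.toBimod.tensor E.bimod) l (tensorComul S z) := by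
  induction z using BT.ind with
  | ht x c =>
    rw [BT.ract_t]
    simp only [tensorComul, BT.map_t, LinearMap.id_apply]
    rw [E.comul_ract, BT.ract_tensor_t]
  | hadd x y hx hy => simp only [map_add, hx, hy]

end RightExtension
end Corings

section Cleft

variable {k A L C D M : Type u} [CommRing k] [Ring A] [Algebra k A] [Ring L] [Algebra k L]
  [AddCommGroup C] [Module k C] [AddCommGroup D] [Module k D] [AddCommGroup M] [Module k M]
  {𝒞 : Coring k A C} {𝒟 : Coring k L D}

namespace RightExtension

section Functor

variable {N : Type u} [AddCommGroup N] [Module k N]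

/-- The image of the coaction `ϱ : M → M ⊗_A 𝒞` under the functor `- ⊗_L N`. -/
noncomputable def coactMap (E : RightExtension 𝒞 𝒟) (S : RightComodule 𝒞 M)
    (lam : L →ₗ[k] N →ₗ[k] N) :
    BT (E.indAct S) lam →ₗ[k] BT (BT.ract S.ract E.bimod) lam :=
  BT.map S.coact LinearMap.id (E.coact_indAct S) (fun _ _ => rfl)

/-- The image of `ϱ ⊗_A 𝒞 : M ⊗_A 𝒞 → M ⊗_A 𝒞 ⊗_A 𝒞` under the functor `- ⊗_L N`. -/
noncomputable def coactTensorMap (E : RightExtension 𝒞 𝒟) (S : RightComodule 𝒞 M)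
    (lam : L →ₗ[k] N →ₗ[k] N) :
    BT (BT.ract S.ract E.bimod) lam
      →ₗ[k] BT (BT.ract S.ract (𝒞.toBimod.tensor E.bimod)) lam :=
  BT.map (coactTensor S) LinearMap.id (E.coactTensor_ract S) (fun _ _ => rfl)

/-- The image of `M ⊗_A Δ : M ⊗_A 𝒞 → M ⊗_A 𝒞 ⊗_A 𝒞` under the functor `- ⊗_L N`. -/
noncomputable def tensorComulMap (E : RightExtension 𝒞 𝒟) (S : RightComodule 𝒞 M)
    (lam : L →ₗ[k] N →ₗ[k] N) :
    BT (BT.ract S.ract E.bimod) lam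
      →ₗ[k] BT (BT.ract S.ract (𝒞.toBimod.tensor E.bimod)) lam :=
  BT.map (tensorComul S) LinearMap.id (E.tensorComul_ract S) (fun _ _ => rfl)

end Functor

/-- Purity of the right coring extension `𝒟` of `𝒞`: for every right `𝒞`-comodule `M`, the
equaliser `M → M ⊗_A 𝒞 ⇉ M ⊗_A 𝒞 ⊗_A 𝒞` of right `L`-modules is preserved by the functor
`- ⊗_L 𝒟 ⊗_L 𝒟`. -/
def IsPure (E : RightExtension 𝒞 𝒟) : Prop :=
  ∀ (M : Type u) [AddCommGroup M] [Module k M] (S : RightComodule 𝒞 M),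
    Function.Injective (E.coactMap S (BT.lact 𝒟.toBimod 𝒟.l)) ∧
    ∀ z, E.coactTensorMap S (BT.lact 𝒟.toBimod 𝒟.l) z
        = E.tensorComulMap S (BT.lact 𝒟.toBimod 𝒟.l) z →
      ∃ w, E.coactMap S (BT.lact 𝒟.toBimod 𝒟.l) w = z

section Induced

variable (E : RightExtension 𝒞 𝒟) (S : RightComodule 𝒞 M)

/-- The map `X ⊗_L 𝒟 → X ⊗_L 𝒟 ⊗_L 𝒟` given by the coproduct of `𝒟`. -/
noncomputable def up {X : Type u} [AddCommGroup X] [Module k X] (ρ : L →ₗ[k] X →ₗ[k] X)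
    (𝒟 : Coring k L D) : BT ρ 𝒟.l →ₗ[k] BT ρ (BT.lact 𝒟.toBimod 𝒟.l) :=
  BT.map LinearMap.id 𝒟.comul (fun _ _ => rfl) 𝒟.comul_l

theorem contrL_l (𝒟 : Coring k L D) (l : L) (z : BT 𝒟.r 𝒟.l) :
    BT.contrL 𝒟.r 𝒟.l 𝒟.l_mul 𝒟.counit 𝒟.counit_r (BT.lact 𝒟.toBimod 𝒟.l l z)
      = 𝒟.l l (BT.contrL 𝒟.r 𝒟.l 𝒟.l_mul 𝒟.counit 𝒟.counit_r z) := by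
  induction z using BT.ind with
  | ht x y => simp [𝒟.counit_l, 𝒟.l_mul]
  | hadd x y hx hy => simp only [map_add, hx, hy]

/-- The map `X ⊗_L 𝒟 ⊗_L 𝒟 → X ⊗_L 𝒟` given by the counit of `𝒟`. -/
noncomputable def down {X : Type u} [AddCommGroup X] [Module k X] (ρ : L →ₗ[k] X →ₗ[k] X)
    (𝒟 : Coring k L D) : BT ρ (BT.lact 𝒟.toBimod 𝒟.l) →ₗ[k] BT ρ 𝒟.l :=
  BT.map LinearMap.id (BT.contrL 𝒟.r 𝒟.l 𝒟.l_mul 𝒟.counit 𝒟.counit_r) (fun _ _ => rfl)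
    (contrL_l 𝒟)

theorem down_up {X : Type u} [AddCommGroup X] [Module k X] (ρ : L →ₗ[k] X →ₗ[k] X)
    (𝒟 : Coring k L D) (z : BT ρ 𝒟.l) : down ρ 𝒟 (up ρ 𝒟 z) = z := by
  induction z using BT.ind with
  | ht x y => simp [up, down, 𝒟.counit_comul]
  | hadd x y hx hy => simp only [map_add, hx, hy]

theorem coactMap_up (z : BT (E.indAct S) 𝒟.l) :
    E.coactMap S (BT.lact 𝒟.toBimod 𝒟.l) (up _ 𝒟 z) = up _ 𝒟 (E.coactMap S 𝒟.l z) := by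
  induction z using BT.ind with
  | ht x y => simp [up, coactMap]
  | hadd x y hx hy => simp only [map_add, hx, hy]

theorem coactMap_down (z : BT (E.indAct S) (BT.lact 𝒟.toBimod 𝒟.l)) :
    E.coactMap S 𝒟.l (down _ 𝒟 z)
      = down _ 𝒟 (E.coactMap S (BT.lact 𝒟.toBimod 𝒟.l) z) := by
  induction z using BT.ind with
  | ht x y => simp [down, coactMap]
  | hadd x y hx hy => simp only [map_add, hx, hy]

theorem coactTensorMap_up (z : BT (BT.ract S.ract E.bimod) 𝒟.l) :
    E.coactTensorMap S (BT.lact 𝒟.toBimod 𝒟.l) (up _ 𝒟 z)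
      = up _ 𝒟 (E.coactTensorMap S 𝒟.l z) := by
  induction z using BT.ind with
  | ht x y => simp [up, coactTensorMap]
  | hadd x y hx hy => simp only [map_add, hx, hy]

theorem tensorComulMap_up (z : BT (BT.ract S.ract E.bimod) 𝒟.l) :
    E.tensorComulMap S (BT.lact 𝒟.toBimod 𝒟.l) (up _ 𝒟 z)
      = up _ 𝒟 (E.tensorComulMap S 𝒟.l z) := by
  induction z using BT.ind with
  | ht x y => simp [up, tensorComulMap]
  | hadd x y hx hy => simp only [map_add, hx, hy]

variable {E} in
theorem IsPure.injective (hE : E.IsPure) : Function.Injective (E.coactMap S 𝒟.l) := by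
  intro z w h
  rw [← down_up _ 𝒟 z, ← down_up _ 𝒟 w]
  congr 1
  apply (hE M S).1
  rw [coactMap_up, coactMap_up, h]

variable {E} in
theorem IsPure.exists_of_eq (hE : E.IsPure) (z : BT (BT.ract S.ract E.bimod) 𝒟.l)
    (hz : E.coactTensorMap S 𝒟.l z = E.tensorComulMap S 𝒟.l z) :
    ∃ w, E.coactMap S 𝒟.l w = z := by
  obtain ⟨w, hw⟩ := (hE M S).2 (up _ 𝒟 z) (by rw [coactTensorMap_up, tensorComulMap_up, hz])
  exact ⟨down _ 𝒟 w, by rw [coactMap_down, hw, down_up]⟩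

/-- The map `m ↦ m^[0] ⊗ (m^[1])_[0] ⊗ (m^[1])_[1]`, that is `(M ⊗_A τ_𝒞) ∘ ϱ`. -/
noncomputable def coactCoact : M →ₗ[k] BT (BT.ract S.ract E.bimod) 𝒟.l :=
  (BT.assocInv S.ract E.bimod 𝒟.l).comp
    ((BT.map LinearMap.id E.coact (fun _ _ => rfl) E.coact_l).comp S.coact)

/-- The map `m ⊗ c ⊗ c' ↦ m ⊗ c ⊗ c'_[0] ⊗ c'_[1]`. -/
noncomputable def phi : BT S.ract (BT.lact 𝒞.toBimod 𝒞.l)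
    →ₗ[k] BT (BT.ract S.ract (𝒞.toBimod.tensor E.bimod)) 𝒟.l :=
  (BT.assocInv S.ract (𝒞.toBimod.tensor E.bimod) 𝒟.l).comp
    (BT.map (lam' := BT.lact (𝒞.toBimod.tensor E.bimod) 𝒟.l) LinearMap.id
      ((BT.assocInv 𝒞.r E.bimod 𝒟.l).comp
        (BT.map LinearMap.id E.coact (fun _ _ => rfl) E.coact_l)) (fun _ _ => rfl) (by
          intro a z
          induction z using BT.ind with
          | ht c c' =>
            simp only [BT.lact_t, BT.map_t, LinearMap.comp_apply, LinearMap.id_apply]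
            generalize E.coact c' = w
            induction w using BT.ind with
            | ht x d => rw [BT.assocInv_t, BT.assocInv_t, BT.lact_t, BT.lact_t]
            | hadd x y hx hy => simp only [map_add, hx, hy]
          | hadd x y hx hy => simp only [map_add, hx, hy]))

theorem assoc_t_ract (w : BT S.ract 𝒞.l) (l : L) (c : C) :
    BT.assoc S.ract 𝒞.toBimod 𝒞.l (BT.t _ _ w (E.ract l c))
      = BT.ract S.ract (𝒞.toBimod.tensor E.bimod) l
          (BT.assoc S.ract 𝒞.toBimod 𝒞.l (BT.t _ _ w c)) := by
  induction w using BT.ind with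
  | ht x c' => rw [BT.assoc_t, BT.assoc_t, BT.ract_tensor_t, BT.ract_t]
  | hadd x y hx hy => simp only [map_add, LinearMap.add_apply, hx, hy]

/-- For `w = m ⊗ c`, the map `x ⊗ d ↦ m ⊗ c ⊗ x ⊗ d`. -/
noncomputable def psi (w : BT S.ract 𝒞.l) : BT E.ract 𝒟.l
    →ₗ[k] BT (BT.ract S.ract (𝒞.toBimod.tensor E.bimod)) 𝒟.l :=
  BT.map ((BT.assoc S.ract 𝒞.toBimod 𝒞.l).comp (BT.t _ _ w)) LinearMap.id
    (E.assoc_t_ract S w) (fun _ _ => rfl)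

theorem psi_add (w w' : BT S.ract 𝒞.l) : E.psi S (w + w') = E.psi S w + E.psi S w' :=
  BT.ext (by simp [psi])

theorem phi_assoc (w : BT S.ract 𝒞.l) (c : C) :
    E.phi S (BT.assoc S.ract 𝒞.toBimod 𝒞.l (BT.t _ _ w c)) = E.psi S w (E.coact c) := by
  induction w using BT.ind with
  | ht m' c' =>
    rw [BT.assoc_t]
    simp only [phi, BT.map_t, LinearMap.comp_apply, LinearMap.id_apply]
    generalize E.coact c = v
    induction v using BT.ind with
    | ht x d =>
      rw [psi, BT.map_t, LinearMap.comp_apply, BT.assoc_t]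
      refine (congrArg _ (congrArg _ (BT.assocInv_t 𝒞.r E.bimod 𝒟.l c' x d))).trans ?_
      exact BT.assocInv_t S.ract (𝒞.toBimod.tensor E.bimod) 𝒟.l m' (BT.t _ _ c' x) d
    | hadd x y hx hy => simp only [map_add, hx, hy]
  | hadd x y hx hy => rw [psi_add, LinearMap.add_apply, ← hx, ← hy, map_add, LinearMap.add_apply,
      map_add, map_add]

theorem coactTensorMap_assocInv (z : BT S.ract 𝒞.l) :
    E.coactTensorMap S 𝒟.l (BT.assocInv S.ract E.bimod 𝒟.l
      (BT.map LinearMap.id E.coact (fun _ _ => rfl) E.coact_l z)) = E.phi S (coactTensor S z) := by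
  induction z using BT.ind with
  | ht m c =>
    have h : coactTensor S (BT.t _ _ m c)
        = BT.assoc S.ract 𝒞.toBimod 𝒞.l (BT.t _ _ (S.coact m) c) := by
      simp [coactTensor]
    rw [h, phi_assoc, BT.map_t, LinearMap.id_apply]
    generalize E.coact c = v
    induction v using BT.ind with
    | ht x d =>
      refine (congrArg _ (BT.assocInv_t S.ract E.bimod 𝒟.l m x d)).trans ?_
      rw [coactTensorMap, BT.map_t, psi, BT.map_t]
      simp [coactTensor]
    | hadd x y hx hy => simp only [map_add, hx, hy]
  | hadd x y hx hy => simp only [map_add, hx, hy]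

theorem tensorComulMap_assocInv (z : BT S.ract 𝒞.l) :
    E.tensorComulMap S 𝒟.l (BT.assocInv S.ract E.bimod 𝒟.l
      (BT.map LinearMap.id E.coact (fun _ _ => rfl) E.coact_l z)) = E.phi S (tensorComul S z) := by
  induction z using BT.ind with
  | ht m c =>
    simp only [tensorComul, phi, BT.map_t, LinearMap.comp_apply, LinearMap.id_apply]
    rw [← E.colinear, BT.assocInv_assoc]
    generalize E.coact c = w
    induction w using BT.ind with
    | ht x d =>
      rw [BT.map_t, LinearMap.id_apply]
      refine (congrArg _ (BT.assocInv_t S.ract E.bimod 𝒟.l m x d)).trans ?_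
      rw [tensorComulMap, BT.map_t, tensorComul, BT.map_t]
      exact (BT.assocInv_t S.ract (𝒞.toBimod.tensor E.bimod) 𝒟.l m (𝒞.comul x) d).symm
    | hadd x y hx hy => simp only [map_add, hx, hy]
  | hadd x y hx hy => simp only [map_add, hx, hy]

theorem coactCoact_equalizes (m : M) :
    E.coactTensorMap S 𝒟.l (E.coactCoact S m) = E.tensorComulMap S 𝒟.l (E.coactCoact S m) := by
  simp only [coactCoact, LinearMap.comp_apply]
  rw [coactTensorMap_assocInv, tensorComulMap_assocInv]
  congr 1
  exact S.coassoc m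

variable {E} in
theorem IsPure.existsUnique_coaction (hE : E.IsPure) :
    ∃! τ : M →ₗ[k] BT (E.indAct S) 𝒟.l, ∀ m, E.coactMap S 𝒟.l (τ m) = E.coactCoact S m := by
  choose τ hτ using fun m => hE.exists_of_eq S _ (E.coactCoact_equalizes S m)
  have hinj := hE.injective S
  refine ⟨⟨⟨τ, ?_⟩, ?_⟩, hτ, ?_⟩
  · intro m m'
    apply hinj
    rw [map_add, hτ, hτ, hτ, map_add]
  · intro a m
    apply hinj
    simp only [map_smul, hτ, RingHom.id_apply]
  · intro τ' hτ'
    ext m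
    apply hinj
    rw [hτ']
    exact (hτ m).symm

variable {E} in
/-- The right `𝒟`-coaction `τ_M` on a right `𝒞`-comodule `M` which is induced by a pure right coring
extension `𝒟` of `𝒞` (via `M ≅ M □_𝒞 𝒞`): the unique map `τ_M : M → M ⊗_L 𝒟` such that
`(ϱ ⊗_L 𝒟) ∘ τ_M = (M ⊗_A τ_𝒞) ∘ ϱ`. -/
noncomputable def IsPure.coaction (hE : E.IsPure) : M →ₗ[k] BT (E.indAct S) 𝒟.l :=
  (hE.existsUnique_coaction S).choose

variable {E} in
theorem IsPure.coactMap_coaction (hE : E.IsPure) (m : M) :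
    E.coactMap S 𝒟.l (hE.coaction S m) = E.coactCoact S m :=
  (hE.existsUnique_coaction S).choose_spec.1 m

end Induced

end RightExtension

variable (k L) in
/-- An `L`-`𝒞` bicomodule structure on `M`: a right `𝒞`-comodule with a left `L`-module structure
such that `M` is an `L`-`A` bimodule and the `𝒞`-coaction is left `L`-linear. -/
structure Bicomodule (𝒞 : Coring k A C) (M : Type u) [AddCommGroup M] [Module k M] extends
    RightComodule 𝒞 M where
  lact : L →ₗ[k] M →ₗ[k] M
  lact_one : ∀ m, lact 1 m = m
  lact_mul : ∀ l l' m, lact (l * l') m = lact l (lact l' m)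
  lr : ∀ l a m, lact l (ract a m) = ract a (lact l m)
  coact_lact : ∀ l m, coact (lact l m)
    = BT.lact ⟨lact, ract, lact_one, lact_mul, ract_one, ract_mul, lr⟩ 𝒞.l l (coact m)

namespace Bicomodule

/-- The `k`-module `_L Hom^𝒟(𝒟, M)` of left `L`-linear and right `𝒟`-colinear maps `𝒟 → M`, for an
`L`-`𝒞` bicomodule `M` and a pure right extension `𝒟` of `𝒞`. -/
structure HomD {E : RightExtension 𝒞 𝒟} (hE : E.IsPure) (S : Bicomodule k L 𝒞 M) where
  toFun : D →ₗ[k] M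
  map_l : ∀ l d, toFun (𝒟.l l d) = S.lact l (toFun d)
  map_r : ∀ l d, toFun (𝒟.r l d) = E.indAct S.toRightComodule l (toFun d)
  colinear : ∀ d, hE.coaction S.toRightComodule (toFun d)
    = BT.map toFun LinearMap.id map_r (fun _ _ => rfl) (𝒟.comul d)

/-- The `k`-module `Q̃` of `A`-`L` bilinear maps `q : 𝒞 → Hom_A(M, A)` such that
`c^(1) q(c^(2))(x) = q(c)(x^[0]) x^[1]`. -/
structure Q (E : RightExtension 𝒞 𝒟) (S : Bicomodule k L 𝒞 M) where
  toFun : C →ₗ[k] M →ₗ[k] A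
  apply_r : ∀ c a x, toFun c (S.ract a x) = toFun c x * a
  map_l : ∀ a c x, toFun (𝒞.l a c) x = a * toFun c x
  map_r : ∀ l c x, toFun (E.ract l c) x = toFun c (S.lact l x)
  compat : ∀ c x,
    BT.contrR 𝒞.r 𝒞.l 𝒞.r_mul (toFun.flip x) (fun a c => map_l a c x) (𝒞.comul c)
      = BT.contrL S.ract 𝒞.l 𝒞.l_mul (toFun c) (apply_r c) (S.coact x)

variable {E : RightExtension 𝒞 𝒟} {hE : E.IsPure} {S : Bicomodule k L 𝒞 M}

/-- The map `c ↦ q(c_[0])(p(c_[1]))`. -/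
noncomputable def evalCoact (q : Q E S) (p : HomD hE S) : C →ₗ[k] A :=
  (BT.lift (q.toFun.compl₂ p.toFun) (by
    intro l c d
    simp only [LinearMap.compl₂_apply]
    rw [q.map_r, p.map_l])).comp E.coact

theorem evalCoact_l (q : Q E S) (p : HomD hE S) (a : A) (c : C) :
    evalCoact q p (𝒞.l a c) = a * evalCoact q p c := by
  simp only [evalCoact, LinearMap.comp_apply]
  rw [E.coact_l]
  generalize E.coact c = z
  induction z using BT.ind with
  | ht x d =>
    rw [BT.lact_t, BT.lift_t, BT.lift_t]
    simp only [LinearMap.compl₂_apply]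
    exact q.map_l a x _
  | hadd x y hx hy => simp only [map_add, hx, hy, mul_add]

/-- The connecting map `(q ⧫ p)(c) = c^(1) q((c^(2))_[0])(p((c^(2))_[1]))`. -/
noncomputable def blackDiamond (q : Q E S) (p : HomD hE S) : C →ₗ[k] C :=
  (BT.contrR 𝒞.r 𝒞.l 𝒞.r_mul (evalCoact q p) (evalCoact_l q p)).comp 𝒞.comul

/-- The connecting map `(p ◇ q)(d) = p(d)^[0] q(p(d)^[1])(-)`, an endomorphism of `M` for each
`d`. -/
noncomputable def diamond (p : HomD hE S) (q : Q E S) (d : D) (x : M) : M :=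
  BT.contrR S.ract 𝒞.l S.ract_mul (q.toFun.flip x) (fun a c => q.map_l a c x)
    (S.coact (p.toFun d))

/-- Cleftness of an `L`-`𝒞` bicomodule `M` for the pure right coring extension `E` of `𝒞` by the
`L`-coring `𝒟`: there are `j ∈ _L Hom^𝒟(𝒟, M)` and `j' ∈ Q̃` such that `j' ⧫ j` is the identity map
of `𝒞`, and `j ◇ j'` is `d ↦ ε_𝒟(d) 1_T`, where the unit map of the `L`-ring `T = End^𝒞(M)` sends
`l` to the map `x ↦ l x`. -/
def IsCleft (E : RightExtension 𝒞 𝒟) (S : Bicomodule k L 𝒞 M) : Prop :=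
  ∃ (hE : E.IsPure) (j : HomD hE S) (j' : Q E S),
    (∀ c, blackDiamond j' j c = c) ∧ ∀ d x, diamond j j' d x = S.lact (𝒟.counit d) x

end Bicomodule
end Cleft

section HopfAlgebroids

variable (k L R H : Type u) [CommRing k] [Ring L] [Algebra k L] [Ring R] [Algebra k R]
  [Ring H] [Algebra k H]

/-- A left bialgebroid over `L` with total algebra `H`: source map `s`, target map `t`, and an
`L`-coring structure on `H` for the bimodule structure `l h l' = s(l) t(l') h`, such that the
coproduct `h ↦ h_(1) ⊗ h_(2)` corestricts to a unital algebra map into the Takeuchi product (a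
subspace of `H ⊗_L H` on which factorwise multiplication is well defined), and the counit is a left
character. Equations involving `h_(1) ⊗ h_(2)` are stated for all lifts of this element from
`H ⊗_L H` to `H ⊗ H`. -/
structure LeftBialgebroid where
  s : L →ₐ[k] H
  t : Lᵐᵒᵖ →ₐ[k] H
  s_mul_t : ∀ l l', s l * t (op l') = t (op l') * s l
  coring : Coring k L H
  l_eq : ∀ l h, coring.l l h = s l * h
  r_eq : ∀ l h, coring.r l h = t (op l) * h
  takeuchi : ∀ l h (v : H ⊗[k] H), BT.mk coring.r coring.l v = coring.comul h →
    BT.mk coring.r coring.l (v * (t (op l) ⊗ₜ[k] 1))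
      = BT.mk coring.r coring.l (v * (1 ⊗ₜ[k] s l))
  comul_one : coring.comul 1 = BT.t coring.r coring.l 1 1
  comul_mul : ∀ h h' (v v' : H ⊗[k] H), BT.mk coring.r coring.l v = coring.comul h →
    BT.mk coring.r coring.l v' = coring.comul h' →
    coring.comul (h * h') = BT.mk coring.r coring.l (v * v')
  counit_one : coring.counit 1 = 1
  counit_mul_s : ∀ h h', coring.counit (h * s (coring.counit h')) = coring.counit (h * h')
  counit_mul_t : ∀ h h', coring.counit (h * t (op (coring.counit h'))) = coring.counit (h * h')

/-- A right bialgebroid over `R` with total algebra `H`: source map `s`, target map `t`, and an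
`R`-coring structure on `H` for the bimodule structure `r h r' = h s(r') t(r)`, such that the
coproduct `h ↦ h^(1) ⊗ h^(2)` corestricts to a unital algebra map into the Takeuchi product, and the
counit is a right character. -/
structure RightBialgebroid where
  s : R →ₐ[k] H
  t : Rᵐᵒᵖ →ₐ[k] H
  s_mul_t : ∀ r r', s r * t (op r') = t (op r') * s r
  coring : Coring k R H
  l_eq : ∀ r h, coring.l r h = h * t (op r)
  r_eq : ∀ r h, coring.r r h = h * s r
  takeuchi : ∀ r h (v : H ⊗[k] H), BT.mk coring.r coring.l v = coring.comul h →
    BT.mk coring.r coring.l ((s r ⊗ₜ[k] 1) * v)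
      = BT.mk coring.r coring.l ((1 ⊗ₜ[k] t (op r)) * v)
  comul_one : coring.comul 1 = BT.t coring.r coring.l 1 1
  comul_mul : ∀ h h' (v v' : H ⊗[k] H), BT.mk coring.r coring.l v = coring.comul h →
    BT.mk coring.r coring.l v' = coring.comul h' →
    coring.comul (h * h') = BT.mk coring.r coring.l (v * v')
  counit_one : coring.counit 1 = 1
  counit_s_mul : ∀ h h', coring.counit (s (coring.counit h) * h') = coring.counit (h * h')
  counit_t_mul : ∀ h h', coring.counit (t (op (coring.counit h)) * h') = coring.counit (h * h')

/-- A left and a right bialgebroid on the same total algebra with compatible source and target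
maps. -/
structure BialgebroidPair where
  left : LeftBialgebroid k L H
  right : RightBialgebroid k R H
  sL_tR : ∀ r, left.s (left.coring.counit (right.t (op r))) = right.t (op r)
  tL_sR : ∀ r, left.t (op (left.coring.counit (right.s r))) = right.s r
  sR_tL : ∀ l, right.s (right.coring.counit (left.t (op l))) = left.t (op l)
  tR_sL : ∀ l, right.t (op (right.coring.counit (left.s l))) = left.s l

variable {k L R H}

namespace BialgebroidPair

variable (𝓗 : BialgebroidPair k L R H)

/-- The `L`-`R` bimodule `H`, with actions `l h r = s_L(l) h s_R(r)`. -/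
@[reducible] def bimodLR : Bimod k L R H :=
  ⟨𝓗.left.coring.l, 𝓗.right.coring.r, 𝓗.left.coring.l_one, 𝓗.left.coring.l_mul,
    𝓗.right.coring.r_one, 𝓗.right.coring.r_mul, fun l r h => by
      simp only [𝓗.left.l_eq, 𝓗.right.r_eq, mul_assoc]⟩

/-- The `R`-`L` bimodule `H`, with actions `r h l = t_L(l) h t_R(r)`. -/
@[reducible] def bimodRL : Bimod k R L H :=
  ⟨𝓗.right.coring.l, 𝓗.left.coring.r, 𝓗.right.coring.l_one, 𝓗.right.coring.l_mul,
    𝓗.left.coring.r_one, 𝓗.left.coring.r_mul, fun r l h => by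
      simp only [𝓗.right.l_eq, 𝓗.left.r_eq, mul_assoc]⟩

theorem comulL_s (l : L) (h : H) : ∀ v, BT.mk _ _ v = 𝓗.left.coring.comul h →
    𝓗.left.coring.comul (h * 𝓗.left.s l)
      = BT.mk 𝓗.left.coring.r 𝓗.left.coring.l (v * (𝓗.left.s l ⊗ₜ[k] 1)) := by
  intro v hv
  refine 𝓗.left.comul_mul h _ v _ hv ?_
  have := 𝓗.left.coring.comul_l l 1
  rw [𝓗.left.l_eq, mul_one, 𝓗.left.comul_one, BT.lact_t, 𝓗.left.l_eq, mul_one] at this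
  rw [this]
  rfl

theorem comulL_t (l : L) (h : H) : ∀ v, BT.mk _ _ v = 𝓗.left.coring.comul h →
    𝓗.left.coring.comul (h * 𝓗.left.t (op l))
      = BT.mk 𝓗.left.coring.r 𝓗.left.coring.l (v * (1 ⊗ₜ[k] 𝓗.left.t (op l))) := by
  intro v hv
  refine 𝓗.left.comul_mul h _ v _ hv ?_
  have := 𝓗.left.coring.comul_r l 1
  rw [𝓗.left.r_eq, mul_one, 𝓗.left.comul_one, BT.ract_t, 𝓗.left.r_eq, mul_one] at this
  rw [this]
  rfl

theorem comulR_s (r : R) (h : H) : ∀ v, BT.mk _ _ v = 𝓗.right.coring.comul h →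
    𝓗.right.coring.comul (𝓗.right.s r * h)
      = BT.mk 𝓗.right.coring.r 𝓗.right.coring.l ((1 ⊗ₜ[k] 𝓗.right.s r) * v) := by
  intro v hv
  refine 𝓗.right.comul_mul _ h _ v ?_ hv
  have := 𝓗.right.coring.comul_r r 1
  rw [𝓗.right.r_eq, one_mul, 𝓗.right.comul_one, BT.ract_t, 𝓗.right.r_eq, one_mul] at this
  rw [this]
  rfl

theorem comulR_t (r : R) (h : H) : ∀ v, BT.mk _ _ v = 𝓗.right.coring.comul h →
    𝓗.right.coring.comul (𝓗.right.t (op r) * h)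
      = BT.mk 𝓗.right.coring.r 𝓗.right.coring.l ((𝓗.right.t (op r) ⊗ₜ[k] 1) * v) := by
  intro v hv
  refine 𝓗.right.comul_mul _ h _ v ?_ hv
  have := 𝓗.right.coring.comul_l r 1
  rw [𝓗.right.l_eq, one_mul, 𝓗.right.comul_one, BT.lact_t, 𝓗.right.l_eq, one_mul] at this
  rw [this]
  rfl

/-- The coproduct of the left bialgebroid is left `R`-linear. -/
theorem comulL_l (r : R) (h : H) : 𝓗.left.coring.comul (𝓗.right.coring.l r h)
    = BT.lact 𝓗.bimodRL 𝓗.left.coring.l r (𝓗.left.coring.comul h) := by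
  obtain ⟨v, hv⟩ := BT.mk_surjective _ _ (𝓗.left.coring.comul h)
  rw [𝓗.right.l_eq, ← 𝓗.sL_tR, comulL_s 𝓗 _ _ v hv, ← hv, 𝓗.sL_tR]
  clear hv
  induction v using TensorProduct.induction_on with
  | zero => simp
  | tmul x y =>
    rw [Algebra.TensorProduct.tmul_mul_tmul, mul_one, BT.mk_tmul, BT.mk_tmul]
    refine ((BT.lact_t 𝓗.bimodRL _ r x y).trans ?_).symm
    rw [𝓗.right.l_eq]
  | add x y hx hy => rw [add_mul, map_add, map_add, map_add, hx, hy]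

/-- The coproduct of the left bialgebroid is right `R`-linear. -/
theorem comulL_r (r : R) (h : H) : 𝓗.left.coring.comul (𝓗.right.coring.r r h)
    = BT.ract 𝓗.left.coring.r 𝓗.bimodLR r (𝓗.left.coring.comul h) := by
  obtain ⟨v, hv⟩ := BT.mk_surjective _ _ (𝓗.left.coring.comul h)
  rw [𝓗.right.r_eq, ← 𝓗.tL_sR, comulL_t 𝓗 _ _ v hv, ← hv, 𝓗.tL_sR]
  clear hv
  induction v using TensorProduct.induction_on with
  | zero => simp
  | tmul x y =>
    rw [Algebra.TensorProduct.tmul_mul_tmul, mul_one, BT.mk_tmul, BT.mk_tmul]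
    refine ((BT.ract_t _ 𝓗.bimodLR r x y).trans ?_).symm
    rw [𝓗.right.r_eq]
  | add x y hx hy => rw [add_mul, map_add, map_add, map_add, hx, hy]

/-- The coproduct of the right bialgebroid is left `L`-linear. -/
theorem comulR_l (l : L) (h : H) : 𝓗.right.coring.comul (𝓗.left.coring.l l h)
    = BT.lact 𝓗.bimodLR 𝓗.right.coring.l l (𝓗.right.coring.comul h) := by
  obtain ⟨v, hv⟩ := BT.mk_surjective _ _ (𝓗.right.coring.comul h)
  rw [𝓗.left.l_eq, ← 𝓗.tR_sL, comulR_t 𝓗 _ _ v hv, ← hv, 𝓗.tR_sL]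
  clear hv
  induction v using TensorProduct.induction_on with
  | zero => simp
  | tmul x y =>
    rw [Algebra.TensorProduct.tmul_mul_tmul, one_mul, BT.mk_tmul, BT.mk_tmul]
    refine ((BT.lact_t 𝓗.bimodLR _ l x y).trans ?_).symm
    rw [𝓗.left.l_eq]
  | add x y hx hy => rw [mul_add, map_add, map_add, map_add, hx, hy]

/-- The coproduct of the right bialgebroid is right `L`-linear. -/
theorem comulR_r (l : L) (h : H) : 𝓗.right.coring.comul (𝓗.left.coring.r l h)
    = BT.ract 𝓗.right.coring.r 𝓗.bimodRL l (𝓗.right.coring.comul h) := by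
  obtain ⟨v, hv⟩ := BT.mk_surjective _ _ (𝓗.right.coring.comul h)
  rw [𝓗.left.r_eq, ← 𝓗.sR_tL, comulR_s 𝓗 _ _ v hv, ← hv, 𝓗.sR_tL]
  clear hv
  induction v using TensorProduct.induction_on with
  | zero => simp
  | tmul x y =>
    rw [Algebra.TensorProduct.tmul_mul_tmul, one_mul, BT.mk_tmul, BT.mk_tmul]
    refine ((BT.ract_t _ 𝓗.bimodRL l x y).trans ?_).symm
    rw [𝓗.left.r_eq]
  | add x y hx hy => rw [mul_add, map_add, map_add, map_add, hx, hy]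

end BialgebroidPair

variable (k L R H) in
/-- A Hopf algebroid: a left bialgebroid over `L` and a right bialgebroid over `R` on the same total
algebra `H`, with compatible source and target maps, coproducts `γ_L`, `γ_R` satisfying
`(γ_L ⊗_R H) γ_R = (H ⊗_L γ_R) γ_L` and `(γ_R ⊗_L H) γ_L = (H ⊗_R γ_L) γ_R`, and an antipode. -/
structure HopfAlgebroid extends BialgebroidPair k L R H where
  coassoc_LR : ∀ h,
    BT.assoc left.coring.r toBialgebroidPair.bimodLR right.coring.l
      (BT.map left.coring.comul LinearMap.id toBialgebroidPair.comulL_r (fun _ _ => rfl)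
        (right.coring.comul h))
    = BT.map LinearMap.id right.coring.comul (fun _ _ => rfl) toBialgebroidPair.comulR_l
        (left.coring.comul h)
  coassoc_RL : ∀ h,
    BT.assoc right.coring.r toBialgebroidPair.bimodRL left.coring.l
      (BT.map right.coring.comul LinearMap.id toBialgebroidPair.comulR_r (fun _ _ => rfl)
        (left.coring.comul h))
    = BT.map LinearMap.id left.coring.comul (fun _ _ => rfl) toBialgebroidPair.comulL_l
        (right.coring.comul h)
  antipode : H →ₗ[k] H
  antipode_bilinear : ∀ l r h, antipode (left.t (op l) * h * right.t (op r))
    = right.s r * antipode h * left.s l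
  antipode_mul_id : ∀ h (v : H ⊗[k] H),
    BT.mk left.coring.r left.coring.l v = left.coring.comul h →
    LinearMap.mul' k H (TensorProduct.map antipode LinearMap.id v) = right.s (right.coring.counit h)
  id_mul_antipode : ∀ h (v : H ⊗[k] H),
    BT.mk right.coring.r right.coring.l v = right.coring.comul h →
    LinearMap.mul' k H (TensorProduct.map LinearMap.id antipode v) = left.s (left.coring.counit h)

namespace HopfAlgebroid

variable (𝓗 : HopfAlgebroid k L R H)

/-- The `L`-coring underlying the left bialgebroid is a right extension of the `R`-coring underlying
the right bialgebroid, via the coproduct of the left bialgebroid. -/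
@[reducible] def extensionL : RightExtension 𝓗.right.coring 𝓗.left.coring where
  ract := 𝓗.left.coring.r
  ract_one := 𝓗.left.coring.r_one
  ract_mul := 𝓗.left.coring.r_mul
  coact := 𝓗.left.coring.comul
  coact_r := 𝓗.left.coring.comul_r
  coassoc := 𝓗.left.coring.coassoc
  counit := 𝓗.left.coring.comul_counit
  lr := 𝓗.bimodRL.lr
  coact_l := 𝓗.comulL_l
  comul_ract := 𝓗.comulR_r
  colinear := 𝓗.coassoc_RL

/-- The `R`-coring underlying the right bialgebroid is a right extension of the `L`-coring underlying
the left bialgebroid, via the coproduct of the right bialgebroid. -/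
@[reducible] def extensionR : RightExtension 𝓗.left.coring 𝓗.right.coring where
  ract := 𝓗.right.coring.r
  ract_one := 𝓗.right.coring.r_one
  ract_mul := 𝓗.right.coring.r_mul
  coact := 𝓗.right.coring.comul
  coact_r := 𝓗.right.coring.comul_r
  coassoc := 𝓗.right.coring.coassoc
  counit := 𝓗.right.coring.comul_counit
  lr := 𝓗.bimodLR.lr
  coact_l := 𝓗.comulR_l
  comul_ract := 𝓗.comulL_r
  colinear := 𝓗.coassoc_LR

/-- A Hopf algebroid is pure if both of these coring extensions are pure. -/
def IsPure : Prop := 𝓗.extensionL.IsPure ∧ 𝓗.extensionR.IsPure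

end HopfAlgebroid

end HopfAlgebroids

section ComoduleAlgebras

variable {k L R H A : Type u} [CommRing k] [Ring L] [Algebra k L] [Ring R] [Algebra k R]
  [Ring H] [Algebra k H] [Ring A] [Algebra k A]

/-- A right comodule algebra `A` over a right bialgebroid: an `R`-ring `A` with unit map `η`, which
is a right comodule over the underlying `R`-coring, such that the coaction
`a ↦ a^[0] ⊗ a^[1]` corestricts to a unital algebra map into the Takeuchi product in `A ⊗_R H`. -/
structure ComoduleAlgebra (𝓑 : RightBialgebroid k R H) (A : Type u) [Ring A] [Algebra k A] where
  η : R →ₐ[k] A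
  comodule : RightComodule 𝓑.coring A
  ract_eq : ∀ r a, comodule.ract r a = a * η r
  takeuchi : ∀ r a (v : A ⊗[k] H), BT.mk comodule.ract 𝓑.coring.l v = comodule.coact a →
    BT.mk comodule.ract 𝓑.coring.l ((η r ⊗ₜ[k] 1) * v)
      = BT.mk comodule.ract 𝓑.coring.l ((1 ⊗ₜ[k] 𝓑.t (op r)) * v)
  coact_one : comodule.coact 1 = BT.t comodule.ract 𝓑.coring.l 1 1
  coact_mul : ∀ a a' (v v' : A ⊗[k] H),
    BT.mk comodule.ract 𝓑.coring.l v = comodule.coact a →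
    BT.mk comodule.ract 𝓑.coring.l v' = comodule.coact a' →
    comodule.coact (a * a') = BT.mk comodule.ract 𝓑.coring.l (v * v')

namespace ComoduleAlgebra

variable {𝓑 : RightBialgebroid k R H} (𝓐 : ComoduleAlgebra 𝓑 A)

/-- The balanced tensor product `A ⊗_R H`. -/
abbrev AH : Type u := BT 𝓐.comodule.ract 𝓑.coring.l

/-- The map `b ⊗ y ↦ a b ⊗ h y`. -/
noncomputable def mulAH : A →ₗ[k] H →ₗ[k] 𝓐.AH →ₗ[k] 𝓐.AH :=
  LinearMap.mk₂ k
    (fun a h => BT.map (LinearMap.mulLeft k a) (LinearMap.mulLeft k h)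
      (fun r b => by simp [𝓐.ract_eq, mul_assoc]) (fun r y => by simp [𝓑.l_eq, mul_assoc]))
    (fun a a' h => BT.ext (by simp [add_mul]))
    (fun x a h => BT.ext (by simp))
    (fun a h h' => BT.ext (by simp [add_mul]))
    (fun x a h => BT.ext (by simp))

theorem mulAH_t (a b : A) (h y : H) : 𝓐.mulAH a h (BT.t _ _ b y) = BT.t _ _ (a * b) (h * y) := by
  simp [mulAH]

theorem mulAH_mk (a : A) (h : H) (v : A ⊗[k] H) :
    𝓐.mulAH a h (BT.mk _ _ v) = BT.mk _ _ ((a ⊗ₜ[k] h) * v) := by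
  induction v using TensorProduct.induction_on with
  | zero => simp
  | tmul b y => rw [BT.mk_tmul, mulAH_t, Algebra.TensorProduct.tmul_mul_tmul, BT.mk_tmul]
  | add x y hx hy => rw [map_add, map_add, hx, hy, mul_add, map_add]

theorem mulAH_bal (r : R) (a : A) (h : H) (b : A) :
    𝓐.mulAH (𝓐.comodule.ract r a) h (𝓐.comodule.coact b)
      = 𝓐.mulAH a (𝓑.coring.l r h) (𝓐.comodule.coact b) := by
  obtain ⟨v, hv⟩ := BT.mk_surjective _ _ (𝓐.comodule.coact b)
  have h1 : 𝓐.comodule.ract r a ⊗ₜ[k] h = (a ⊗ₜ[k] h) * (𝓐.η r ⊗ₜ[k] 1) := by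
    rw [Algebra.TensorProduct.tmul_mul_tmul, mul_one, 𝓐.ract_eq]
  have h2 : a ⊗ₜ[k] 𝓑.coring.l r h = (a ⊗ₜ[k] h) * (1 ⊗ₜ[k] 𝓑.t (op r)) := by
    rw [Algebra.TensorProduct.tmul_mul_tmul, mul_one, 𝓑.l_eq]
  rw [← hv, mulAH_mk, mulAH_mk, h1, h2, mul_assoc, mul_assoc, ← mulAH_mk,
    𝓐.takeuchi r b v hv, mulAH_mk]

/-- The right `A`-action `(b ⊗ h) a = b a^[0] ⊗ h a^[1]` on `A ⊗_R H`. -/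
noncomputable def ractAH : A →ₗ[k] 𝓐.AH →ₗ[k] 𝓐.AH where
  toFun a := BT.lift (LinearMap.mk₂ k (fun b h => 𝓐.mulAH b h (𝓐.comodule.coact a))
      (by simp) (by simp) (by simp) (by simp)) (by
    intro r b h
    simp only [LinearMap.mk₂_apply]
    exact 𝓐.mulAH_bal r b h a)
  map_add' a a' := BT.ext (by simp)
  map_smul' x a := BT.ext (by simp)

theorem ractAH_t (a b : A) (h : H) :
    𝓐.ractAH a (BT.t _ _ b h) = 𝓐.mulAH b h (𝓐.comodule.coact a) := by
  simp [ractAH]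

theorem ractAH_mk (a : A) (v w : A ⊗[k] H) (hv : BT.mk _ _ v = 𝓐.comodule.coact a) :
    𝓐.ractAH a (BT.mk _ _ w) = BT.mk _ _ (w * v) := by
  induction w using TensorProduct.induction_on with
  | zero => simp
  | tmul b y => rw [BT.mk_tmul, ractAH_t, ← hv, mulAH_mk]
  | add x y hx hy => rw [map_add, map_add, hx, hy, add_mul, map_add]

theorem coact_mul' (a a' : A) : 𝓐.comodule.coact (a * a') = 𝓐.ractAH a' (𝓐.comodule.coact a) := by
  obtain ⟨v, hv⟩ := BT.mk_surjective _ _ (𝓐.comodule.coact a)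
  obtain ⟨v', hv'⟩ := BT.mk_surjective _ _ (𝓐.comodule.coact a')
  rw [𝓐.coact_mul a a' v v' hv hv', ← hv, 𝓐.ractAH_mk a' v' v hv']

/-- The `A`-`A` bimodule structure of `A ⊗_R H`. -/
noncomputable def bimodAH : Bimod k A A 𝓐.AH where
  l := 𝓐.mulAH.flip 1
  r := 𝓐.ractAH
  l_one z := by
    induction z using BT.ind with
    | ht b h => simp [mulAH_t]
    | hadd x y hx hy => rw [map_add, hx, hy]
  l_mul a a' z := by
    induction z using BT.ind with
    | ht b h => simp [mulAH_t, mul_assoc]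
    | hadd x y hx hy => rw [map_add, hx, hy, map_add, map_add]
  r_one z := by
    obtain ⟨w, rfl⟩ := BT.mk_surjective _ _ z
    rw [𝓐.ractAH_mk 1 1 w 𝓐.coact_one.symm, mul_one]
  r_mul a a' z := by
    obtain ⟨w, rfl⟩ := BT.mk_surjective _ _ z
    obtain ⟨v, hv⟩ := BT.mk_surjective _ _ (𝓐.comodule.coact a)
    obtain ⟨v', hv'⟩ := BT.mk_surjective _ _ (𝓐.comodule.coact a')
    rw [𝓐.ractAH_mk a v w hv, 𝓐.ractAH_mk a' v' _ hv',
      𝓐.ractAH_mk (a * a') (v * v') w (𝓐.coact_mul a a' v v' hv hv').symm, mul_assoc]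
  lr a a' z := by
    obtain ⟨w, rfl⟩ := BT.mk_surjective _ _ z
    obtain ⟨v, hv⟩ := BT.mk_surjective _ _ (𝓐.comodule.coact a')
    simp only [LinearMap.flip_apply]
    rw [𝓐.ractAH_mk a' v w hv, 𝓐.mulAH_mk, 𝓐.mulAH_mk, 𝓐.ractAH_mk a' v _ hv, mul_assoc]

theorem bimodAH_l_t (a b : A) (h : H) :
    𝓐.bimodAH.l a (BT.t _ _ b h) = BT.t _ _ (a * b) h := by
  change 𝓐.mulAH a 1 _ = _
  rw [mulAH_t, one_mul]

theorem coact_η (r : R) : 𝓐.comodule.coact (𝓐.η r) = BT.t _ _ 1 (𝓑.s r) := by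
  have := 𝓐.comodule.coact_r r 1
  rw [𝓐.ract_eq, one_mul, 𝓐.coact_one, BT.ract_t, 𝓑.r_eq, one_mul] at this
  exact this

theorem bimodAH_r_η (r : R) (b : A) (h : H) :
    𝓐.bimodAH.r (𝓐.η r) (BT.t _ _ b h) = BT.t _ _ b (𝓑.coring.r r h) := by
  change 𝓐.ractAH _ _ = _
  rw [ractAH_t, coact_η, mulAH_t, mul_one, 𝓑.r_eq]

theorem tens_bal (b : A) (r : R) (h y : H) :
    BT.t 𝓐.bimodAH.r 𝓐.bimodAH.l (BT.t _ _ b (𝓑.coring.r r h)) (BT.t _ _ 1 y)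
      = BT.t 𝓐.bimodAH.r 𝓐.bimodAH.l (BT.t _ _ b h) (BT.t _ _ 1 (𝓑.coring.l r y)) := by
  rw [← bimodAH_r_η, BT.t_bal, bimodAH_l_t, mul_one, ← BT.t_bal, 𝓐.ract_eq, one_mul]

/-- The map `y ⊗ y' ↦ (a ⊗ y) ⊗ (1 ⊗ y')`. -/
noncomputable def kappaAux (a : A) :
    BT 𝓑.coring.r 𝓑.coring.l →ₗ[k] BT 𝓐.bimodAH.r 𝓐.bimodAH.l :=
  BT.lift ((BT.t 𝓐.bimodAH.r 𝓐.bimodAH.l).compl₁₂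
    (BT.t 𝓐.comodule.ract 𝓑.coring.l a) (BT.t 𝓐.comodule.ract 𝓑.coring.l 1))
    (by
      intro r h y
      simp only [LinearMap.compl₁₂_apply]
      exact 𝓐.tens_bal a r h y)

theorem kappaAux_t (a : A) (y y' : H) : 𝓐.kappaAux a (BT.t _ _ y y')
    = BT.t 𝓐.bimodAH.r 𝓐.bimodAH.l (BT.t _ _ a y) (BT.t _ _ 1 y') := by
  exact BT.lift_t _ _ y y'

/-- The map `A ⊗_R H ⊗_R H → (A ⊗_R H) ⊗_A (A ⊗_R H)`, `a ⊗ y ⊗ y' ↦ (a ⊗ y) ⊗ (1 ⊗ y')`. -/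
noncomputable def kappa : BT 𝓐.comodule.ract (BT.lact 𝓑.coring.toBimod 𝓑.coring.l)
    →ₗ[k] BT 𝓐.bimodAH.r 𝓐.bimodAH.l :=
  BT.lift
    { toFun := 𝓐.kappaAux
      map_add' := fun a a' => BT.ext (by simp [kappaAux_t])
      map_smul' := fun x a => BT.ext (by simp [kappaAux_t]) }
    (by
      intro r a z
      simp only [LinearMap.coe_mk, AddHom.coe_mk]
      induction z using BT.ind with
      | ht y y' => rw [BT.lact_t, kappaAux_t, kappaAux_t, BT.t_bal]
      | hadd x y hx hy => rw [map_add, hx, hy, map_add, map_add])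

theorem kappa_t (a : A) (z : BT 𝓑.coring.r 𝓑.coring.l) :
    𝓐.kappa (BT.t _ _ a z) = 𝓐.kappaAux a z := by
  exact BT.lift_t _ _ a z

/-- The coproduct `a ⊗ h ↦ (a ⊗ h^(1)) ⊗ (1 ⊗ h^(2))` of `A ⊗_R H`. -/
noncomputable def comulAH : 𝓐.AH →ₗ[k] BT 𝓐.bimodAH.r 𝓐.bimodAH.l :=
  𝓐.kappa.comp (BT.map LinearMap.id 𝓑.coring.comul (fun _ _ => rfl) 𝓑.coring.comul_l)

theorem comulAH_t (a : A) (h : H) :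
    𝓐.comulAH (BT.t _ _ a h) = 𝓐.kappaAux a (𝓑.coring.comul h) := by
  rw [comulAH, LinearMap.comp_apply, BT.map_t, kappa_t]; rfl

/-- The counit `a ⊗ h ↦ a η(π_R(h))` of `A ⊗_R H`. -/
noncomputable def counitAH : 𝓐.AH →ₗ[k] A :=
  BT.contrR 𝓐.comodule.ract 𝓑.coring.l 𝓐.comodule.ract_mul 𝓑.coring.counit 𝓑.coring.counit_l

theorem counitAH_t (a : A) (h : H) :
    𝓐.counitAH (BT.t _ _ a h) = a * 𝓐.η (𝓑.coring.counit h) := by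
  rw [counitAH, BT.contrR_t, 𝓐.ract_eq]

theorem comulAH_l (a : A) (z : 𝓐.AH) :
    𝓐.comulAH (𝓐.bimodAH.l a z) = BT.lact 𝓐.bimodAH 𝓐.bimodAH.l a (𝓐.comulAH z) := by
  induction z using BT.ind with
  | ht b h =>
    rw [bimodAH_l_t, comulAH_t, comulAH_t]
    generalize 𝓑.coring.comul h = w
    induction w using BT.ind with
    | ht y y' => rw [kappaAux_t, kappaAux_t, BT.lact_t, bimodAH_l_t]
    | hadd x y hx hy => simp only [map_add, hx, hy]
  | hadd x y hx hy => simp only [map_add, hx, hy]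

/-- The map `x ⊗ x' ↦ y x ⊗ y' x'`. -/
noncomputable def mulHH (𝓑 : RightBialgebroid k R H) : H →ₗ[k] H →ₗ[k]
    BT 𝓑.coring.r 𝓑.coring.l →ₗ[k] BT 𝓑.coring.r 𝓑.coring.l :=
  LinearMap.mk₂ k
    (fun y y' => BT.map (LinearMap.mulLeft k y) (LinearMap.mulLeft k y')
      (fun r x => by simp [𝓑.r_eq, mul_assoc]) (fun r x => by simp [𝓑.l_eq, mul_assoc]))
    (fun a a' h => BT.ext (by simp [add_mul]))
    (fun x a h => BT.ext (by simp))
    (fun a h h' => BT.ext (by simp [add_mul]))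
    (fun x a h => BT.ext (by simp))

theorem mulHH_t (y y' x x' : H) :
    mulHH 𝓑 y y' (BT.t _ _ x x') = BT.t _ _ (y * x) (y' * x') := by
  simp [mulHH]

theorem mulHH_mk (y y' : H) (v : H ⊗[k] H) :
    mulHH 𝓑 y y' (BT.mk _ _ v) = BT.mk _ _ ((y ⊗ₜ[k] y') * v) := by
  induction v using TensorProduct.induction_on with
  | zero => simp
  | tmul b y => rw [BT.mk_tmul, mulHH_t, Algebra.TensorProduct.tmul_mul_tmul, BT.mk_tmul]
  | add x y hx hy => rw [map_add, map_add, hx, hy, mul_add, map_add]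

theorem mulHH_l (y y' : H) (r : R) (z : BT 𝓑.coring.r 𝓑.coring.l) :
    mulHH 𝓑 y y' (BT.lact 𝓑.coring.toBimod 𝓑.coring.l r z)
      = BT.lact 𝓑.coring.toBimod 𝓑.coring.l r (mulHH 𝓑 y y' z) := by
  induction z using BT.ind with
  | ht x x' => simp [mulHH_t, 𝓑.l_eq, mul_assoc]
  | hadd x y hx hy => simp only [map_add, hx, hy]

/-- The map `x ⊗ z ↦ b x ⊗ (y ⊗ y') z`. -/
noncomputable def mulAHH (b : A) (y y' : H) :
    BT 𝓐.comodule.ract (BT.lact 𝓑.coring.toBimod 𝓑.coring.l)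
      →ₗ[k] BT 𝓐.comodule.ract (BT.lact 𝓑.coring.toBimod 𝓑.coring.l) :=
  BT.map (LinearMap.mulLeft k b) (mulHH 𝓑 y y')
    (fun r x => by simp [𝓐.ract_eq, mul_assoc]) (fun r z => mulHH_l y y' r z)

theorem mulAHH_t (b x : A) (y y' : H) (z : BT 𝓑.coring.r 𝓑.coring.l) :
    𝓐.mulAHH b y y' (BT.t _ _ x z) = BT.t _ _ (b * x) (mulHH 𝓑 y y' z) := by
  simp [mulAHH]

/-- The map `mulAHH` as a linear map on `H ⊗ H`. -/
noncomputable def mulAHHL (b : A) : H ⊗[k] H →ₗ[k]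
    BT 𝓐.comodule.ract (BT.lact 𝓑.coring.toBimod 𝓑.coring.l)
      →ₗ[k] BT 𝓐.comodule.ract (BT.lact 𝓑.coring.toBimod 𝓑.coring.l) :=
  TensorProduct.lift (LinearMap.mk₂ k (𝓐.mulAHH b)
    (fun y y' h => BT.ext (by simp [mulAHH_t]))
    (fun c y h => BT.ext (by simp [mulAHH_t]))
    (fun y h h' => BT.ext (by simp [mulAHH_t]))
    (fun c y h => BT.ext (by simp [mulAHH_t])))

theorem mulAHHL_tmul (b : A) (y y' : H) : 𝓐.mulAHHL b (y ⊗ₜ[k] y') = 𝓐.mulAHH b y y' := by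
  simp [mulAHHL]

theorem mulAHHL_t (b x : A) (g v : H ⊗[k] H) :
    𝓐.mulAHHL b g (BT.t _ _ x (BT.mk _ _ v)) = BT.t _ _ (b * x) (BT.mk _ _ (g * v)) := by
  induction g using TensorProduct.induction_on with
  | zero => simp
  | tmul y y' => rw [mulAHHL_tmul, mulAHH_t, mulHH_mk]
  | add g g' h h' => rw [map_add, LinearMap.add_apply, h, h', add_mul, map_add, map_add]

theorem map_comul_mulAH (b : A) (h : H) (g : H ⊗[k] H)
    (hg : BT.mk _ _ g = 𝓑.coring.comul h) (w : 𝓐.AH) :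
    BT.map LinearMap.id 𝓑.coring.comul (fun _ _ => rfl) 𝓑.coring.comul_l (𝓐.mulAH b h w)
      = 𝓐.mulAHHL b g
        (BT.map LinearMap.id 𝓑.coring.comul (fun _ _ => rfl) 𝓑.coring.comul_l w) := by
  induction w using BT.ind with
  | ht x y =>
    obtain ⟨v, hv⟩ := BT.mk_surjective _ _ (𝓑.coring.comul y)
    rw [mulAH_t, BT.map_t, BT.map_t, ← hv, 𝓑.comul_mul h y g v hg hv, LinearMap.id_apply,
      LinearMap.id_apply, mulAHHL_t]
  | hadd x y hx hy => simp only [map_add, hx, hy]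

theorem mulAHH_assoc (b : A) (h h' : H) (z : 𝓐.AH) (y' : H) :
    𝓐.mulAHH b h h' (BT.assoc _ 𝓑.coring.toBimod 𝓑.coring.l (BT.t _ _ z y'))
      = BT.assoc _ 𝓑.coring.toBimod 𝓑.coring.l (BT.t _ _ (𝓐.mulAH b h z) (h' * y')) := by
  induction z using BT.ind with
  | ht x y => rw [BT.assoc_t, mulAHH_t, mulHH_t, mulAH_t, BT.assoc_t]
  | hadd x y hx hy => simp only [map_add, LinearMap.add_apply, hx, hy]

theorem kappa_assoc (z : 𝓐.AH) (y : H) :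
    𝓐.kappa (BT.assoc _ 𝓑.coring.toBimod 𝓑.coring.l (BT.t _ _ z y))
      = BT.t 𝓐.bimodAH.r 𝓐.bimodAH.l z (BT.t _ _ 1 y) := by
  induction z using BT.ind with
  | ht a x => rw [BT.assoc_t, kappa_t, kappaAux_t]
  | hadd x y hx hy => simp only [map_add, LinearMap.add_apply, hx, hy]

theorem ract_kappa (a b : A) (h h' : H) :
    BT.t 𝓐.bimodAH.r 𝓐.bimodAH.l (BT.t _ _ b h) (𝓐.bimodAH.r a (BT.t _ _ 1 h'))
      = 𝓐.kappa (𝓐.mulAHH b h h'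
        (BT.map LinearMap.id 𝓑.coring.comul (fun _ _ => rfl) 𝓑.coring.comul_l
          (𝓐.comodule.coact a))) := by
  have h1 : 𝓐.bimodAH.r a (BT.t _ _ 1 h') = 𝓐.mulAH 1 h' (𝓐.comodule.coact a) :=
    𝓐.ractAH_t a 1 h'
  rw [h1, ← 𝓐.comodule.coassoc]
  generalize 𝓐.comodule.coact a = w
  induction w using BT.ind with
  | ht x y =>
    rw [mulAH_t, one_mul, BT.map_t, LinearMap.id_apply, mulAHH_assoc, kappa_assoc]
    have h2 : BT.t 𝓐.comodule.ract 𝓑.coring.l x (h' * y)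
        = 𝓐.bimodAH.l x (BT.t _ _ 1 (h' * y)) := by rw [bimodAH_l_t, mul_one]
    rw [h2, ← BT.t_bal]
    congr 2
  | hadd x y hx hy => simp only [map_add, hx, hy]

theorem comulAH_r (a : A) (z : 𝓐.AH) :
    𝓐.comulAH (𝓐.bimodAH.r a z) = BT.ract 𝓐.bimodAH.r 𝓐.bimodAH a (𝓐.comulAH z) := by
  induction z using BT.ind with
  | ht b h =>
    have h1 : 𝓐.bimodAH.r a (BT.t _ _ b h) = 𝓐.mulAH b h (𝓐.comodule.coact a) :=
      𝓐.ractAH_t a b h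
    obtain ⟨g, hg⟩ := BT.mk_surjective _ _ (𝓑.coring.comul h)
    rw [h1, comulAH_t, comulAH, LinearMap.comp_apply, map_comul_mulAH 𝓐 b h g hg, ← hg]
    clear hg
    induction g using TensorProduct.induction_on with
    | zero => simp
    | tmul y y' => rw [BT.mk_tmul, kappaAux_t, BT.ract_t, ract_kappa, mulAHHL_tmul]
    | add x y hx hy => simp only [map_add, LinearMap.add_apply, hx, hy]
  | hadd x y hx hy => simp only [map_add, hx, hy]

theorem counitAH_l (a : A) (z : 𝓐.AH) : 𝓐.counitAH (𝓐.bimodAH.l a z) = a * 𝓐.counitAH z := by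
  induction z using BT.ind with
  | ht b h => rw [bimodAH_l_t, counitAH_t, counitAH_t, mul_assoc]
  | hadd x y hx hy => rw [map_add, map_add, hx, hy, map_add, mul_add]

theorem counitAH_mulAH (b : A) (h : H) (z : 𝓐.AH) :
    𝓐.counitAH (𝓐.mulAH b h z)
      = b * 𝓐.counitAH (𝓐.mulAH 1 (𝓑.s (𝓑.coring.counit h)) z) := by
  induction z using BT.ind with
  | ht x y =>
    rw [mulAH_t, mulAH_t, counitAH_t, counitAH_t, one_mul, 𝓑.counit_s_mul, mul_assoc]
  | hadd x y hx hy => simp only [map_add, hx, hy, mul_add]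

theorem counitAH_coact (a : A) : 𝓐.counitAH (𝓐.comodule.coact a) = a := 𝓐.comodule.counit a

theorem counitAH_r (a : A) (z : 𝓐.AH) : 𝓐.counitAH (𝓐.bimodAH.r a z) = 𝓐.counitAH z * a := by
  induction z using BT.ind with
  | ht b h =>
    have h1 : 𝓐.bimodAH.r a (BT.t _ _ b h) = 𝓐.mulAH b h (𝓐.comodule.coact a) :=
      𝓐.ractAH_t a b h
    have h2 : 𝓐.comodule.coact (𝓐.η (𝓑.coring.counit h) * a)
        = 𝓐.mulAH 1 (𝓑.s (𝓑.coring.counit h)) (𝓐.comodule.coact a) := by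
      rw [coact_mul', coact_η, ractAH_t]
    rw [h1, counitAH_mulAH, ← h2, counitAH_coact, counitAH_t, mul_assoc]
  | hadd x y hx hy => rw [map_add, map_add, hx, hy, map_add, add_mul]

/-- The map `x ⊗ z ↦ (a ⊗ x) ⊗ kappa(1 ⊗ z)`. -/
noncomputable def kappa3 (a : A) : BT 𝓑.coring.r (BT.lact 𝓑.coring.toBimod 𝓑.coring.l)
    →ₗ[k] BT 𝓐.bimodAH.r (BT.lact 𝓐.bimodAH 𝓐.bimodAH.l) :=
  BT.lift ((BT.t 𝓐.bimodAH.r (BT.lact 𝓐.bimodAH 𝓐.bimodAH.l)).compl₁₂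
    (BT.t 𝓐.comodule.ract 𝓑.coring.l a) (𝓐.kappaAux 1)) (by
      intro r x z
      simp only [LinearMap.compl₁₂_apply]
      rw [← bimodAH_r_η, BT.t_bal]
      congr 1
      induction z using BT.ind with
      | ht y y' =>
        rw [BT.lact_t, kappaAux_t, kappaAux_t, BT.lact_t, bimodAH_l_t, mul_one, ← BT.t_bal,
          𝓐.ract_eq, one_mul]
      | hadd x y hx hy => simp only [map_add, hx, hy])

theorem kappa3_t (a : A) (x : H) (z : BT 𝓑.coring.r 𝓑.coring.l) :
    𝓐.kappa3 a (BT.t _ _ x z)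
      = BT.t 𝓐.bimodAH.r (BT.lact 𝓐.bimodAH 𝓐.bimodAH.l) (BT.t _ _ a x) (𝓐.kappaAux 1 z) := by
  exact BT.lift_t _ _ x z

/-- The `A`-coring `A ⊗_R H` associated to a right comodule algebra `A`. -/
@[reducible] noncomputable def coring : Coring k A 𝓐.AH where
  toBimod := 𝓐.bimodAH
  comul := 𝓐.comulAH
  comul_l := 𝓐.comulAH_l
  comul_r := 𝓐.comulAH_r
  counit := 𝓐.counitAH
  counit_l := 𝓐.counitAH_l
  counit_r := 𝓐.counitAH_r
  coassoc z := by
    induction z using BT.ind with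
    | ht a h =>
      have h1 : ∀ w, BT.assoc 𝓐.bimodAH.r 𝓐.bimodAH 𝓐.bimodAH.l
          (BT.map 𝓐.comulAH LinearMap.id 𝓐.comulAH_r (fun _ _ => rfl) (𝓐.kappaAux a w))
          = 𝓐.kappa3 a (BT.assoc 𝓑.coring.r 𝓑.coring.toBimod 𝓑.coring.l
            (BT.map 𝓑.coring.comul LinearMap.id 𝓑.coring.comul_r (fun _ _ => rfl) w)) := by
        intro w
        induction w using BT.ind with
        | ht y y' =>
          rw [kappaAux_t, BT.map_t, BT.map_t, comulAH_t]
          generalize 𝓑.coring.comul y = v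
          induction v using BT.ind with
          | ht x x' =>
            rw [kappaAux_t, BT.assoc_t, BT.assoc_t, kappa3_t, kappaAux_t]
            rfl
          | hadd x y hx hy => simp only [map_add, LinearMap.add_apply, hx, hy]
        | hadd x y hx hy => simp only [map_add, hx, hy]
      have h2 : ∀ w,
          BT.map LinearMap.id 𝓐.comulAH (fun _ _ => rfl) 𝓐.comulAH_l (𝓐.kappaAux a w)
          = 𝓐.kappa3 a (BT.map LinearMap.id 𝓑.coring.comul (fun _ _ => rfl)
            𝓑.coring.comul_l w) := by
        intro w
        induction w using BT.ind with
        | ht y y' =>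
          rw [kappaAux_t, BT.map_t, BT.map_t, comulAH_t, kappa3_t]
          rfl
        | hadd x y hx hy => simp only [map_add, hx, hy]
      rw [comulAH_t, h1, h2, 𝓑.coring.coassoc]
    | hadd x y hx hy => simp only [map_add, hx, hy]
  counit_comul z := by
    induction z using BT.ind with
    | ht a h =>
      rw [comulAH_t]
      have h1 : ∀ w, BT.contrL 𝓐.bimodAH.r 𝓐.bimodAH.l 𝓐.bimodAH.l_mul 𝓐.counitAH 𝓐.counitAH_r
          (𝓐.kappaAux a w) = BT.t _ _ a (BT.contrL 𝓑.coring.r 𝓑.coring.l 𝓑.coring.l_mul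
            𝓑.coring.counit 𝓑.coring.counit_r w) := by
        intro w
        induction w using BT.ind with
        | ht y y' =>
          rw [kappaAux_t, BT.contrL_t, BT.contrL_t, counitAH_t, bimodAH_l_t, mul_one,
            ← 𝓐.ract_eq, BT.t_bal]
        | hadd x y hx hy => simp only [map_add, hx, hy]
      rw [h1, 𝓑.coring.counit_comul]
    | hadd x y hx hy => simp only [map_add, hx, hy]
  comul_counit z := by
    induction z using BT.ind with
    | ht a h =>
      rw [comulAH_t]
      have h1 : ∀ w, BT.contrR 𝓐.bimodAH.r 𝓐.bimodAH.l 𝓐.bimodAH.r_mul 𝓐.counitAH 𝓐.counitAH_l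
          (𝓐.kappaAux a w) = BT.t _ _ a (BT.contrR 𝓑.coring.r 𝓑.coring.l 𝓑.coring.r_mul
            𝓑.coring.counit 𝓑.coring.counit_l w) := by
        intro w
        induction w using BT.ind with
        | ht y y' =>
          rw [kappaAux_t, BT.contrR_t, BT.contrR_t, counitAH_t, one_mul, bimodAH_r_η]
        | hadd x y hx hy => simp only [map_add, hx, hy]
      rw [h1, 𝓑.coring.comul_counit]
    | hadd x y hx hy => simp only [map_add, hx, hy]

end ComoduleAlgebra
end ComoduleAlgebras

section CleftExtensions

variable {k L R H A : Type u} [CommRing k] [Ring L] [Algebra k L] [Ring R] [Algebra k R]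
  [Ring H] [Algebra k H] [Ring A] [Algebra k A]

namespace ComoduleAlgebra

section Extension

variable {𝓗 : HopfAlgebroid k L R H} (𝓐 : ComoduleAlgebra 𝓗.right A)

/-- The right `L`-action `(a ⊗ h) l = a ⊗ t_L(l) h` on `A ⊗_R H`. -/
noncomputable def ractL : L →ₗ[k] 𝓐.AH →ₗ[k] 𝓐.AH :=
  BT.ract 𝓐.comodule.ract 𝓗.bimodRL

theorem ractL_t (l : L) (a : A) (h : H) :
    𝓐.ractL l (BT.t _ _ a h) = BT.t _ _ a (𝓗.left.coring.r l h) :=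
  BT.ract_t 𝓐.comodule.ract 𝓗.bimodRL l a h

theorem lr_AH (a : A) (l : L) (z : 𝓐.AH) :
    𝓐.coring.l a (𝓐.ractL l z) = 𝓐.ractL l (𝓐.coring.l a z) := by
  induction z using BT.ind with
  | ht b h => rw [ractL_t, bimodAH_l_t, bimodAH_l_t, ractL_t]
  | hadd x y hx hy => simp only [map_add, hx, hy]

theorem ractL_one (z : 𝓐.AH) : 𝓐.ractL (1 : L) z = z := by
  induction z using BT.ind with
  | ht b h => rw [ractL_t, 𝓗.left.coring.r_one]
  | hadd x y hx hy => rw [map_add, hx, hy]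

theorem ractL_mul (l l' : L) (z : 𝓐.AH) : 𝓐.ractL (l * l') z = 𝓐.ractL l' (𝓐.ractL l z) := by
  induction z using BT.ind with
  | ht b h => rw [ractL_t, ractL_t, ractL_t, 𝓗.left.coring.r_mul]
  | hadd x y hx hy => rw [map_add, hx, hy, map_add, map_add]

/-- The `A`-`L` bimodule `A ⊗_R H`. -/
@[reducible] noncomputable def bimodL : Bimod k A L 𝓐.AH :=
  ⟨𝓐.coring.l, 𝓐.ractL, 𝓐.coring.l_one, 𝓐.coring.l_mul, 𝓐.ractL_one, 𝓐.ractL_mul, 𝓐.lr_AH⟩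

theorem tau_bal (a : A) (l : L) (y : H) :
    BT.t 𝓐.comodule.ract 𝓗.right.coring.l a (𝓗.left.coring.r l y)
      = 𝓐.ractL l (BT.t 𝓐.comodule.ract 𝓗.right.coring.l a y) := by
  rw [ractL_t]

/-- The map `y ⊗ y' ↦ (a ⊗ y) ⊗ y'`. -/
noncomputable def tauAux (a : A) :
    BT 𝓗.left.coring.r 𝓗.left.coring.l →ₗ[k] BT 𝓐.ractL 𝓗.left.coring.l :=
  BT.map (BT.t 𝓐.comodule.ract 𝓗.right.coring.l a) LinearMap.id (𝓐.tau_bal a) (fun _ _ => rfl)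

theorem tauAux_t (a : A) (y y' : H) :
    𝓐.tauAux a (BT.t _ _ y y') = BT.t 𝓐.ractL 𝓗.left.coring.l (BT.t _ _ a y) y' := by
  rw [tauAux, BT.map_t]; rfl

theorem tauAux_bal (r : R) (a : A) (z : BT 𝓗.left.coring.r 𝓗.left.coring.l) :
    𝓐.tauAux (𝓐.comodule.ract r a) z
      = 𝓐.tauAux a (BT.lact 𝓗.bimodRL 𝓗.left.coring.l r z) := by
  induction z using BT.ind with
  | ht y y' =>
    rw [tauAux_t, BT.t_bal]
    refine Eq.trans ?_ (congrArg _ (BT.lact_t 𝓗.bimodRL 𝓗.left.coring.l r y y')).symm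
    rw [tauAux_t]
  | hadd x y hx hy => rw [map_add, hx, hy, map_add, map_add]

/-- The right coaction `a ⊗ h ↦ (a ⊗ h_(1)) ⊗ h_(2)` on `A ⊗_R H`. -/
noncomputable def tau : 𝓐.AH →ₗ[k] BT 𝓐.ractL 𝓗.left.coring.l :=
  BT.lift (LinearMap.mk₂ k (fun a h => 𝓐.tauAux a (𝓗.left.coring.comul h))
    (fun a a' h => by
      rw [← LinearMap.add_apply]; congr 1; exact BT.ext (by simp [tauAux_t]))
    (fun c a h => by
      rw [← LinearMap.smul_apply]; congr 1; exact BT.ext (by simp [tauAux_t]))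
    (by simp) (by simp)) (by
      intro r a h
      simp only [LinearMap.mk₂_apply]
      rw [tauAux_bal, 𝓗.comulL_l])

theorem tau_t (a : A) (h : H) :
    𝓐.tau (BT.t _ _ a h) = 𝓐.tauAux a (𝓗.left.coring.comul h) := by
  exact BT.lift_t _ _ a h

theorem tau_r (l : L) (z : 𝓐.AH) :
    𝓐.tau (𝓐.ractL l z) = BT.ract 𝓐.ractL 𝓗.left.coring.toBimod l (𝓐.tau z) := by
  induction z using BT.ind with
  | ht a h =>
    rw [ractL_t, tau_t, tau_t, 𝓗.left.coring.comul_r]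
    generalize 𝓗.left.coring.comul h = w
    induction w using BT.ind with
    | ht y y' => rw [BT.ract_t, tauAux_t, tauAux_t, BT.ract_t]
    | hadd x y hx hy => simp only [map_add, hx, hy]
  | hadd x y hx hy => simp only [map_add, hx, hy]

theorem tau_l (a : A) (z : 𝓐.AH) :
    𝓐.tau (𝓐.coring.l a z) = BT.lact 𝓐.bimodL 𝓗.left.coring.l a (𝓐.tau z) := by
  induction z using BT.ind with
  | ht b h =>
    rw [bimodAH_l_t, tau_t, tau_t]
    generalize 𝓗.left.coring.comul h = w
    induction w using BT.ind with
    | ht y y' =>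
      rw [tauAux_t, tauAux_t]
      refine ((BT.lact_t 𝓐.bimodL 𝓗.left.coring.l a _ y').trans ?_).symm
      rw [bimodAH_l_t]
    | hadd x y hx hy => simp only [map_add, hx, hy]
  | hadd x y hx hy => simp only [map_add, hx, hy]

/-- The map `y ⊗ z ↦ (a ⊗ y) ⊗ z`. -/
noncomputable def tau3 (a : A) :
    BT 𝓗.left.coring.r (BT.lact 𝓗.left.coring.toBimod 𝓗.left.coring.l)
      →ₗ[k] BT 𝓐.ractL (BT.lact 𝓗.left.coring.toBimod 𝓗.left.coring.l) :=
  BT.map (BT.t 𝓐.comodule.ract 𝓗.right.coring.l a) LinearMap.id (𝓐.tau_bal a) (fun _ _ => rfl)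

theorem tau3_t (a : A) (y : H) (z : BT 𝓗.left.coring.r 𝓗.left.coring.l) :
    𝓐.tau3 a (BT.t _ _ y z)
      = BT.t 𝓐.ractL (BT.lact 𝓗.left.coring.toBimod 𝓗.left.coring.l) (BT.t _ _ a y) z := by
  rw [tau3, BT.map_t]; rfl

theorem tau_coassoc (z : 𝓐.AH) :
    BT.assoc 𝓐.ractL 𝓗.left.coring.toBimod 𝓗.left.coring.l
      (BT.map 𝓐.tau LinearMap.id 𝓐.tau_r (fun _ _ => rfl) (𝓐.tau z))
    = BT.map LinearMap.id 𝓗.left.coring.comul (fun _ _ => rfl) 𝓗.left.coring.comul_l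
        (𝓐.tau z) := by
  induction z using BT.ind with
  | ht a h =>
    have h1 : ∀ w, BT.assoc 𝓐.ractL 𝓗.left.coring.toBimod 𝓗.left.coring.l
        (BT.map 𝓐.tau LinearMap.id 𝓐.tau_r (fun _ _ => rfl) (𝓐.tauAux a w))
        = 𝓐.tau3 a (BT.assoc 𝓗.left.coring.r 𝓗.left.coring.toBimod 𝓗.left.coring.l
          (BT.map 𝓗.left.coring.comul LinearMap.id 𝓗.left.coring.comul_r (fun _ _ => rfl) w)) := by
      intro w
      induction w using BT.ind with
      | ht y y' =>
        rw [tauAux_t, BT.map_t, BT.map_t, tau_t]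
        generalize 𝓗.left.coring.comul y = v
        induction v using BT.ind with
        | ht x x' => rw [tauAux_t, BT.assoc_t, BT.assoc_t, tau3_t]
        | hadd x y hx hy => simp only [map_add, LinearMap.add_apply, hx, hy]
      | hadd x y hx hy => simp only [map_add, hx, hy]
    have h2 : ∀ w, BT.map LinearMap.id 𝓗.left.coring.comul (fun _ _ => rfl)
        𝓗.left.coring.comul_l (𝓐.tauAux a w)
        = 𝓐.tau3 a (BT.map LinearMap.id 𝓗.left.coring.comul (fun _ _ => rfl)
          𝓗.left.coring.comul_l w) := by
      intro w
      induction w using BT.ind with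
      | ht y y' => rw [tauAux_t, BT.map_t, BT.map_t, tau3_t]; rfl
      | hadd x y hx hy => simp only [map_add, hx, hy]
    rw [tau_t, h1, h2, 𝓗.left.coring.coassoc]
  | hadd x y hx hy => simp only [map_add, hx, hy]

theorem tau_counit (z : 𝓐.AH) :
    BT.contrR 𝓐.ractL 𝓗.left.coring.l 𝓐.ractL_mul 𝓗.left.coring.counit
      𝓗.left.coring.counit_l (𝓐.tau z) = z := by
  induction z using BT.ind with
  | ht a h =>
    have h1 : ∀ w, BT.contrR 𝓐.ractL 𝓗.left.coring.l 𝓐.ractL_mul 𝓗.left.coring.counit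
        𝓗.left.coring.counit_l (𝓐.tauAux a w)
        = BT.t _ _ a (BT.contrR 𝓗.left.coring.r 𝓗.left.coring.l 𝓗.left.coring.r_mul
          𝓗.left.coring.counit 𝓗.left.coring.counit_l w) := by
      intro w
      induction w using BT.ind with
      | ht y y' => rw [tauAux_t, BT.contrR_t, BT.contrR_t, ractL_t]
      | hadd x y hx hy => simp only [map_add, hx, hy]
    rw [tau_t, h1, 𝓗.left.coring.comul_counit]
  | hadd x y hx hy => simp only [map_add, hx, hy]

theorem comulAH_ractL (l : L) (z : 𝓐.AH) :
    𝓐.coring.comul (𝓐.ractL l z) = BT.ract 𝓐.coring.r 𝓐.bimodL l (𝓐.coring.comul z) := by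
  induction z using BT.ind with
  | ht a h =>
    rw [ractL_t, comulAH_t, comulAH_t, 𝓗.comulR_r]
    generalize 𝓗.right.coring.comul h = w
    induction w using BT.ind with
    | ht y y' =>
      refine (congrArg _ (BT.ract_t 𝓗.right.coring.r 𝓗.bimodRL l y y')).trans ?_
      rw [kappaAux_t, kappaAux_t]
      refine ((BT.ract_t 𝓐.coring.r 𝓐.bimodL l _ _).trans ?_).symm
      rw [ractL_t]
    | hadd x y hx hy => simp only [map_add, hx, hy]
  | hadd x y hx hy => simp only [map_add, hx, hy]

theorem kappaTau_bal (a : A) (r : R) (x : H) (z : BT 𝓗.left.coring.r 𝓗.left.coring.l) :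
    BT.t 𝓐.coring.r (BT.lact 𝓐.bimodL 𝓗.left.coring.l)
        (BT.t 𝓐.comodule.ract 𝓗.right.coring.l a (𝓗.right.coring.r r x)) (𝓐.tauAux 1 z)
      = BT.t 𝓐.coring.r (BT.lact 𝓐.bimodL 𝓗.left.coring.l)
        (BT.t 𝓐.comodule.ract 𝓗.right.coring.l a x)
        (𝓐.tauAux 1 (BT.lact 𝓗.bimodRL 𝓗.left.coring.l r z)) := by
  rw [← bimodAH_r_η, BT.t_bal, ← tauAux_bal]
  congr 1
  induction z using BT.ind with
  | ht y y' =>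
    rw [tauAux_t, tauAux_t, 𝓐.ract_eq, one_mul]
    refine (BT.lact_t 𝓐.bimodL 𝓗.left.coring.l _ _ y').trans ?_
    rw [bimodAH_l_t, mul_one]
  | hadd x y hx hy => simp only [map_add, hx, hy]

/-- The map `x ⊗ y ⊗ y' ↦ (a ⊗ x) ⊗ (1 ⊗ y) ⊗ y'`. -/
noncomputable def kappaTau (a : A) : BT 𝓗.right.coring.r (BT.lact 𝓗.bimodRL 𝓗.left.coring.l)
    →ₗ[k] BT 𝓐.coring.r (BT.lact 𝓐.bimodL 𝓗.left.coring.l) :=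
  BT.lift ((BT.t 𝓐.coring.r (BT.lact 𝓐.bimodL 𝓗.left.coring.l)).compl₁₂
    (BT.t 𝓐.comodule.ract 𝓗.right.coring.l a) (𝓐.tauAux 1)) (by
      intro r x z
      simp only [LinearMap.compl₁₂_apply]
      exact 𝓐.kappaTau_bal a r x z)

theorem kappaTau_t (a : A) (x : H) (z : BT 𝓗.left.coring.r 𝓗.left.coring.l) :
    𝓐.kappaTau a (BT.t _ (BT.lact 𝓗.bimodRL 𝓗.left.coring.l) x z)
      = BT.t 𝓐.coring.r (BT.lact 𝓐.bimodL 𝓗.left.coring.l) (BT.t _ _ a x) (𝓐.tauAux 1 z) := by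
  exact BT.lift_t _ _ x z

theorem tau_colinear (z : 𝓐.AH) :
    BT.assoc 𝓐.coring.r 𝓐.bimodL 𝓗.left.coring.l
      (BT.map 𝓐.coring.comul LinearMap.id 𝓐.comulAH_ractL (fun _ _ => rfl) (𝓐.tau z))
    = BT.map LinearMap.id 𝓐.tau (fun _ _ => rfl) 𝓐.tau_l (𝓐.coring.comul z) := by
  induction z using BT.ind with
  | ht a h =>
    have h1 : ∀ w, BT.assoc 𝓐.coring.r 𝓐.bimodL 𝓗.left.coring.l
        (BT.map 𝓐.coring.comul LinearMap.id 𝓐.comulAH_ractL (fun _ _ => rfl) (𝓐.tauAux a w))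
        = 𝓐.kappaTau a (BT.assoc 𝓗.right.coring.r 𝓗.bimodRL 𝓗.left.coring.l
          (BT.map 𝓗.right.coring.comul LinearMap.id 𝓗.comulR_r (fun _ _ => rfl) w)) := by
      intro w
      induction w using BT.ind with
      | ht y y' =>
        rw [tauAux_t, BT.map_t, BT.map_t, comulAH_t]
        generalize 𝓗.right.coring.comul y = v
        induction v using BT.ind with
        | ht x x' =>
          rw [kappaAux_t]
          refine (BT.assoc_t 𝓐.coring.r 𝓐.bimodL 𝓗.left.coring.l _ _ _).trans ?_
          refine Eq.trans ?_ (congrArg _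
            (BT.assoc_t 𝓗.right.coring.r 𝓗.bimodRL 𝓗.left.coring.l x x' _)).symm
          rw [kappaTau_t, tauAux_t]
        | hadd x y hx hy => simp only [map_add, LinearMap.add_apply, hx, hy]
      | hadd x y hx hy => simp only [map_add, hx, hy]
    have h2 : ∀ w, BT.map LinearMap.id 𝓐.tau (fun _ _ => rfl) 𝓐.tau_l (𝓐.kappaAux a w)
        = 𝓐.kappaTau a (BT.map LinearMap.id 𝓗.left.coring.comul (fun _ _ => rfl)
          𝓗.comulL_l w) := by
      intro w
      induction w using BT.ind with
      | ht y y' => rw [kappaAux_t, BT.map_t, BT.map_t, tau_t, kappaTau_t]; rfl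
      | hadd x y hx hy => simp only [map_add, hx, hy]
    rw [tau_t, h1, comulAH_t, h2, 𝓗.coassoc_RL]
  | hadd x y hx hy => simp only [map_add, hx, hy]

/-- The `L`-coring underlying the left bialgebroid of a Hopf algebroid is a right extension of the
`A`-coring `A ⊗_R H`, via the coaction `a ⊗ h ↦ a ⊗ h_(1) ⊗ h_(2)`. -/
@[reducible] noncomputable def extension : RightExtension 𝓐.coring 𝓗.left.coring where
  ract := 𝓐.ractL
  ract_one := 𝓐.ractL_one
  ract_mul := 𝓐.ractL_mul
  coact := 𝓐.tau
  coact_r := 𝓐.tau_r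
  coassoc := 𝓐.tau_coassoc
  counit := 𝓐.tau_counit
  lr := 𝓐.lr_AH
  coact_l := 𝓐.tau_l
  comul_ract := 𝓐.comulAH_ractL
  colinear := 𝓐.tau_colinear

end Extension

section Regular

variable {𝓑 : RightBialgebroid k R H} (𝓐 : ComoduleAlgebra 𝓑 A)

/-- The coinvariant subalgebra `{t ∈ A | t^[0] ⊗ t^[1] = t ⊗ 1}`. -/
def coinvariants : Subalgebra k A where
  carrier := {a | 𝓐.comodule.coact a = BT.t _ _ a 1}
  mul_mem' {a b} ha hb := by
    refine (𝓐.coact_mul a b (a ⊗ₜ[k] 1) (b ⊗ₜ[k] 1) ?_ ?_).trans ?_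
    · exact Eq.symm ha
    · exact Eq.symm hb
    · rw [Algebra.TensorProduct.tmul_mul_tmul, mul_one]; rfl
  add_mem' {a b} ha hb := by
    change 𝓐.comodule.coact (a + b) = BT.t _ _ (a + b) 1
    rw [map_add, map_add, LinearMap.add_apply]
    exact congrArg₂ (· + ·) ha hb
  algebraMap_mem' c := by
    change 𝓐.comodule.coact (algebraMap k A c) = BT.t _ _ (algebraMap k A c) 1
    rw [Algebra.algebraMap_eq_smul_one, map_smul, 𝓐.coact_one, map_smul, LinearMap.smul_apply]

/-- The right regular `A`-module structure of `A`. -/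
noncomputable def ractA (A : Type u) [Ring A] [Algebra k A] : A →ₗ[k] A →ₗ[k] A :=
  (LinearMap.mul k A).flip

theorem ractA_apply (a b : A) : ractA (k := k) A a b = b * a := rfl

/-- The algebra `A`, with the right regular `A`-module structure and the coaction
`A → A ⊗_R H ≅ A ⊗_A (A ⊗_R H)`, as a right comodule over the `A`-coring `A ⊗_R H`. -/
@[reducible] noncomputable def regular : RightComodule 𝓐.coring A where
  ract := ractA A
  ract_one m := by rw [ractA_apply, mul_one]
  ract_mul a a' m := by rw [ractA_apply, ractA_apply, ractA_apply, mul_assoc]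
  coact := (BT.t _ _ 1).comp 𝓐.comodule.coact
  coact_r a b := by
    rw [ractA_apply, LinearMap.comp_apply, coact_mul', LinearMap.comp_apply]
    exact (BT.ract_t (ractA A) 𝓐.bimodAH a 1 _).symm
  coassoc a := by
    have h1 : ∀ w : 𝓐.AH, BT.assoc (ractA A) 𝓐.bimodAH 𝓐.bimodAH.l
        (BT.t (BT.ract (ractA A) 𝓐.bimodAH) 𝓐.bimodAH.l
          (BT.t (ractA A) 𝓐.bimodAH.l 1 (𝓐.comodule.coact 1)) w)
        = BT.t (ractA A) (BT.lact 𝓐.bimodAH 𝓐.bimodAH.l) 1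
          (BT.t 𝓐.bimodAH.r 𝓐.bimodAH.l (BT.t _ _ 1 1) w) := by
      intro w
      rw [BT.assoc_t, 𝓐.coact_one]
    have h2 : ∀ w : 𝓐.AH, BT.t 𝓐.bimodAH.r 𝓐.bimodAH.l (BT.t _ _ 1 1) w
        = 𝓐.kappa (BT.assoc _ 𝓑.coring.toBimod 𝓑.coring.l
          (BT.map 𝓐.comodule.coact LinearMap.id 𝓐.comodule.coact_r (fun _ _ => rfl) w)) := by
      intro w
      induction w using BT.ind with
      | ht x y =>
        rw [BT.map_t, LinearMap.id_apply, kappa_assoc]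
        have h3 : BT.t 𝓐.comodule.ract 𝓑.coring.l x y
            = 𝓐.bimodAH.l x (BT.t _ _ 1 y) := by rw [bimodAH_l_t, mul_one]
        have h4 : 𝓐.bimodAH.r x (BT.t _ _ 1 1) = 𝓐.comodule.coact x := by
          refine (𝓐.ractAH_t x 1 1).trans ?_
          generalize 𝓐.comodule.coact x = v
          induction v using BT.ind with
          | ht b h => rw [mulAH_t, one_mul, one_mul]
          | hadd x y hx hy => rw [map_add, hx, hy]
        rw [h3, ← BT.t_bal, h4]
      | hadd x y hx hy => simp only [map_add, hx, hy]
    rw [LinearMap.comp_apply, BT.map_t, BT.map_t, LinearMap.comp_apply, LinearMap.id_apply]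
    refine (h1 _).trans ?_
    rw [h2, 𝓐.comodule.coassoc]
    rfl
  counit a := by
    rw [LinearMap.comp_apply, BT.contrR_t, ractA_apply, one_mul]
    exact 𝓐.counitAH_coact a

end Regular

section Cleft

variable {𝓗 : HopfAlgebroid k L R H} (𝓐 : ComoduleAlgebra 𝓗.right A)

/-- Left `L`-linearity of the coaction of the right comodule algebra `A`, for an `L`-ring structure
`ηL : L → A`. -/
def IsLeftLinear (ηL : L →ₐ[k] A) : Prop :=
  ∀ l a, 𝓐.comodule.coact (ηL l * a) = 𝓐.bimodAH.l (ηL l) (𝓐.comodule.coact a)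

/-- The left `L`-action `l a = ηL(l) a` on an `L`-ring `A`. -/
noncomputable def lactA (ηL : L →ₐ[k] A) : L →ₗ[k] A →ₗ[k] A :=
  (LinearMap.mul k A).comp ηL.toLinearMap

theorem lactA_apply (ηL : L →ₐ[k] A) (l : L) (a : A) : lactA ηL l a = ηL l * a := rfl

/-- The `L`-`A` bimodule structure of an `L`-ring `A`. -/
@[reducible] noncomputable def bimodA (ηL : L →ₐ[k] A) : Bimod k L A A where
  l := lactA ηL
  r := ractA A
  l_one m := by rw [lactA_apply, map_one, one_mul]
  l_mul l l' m := by rw [lactA_apply, lactA_apply, lactA_apply, map_mul, mul_assoc]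
  r_one m := by rw [ractA_apply, mul_one]
  r_mul a a' m := by rw [ractA_apply, ractA_apply, ractA_apply, mul_assoc]
  lr l a m := by rw [lactA_apply, ractA_apply, ractA_apply, lactA_apply, mul_assoc]

/-- If `A` is an `L`-ring with left `L`-linear coaction, then `A` is an `L`-`(A ⊗_R H)`
bicomodule. -/
@[reducible] noncomputable def bicomodule (ηL : L →ₐ[k] A) (h : 𝓐.IsLeftLinear ηL) :
    Bicomodule k L 𝓐.coring A where
  toRightComodule := 𝓐.regular
  lact := lactA ηL
  lact_one := (bimodA ηL).l_one
  lact_mul := (bimodA ηL).l_mul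
  lr := (bimodA ηL).lr
  coact_lact l a := by
    have h1 : BT.t (ractA A) 𝓐.bimodAH.l 1 (𝓐.bimodAH.l (ηL l) (𝓐.comodule.coact a))
        = BT.lact (bimodA ηL) 𝓐.bimodAH.l l (BT.t (ractA A) 𝓐.bimodAH.l 1 (𝓐.comodule.coact a)) := by
      rw [BT.lact_t, ← BT.t_bal, ractA_apply, one_mul, lactA_apply, mul_one]
    rw [← h l a] at h1
    exact h1

/-- A cleaving: a left `L`-linear right `H_R`-colinear map `λ : H → A`, together with a left
`R`-linear right `L`-linear map `λ' : H → A` such that `μ_A (λ ⊗_R λ') γ_R = η_L π_L` and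
`μ_A (λ' ⊗_L λ) γ_L = η_R π_R`. -/
structure Cleaving (ηL : L →ₐ[k] A) where
  toFun : H →ₗ[k] A
  map_l : ∀ l h, toFun (𝓗.left.coring.l l h) = ηL l * toFun h
  map_r : ∀ r h, toFun (𝓗.right.coring.r r h) = 𝓐.comodule.ract r (toFun h)
  colinear : ∀ h, 𝓐.comodule.coact (toFun h)
    = BT.map toFun LinearMap.id map_r (fun _ _ => rfl) (𝓗.right.coring.comul h)
  inv : H →ₗ[k] A
  inv_l : ∀ r h, inv (𝓗.right.coring.l r h) = 𝓐.η r * inv h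
  inv_r : ∀ l h, inv (𝓗.left.coring.r l h) = inv h * ηL l
  mul_inv : ∀ h, BT.lift ((LinearMap.mul k A).compl₁₂ toFun inv)
      (by
        intro r x y
        simp only [LinearMap.compl₁₂_apply, LinearMap.mul_apply']
        rw [map_r, inv_l, 𝓐.ract_eq, mul_assoc])
      (𝓗.right.coring.comul h) = ηL (𝓗.left.coring.counit h)
  inv_mul : ∀ h, BT.lift ((LinearMap.mul k A).compl₁₂ inv toFun)
      (by
        intro l x y
        simp only [LinearMap.compl₁₂_apply, LinearMap.mul_apply']
        rw [map_l, inv_r, mul_assoc])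
      (𝓗.left.coring.comul h) = 𝓐.η (𝓗.right.coring.counit h)

/-- The `H_R`-comodule algebra `A`, with the `L`-ring structure `ηL`, is an `H`-cleft extension of
its coinvariant subalgebra `T`: `T` is an `L`-subring of `A`, and there is a cleaving. -/
def IsCleftVia (ηL : L →ₐ[k] A) : Prop :=
  (∀ l, ηL l ∈ 𝓐.coinvariants) ∧ Nonempty (𝓐.Cleaving ηL)

/-- The `H_R`-comodule algebra `A` is an `H`-cleft extension of its coinvariant subalgebra: this
holds for some `L`-ring structure of `A`. -/
def IsCleftExtension : Prop := ∃ ηL : L →ₐ[k] A, 𝓐.IsCleftVia ηL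

/-- The algebra `A`, with the left `L`-module structure given by `ηL`, the right regular `A`-module
structure and the given coaction, is an `L`-`(A ⊗_R H)` bicomodule which is cleft for the coring
extension `H_L` of `A ⊗_R H`. -/
def IsCleftBicomodule (ηL : L →ₐ[k] A) : Prop :=
  ∃ h : 𝓐.IsLeftLinear ηL, (𝓐.bicomodule ηL h).IsCleft 𝓐.extension

end Cleft

end ComoduleAlgebra
end CleftExtensions

end NC

/-! Write h_(1) ⊗ h_(2) for `γ_L` and h^(1) ⊗ h^(2) for `γ_R`, and λ, λ' for a cleaving. The
dictionary between cleavings and cleft bicomodules is j = λ and q(a ⊗ h)(x) = a λ'(h) x; conversely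
λ'(h) = q(1 ⊗ h)(1). Left `L`-linearity of the coaction amounts to `η_L(L)` being coinvariant
(`isLeftLinear_iff`).

Purity passes from the Hopf algebroid to `A ⊗_R H` because M ⊗_A (A ⊗_R H) ≅ M ⊗_R H. Every comodule
over `A ⊗_R H` is thereby a comodule over `H_R`, with the same induced `L`-action and compatible
equaliser diagrams (`extension_isPure`).

From a cleaving to a cleft bicomodule, two facts are needed. The map λ is colinear over `H_L`, by
mixed coassociativity and the uniqueness of the induced coaction (`coaction_toFun`). The
compatibility required of q follows from (1 ⊗ h^(1)) λ'(h^(2)) = λ'(h) ⊗ 1 (`ractInv_comul`),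
obtained by a convolution-inverse argument: one triple product is evaluated in two ways. The two
cleaving identities then become the two cleftness identities.

In the other direction, applying the counit to j' ⧫ j = id gives λ'(h_(1)) λ(h_(2)) = `η_R π_R(h)`
(`evalCoact_eq_counit`). The obstacle is that j is known to be colinear only over `H_L`. Its right
`R`-linearity follows by comparing elements under injective coactions (`homD_ract`). Its colinearity
over `H_R` follows from an explicit left inverse of the coaction `tau` built out of λ and λ'
(`recover_tau`), together with the second cleftness identity (`LeftCleaving.coact_toFun`). -/

namespace NC
namespace ComoduleAlgebra

/-! ### The isomorphism X ⊗_A (A ⊗_R H) ≅ X ⊗_R H and its two-fold version. -/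

section Contraction

variable {k R H A X : Type u} [CommRing k] [Ring R] [Algebra k R] [Ring H] [Algebra k H]
  [Ring A] [Algebra k A] [AddCommGroup X] [Module k X] {𝓑 : RightBialgebroid k R H}
  (𝓐 : ComoduleAlgebra 𝓑 A)

/-- Restriction of a right action of `A` along `η : R → A`. -/
noncomputable def restrict (ρ : A →ₗ[k] X →ₗ[k] X) : R →ₗ[k] X →ₗ[k] X :=
  ρ.comp 𝓐.η.toLinearMap

theorem restrict_apply (ρ : A →ₗ[k] X →ₗ[k] X) (r : R) (x : X) :
    𝓐.restrict ρ r x = ρ (𝓐.η r) x := rfl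

variable {ρ : A →ₗ[k] X →ₗ[k] X} (hρ : ∀ a a' x, ρ (a * a') x = ρ a' (ρ a x))

/-- The map `A ⊗_R H → X ⊗_R H`, `a ⊗ h ↦ x a ⊗ h`. -/
noncomputable def contractAux (x : X) : 𝓐.AH →ₗ[k] BT (𝓐.restrict ρ) 𝓑.coring.l :=
  BT.map (ρ.flip x) LinearMap.id
    (fun r a => by simp only [LinearMap.flip_apply]; rw [𝓐.ract_eq, hρ, restrict_apply])
    (fun _ _ => rfl)

theorem contractAux_t (x : X) (a : A) (h : H) :
    𝓐.contractAux hρ x (BT.t _ _ a h) = BT.t _ _ (ρ a x) h := by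
  rw [contractAux, BT.map_t]; rfl

/-- The map `X ⊗_A (A ⊗_R H) → X ⊗_R H`, `x ⊗ a ⊗ h ↦ x a ⊗ h`. -/
noncomputable def contract : BT ρ 𝓐.bimodAH.l →ₗ[k] BT (𝓐.restrict ρ) 𝓑.coring.l :=
  BT.lift
    { toFun := 𝓐.contractAux hρ
      map_add' := fun x x' => BT.ext (by simp [contractAux_t])
      map_smul' := fun c x => BT.ext (by simp [contractAux_t]) }
    (by
      intro a x z
      simp only [LinearMap.coe_mk, AddHom.coe_mk]
      induction z using BT.ind with
      | ht b h => rw [bimodAH_l_t, contractAux_t, contractAux_t, hρ]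
      | hadd x y hx hy => simp only [map_add, hx, hy])

theorem contract_t (x : X) (a : A) (h : H) :
    𝓐.contract hρ (BT.t _ _ x (BT.t _ _ a h)) = BT.t _ _ (ρ a x) h := by
  rw [contract, BT.lift_t]
  exact 𝓐.contractAux_t hρ x a h

variable (ρ) in
/-- The map `X ⊗_R H → X ⊗_A (A ⊗_R H)`, `x ⊗ h ↦ x ⊗ 1 ⊗ h`. -/
noncomputable def expand : BT (𝓐.restrict ρ) 𝓑.coring.l →ₗ[k] BT ρ 𝓐.bimodAH.l :=
  BT.lift ((BT.t ρ 𝓐.bimodAH.l).compl₂ (BT.t 𝓐.comodule.ract 𝓑.coring.l 1)) (by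
    intro r x h
    simp only [LinearMap.compl₂_apply]
    rw [restrict_apply, BT.t_bal, bimodAH_l_t, mul_one, ← BT.t_bal, 𝓐.ract_eq, one_mul])

theorem expand_t (x : X) (h : H) :
    𝓐.expand ρ (BT.t _ _ x h) = BT.t _ _ x (BT.t _ _ 1 h) := by
  rw [expand, BT.lift_t]; rfl

/-- Only this composite is needed: `contract` has to be injective to reflect equalities, and no
argument uses its surjectivity. -/
theorem expand_contract (z : BT ρ 𝓐.bimodAH.l) : 𝓐.expand ρ (𝓐.contract hρ z) = z := by
  induction z using BT.ind with
  | ht x w =>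
    induction w using BT.ind with
    | ht a h => rw [contract_t, expand_t, BT.t_bal, bimodAH_l_t, mul_one]
    | hadd x y hx hy => simp only [map_add, hx, hy]
  | hadd x y hx hy => simp only [map_add, hx, hy]

theorem contract_ract (r : R) (z : BT ρ 𝓐.bimodAH.l) :
    𝓐.contract hρ (𝓐.restrict (BT.ract ρ 𝓐.bimodAH) r z)
      = BT.ract (𝓐.restrict ρ) 𝓑.coring.toBimod r (𝓐.contract hρ z) := by
  induction z using BT.ind with
  | ht x w =>
    induction w using BT.ind with
    | ht a h =>
      rw [restrict_apply, BT.ract_t, bimodAH_r_η, contract_t, contract_t, BT.ract_t]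
    | hadd x y hx hy => simp only [map_add, hx, hy]
  | hadd x y hx hy => simp only [map_add, hx, hy]

theorem ract_bimodAH_mul (a a' : A) (z : BT ρ 𝓐.bimodAH.l) :
    BT.ract ρ 𝓐.bimodAH (a * a') z = BT.ract ρ 𝓐.bimodAH a' (BT.ract ρ 𝓐.bimodAH a z) := by
  induction z using BT.ind with
  | ht x w => rw [BT.ract_t, BT.ract_t, BT.ract_t, 𝓐.bimodAH.r_mul]
  | hadd x y hx hy => simp only [map_add, hx, hy]

/-- The map `X ⊗_A (A ⊗_R H) ⊗_A (A ⊗_R H) → X ⊗_R H ⊗_R H`. -/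
noncomputable def contractTwo : BT ρ (BT.lact 𝓐.bimodAH 𝓐.bimodAH.l)
    →ₗ[k] BT (𝓐.restrict ρ) (BT.lact 𝓑.coring.toBimod 𝓑.coring.l) :=
  (BT.assoc (𝓐.restrict ρ) 𝓑.coring.toBimod 𝓑.coring.l).comp
    ((BT.map (𝓐.contract hρ) LinearMap.id (𝓐.contract_ract hρ) (fun _ _ => rfl)).comp
      ((𝓐.contract 𝓐.ract_bimodAH_mul).comp (BT.assocInv ρ 𝓐.bimodAH 𝓐.bimodAH.l)))

/-- The outer factor is contracted before the inner one, so its `A`-coefficient b first acts on all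
of w through the right action of `A ⊗_R H`. -/
theorem contractTwo_assoc (w : BT ρ 𝓐.bimodAH.l) (b : A) (h : H) :
    𝓐.contractTwo hρ (BT.assoc ρ 𝓐.bimodAH 𝓐.bimodAH.l (BT.t _ _ w (BT.t _ _ b h)))
      = BT.assoc (𝓐.restrict ρ) 𝓑.coring.toBimod 𝓑.coring.l
          (BT.t _ _ (𝓐.contract hρ (BT.ract ρ 𝓐.bimodAH b w)) h) := by
  simp only [contractTwo, LinearMap.comp_apply]
  rw [BT.assocInv_assoc, contract_t, BT.map_t, LinearMap.id_apply]

/-- On elements (b ⊗ y) ⊗ (1 ⊗ y') the outer coefficient is 1 and acts trivially. The coproduct of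
`A ⊗_R H` takes values in sums of such elements. -/
theorem contractTwo_kappaAux (x : X) (b : A) (z : BT 𝓑.coring.r 𝓑.coring.l) :
    𝓐.contractTwo hρ (BT.t _ _ x (𝓐.kappaAux b z)) = BT.t _ _ (ρ b x) z := by
  induction z using BT.ind with
  | ht y y' =>
    rw [kappaAux_t, ← BT.assoc_t, contractTwo_assoc, BT.ract_t, 𝓐.bimodAH.r_one, contract_t,
      BT.assoc_t]
  | hadd x y hx hy => simp only [map_add, hx, hy]

end Contraction

/-! ### Comodules over `A ⊗_R H` as comodules over `H_R`. -/

section RestrictComodule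

variable {k R H A M : Type u} [CommRing k] [Ring R] [Algebra k R] [Ring H] [Algebra k H]
  [Ring A] [Algebra k A] [AddCommGroup M] [Module k M] {𝓑 : RightBialgebroid k R H}
  (𝓐 : ComoduleAlgebra 𝓑 A) (S : RightComodule 𝓐.coring M)

/-- The coaction `M → M ⊗_A (A ⊗_R H) ≅ M ⊗_R H`. -/
noncomputable def restrictCoact : M →ₗ[k] BT (𝓐.restrict S.ract) 𝓑.coring.l :=
  (𝓐.contract S.ract_mul).comp S.coact

theorem restrictCoact_r (r : R) (m : M) :
    𝓐.restrictCoact S (𝓐.restrict S.ract r m)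
      = BT.ract (𝓐.restrict S.ract) 𝓑.coring.toBimod r (𝓐.restrictCoact S m) := by
  rw [restrictCoact, LinearMap.comp_apply, restrict_apply, S.coact_r, LinearMap.comp_apply,
    ← contract_ract]
  rfl

/-- With `contractTwo_tensorComul`, this matches the two parallel arrows of the equaliser over `A
⊗_R H` with those over `H`. It serves both for the coassociativity of the restricted coaction and
for the transfer of purity. Here the coefficient b of the outer factor is absorbed because the
coaction of M is right `A`-linear. -/
theorem contractTwo_coactTensor (z : BT S.ract 𝓐.coring.l) :
    𝓐.contractTwo S.ract_mul (RightExtension.coactTensor S z)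
      = BT.assoc (𝓐.restrict S.ract) 𝓑.coring.toBimod 𝓑.coring.l
          (BT.map (𝓐.restrictCoact S) LinearMap.id (𝓐.restrictCoact_r S) (fun _ _ => rfl)
            (𝓐.contract S.ract_mul z)) := by
  induction z using BT.ind with
  | ht m w =>
    induction w using BT.ind with
    | ht b h =>
      rw [contract_t, BT.map_t, restrictCoact, LinearMap.comp_apply, S.coact_r,
        RightExtension.coactTensor, LinearMap.comp_apply, BT.map_t]
      exact 𝓐.contractTwo_assoc S.ract_mul (S.coact m) b h
    | hadd x y hx hy => simp only [map_add, hx, hy]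
  | hadd x y hx hy => simp only [map_add, hx, hy]

theorem contractTwo_tensorComul (z : BT S.ract 𝓐.coring.l) :
    𝓐.contractTwo S.ract_mul (RightExtension.tensorComul S z)
      = BT.map LinearMap.id 𝓑.coring.comul (fun _ _ => rfl) 𝓑.coring.comul_l
            (𝓐.contract S.ract_mul z) := by
  induction z using BT.ind with
  | ht m w =>
    induction w using BT.ind with
    | ht b h =>
      rw [contract_t, BT.map_t, RightExtension.tensorComul, BT.map_t, comulAH_t]
      exact 𝓐.contractTwo_kappaAux S.ract_mul m b _
    | hadd x y hx hy => simp only [map_add, hx, hy]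
  | hadd x y hx hy => simp only [map_add, hx, hy]

/-- The right comodule over the `R`-coring `H` underlying a right comodule over the `A`-coring
`A ⊗_R H`. -/
@[reducible] noncomputable def restrictComodule : RightComodule 𝓑.coring M where
  ract := 𝓐.restrict S.ract
  ract_one m := by rw [restrict_apply, map_one, S.ract_one]
  ract_mul r r' m := by
    rw [restrict_apply, restrict_apply, restrict_apply, map_mul, S.ract_mul]
  coact := 𝓐.restrictCoact S
  coact_r := 𝓐.restrictCoact_r S
  coassoc m := by
    -- Coassociativity over `A ⊗_R H` is pushed forward along `contractTwo`; each side becomes the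
    -- corresponding side over `H`.
    refine (𝓐.contractTwo_coactTensor S (S.coact m)).symm.trans ?_
    refine Eq.trans ?_ (𝓐.contractTwo_tensorComul S (S.coact m))
    exact congrArg _ (S.coassoc m)
  counit m := by
    refine Eq.trans ?_ (S.counit m)
    rw [restrictCoact, LinearMap.comp_apply]
    generalize S.coact m = z
    induction z using BT.ind with
    | ht m w =>
      induction w using BT.ind with
      | ht b h =>
        rw [contract_t, BT.contrR_t, BT.contrR_t, counitAH_t, S.ract_mul, restrict_apply]
      | hadd x y hx hy => simp only [map_add, hx, hy]
    | hadd x y hx hy => simp only [map_add, hx, hy]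

end RestrictComodule

/-! ### Transfer of purity from the Hopf algebroid to `A ⊗_R H`. -/

section Purity

variable {k L R H A M N : Type u} [CommRing k] [Ring L] [Algebra k L] [Ring R] [Algebra k R]
  [Ring H] [Algebra k H] [Ring A] [Algebra k A] [AddCommGroup M] [Module k M]
  [AddCommGroup N] [Module k N] {𝓗 : HopfAlgebroid k L R H} (𝓐 : ComoduleAlgebra 𝓗.right A)

theorem contract_ractL {S : RightComodule 𝓐.coring M} (l : L) (z : BT S.ract 𝓐.coring.l) :
    𝓐.contract S.ract_mul (BT.ract S.ract 𝓐.extension.bimod l z)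
      = BT.ract (𝓐.restrict S.ract) 𝓗.extensionL.bimod l (𝓐.contract S.ract_mul z) := by
  induction z using BT.ind with
  | ht m w =>
    rw [BT.ract_t]
    induction w using BT.ind with
    | ht b h =>
      rw [contract_t]
      exact ((congrArg _ (congrArg _ (𝓐.ractL_t l b h))).trans
        (𝓐.contract_t S.ract_mul m b _)).trans
          (BT.ract_t (𝓐.restrict S.ract) 𝓗.extensionL.bimod l _ h).symm
    | hadd x y hx hy => simp only [map_add, hx, hy]
  | hadd x y hx hy => simp only [map_add, hx, hy]

theorem expand_ractL {S : RightComodule 𝓐.coring M} (l : L)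
    (z : BT (𝓐.restrict S.ract) 𝓗.right.coring.l) :
    𝓐.expand S.ract (BT.ract (𝓐.restrict S.ract) 𝓗.extensionL.bimod l z)
      = BT.ract S.ract 𝓐.extension.bimod l (𝓐.expand S.ract z) := by
  induction z using BT.ind with
  | ht m h =>
    rw [expand_t, BT.ract_t, BT.ract_t, expand_t]
    exact congrArg _ (𝓐.ractL_t l 1 h).symm
  | hadd x y hx hy => simp only [map_add, hx, hy]

/-- Both actions are m^[0] ε(m^[1] l), and the counit of `A ⊗_R H` sends b ⊗ h to b η(π_R(h)). The
equality is not definitional, so the two balanced tensor products over `L` are different types and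
are linked by `idMap` and `idMapInv`. -/
theorem indAct_restrictComodule (S : RightComodule 𝓐.coring M) (l : L) (m : M) :
    𝓗.extensionL.indAct (𝓐.restrictComodule S) l m = 𝓐.extension.indAct S l m := by
  rw [RightExtension.indAct_apply, RightExtension.indAct_apply]
  change BT.contrR _ _ _ _ _ (𝓐.contract S.ract_mul (S.coact m)) = _
  generalize S.coact m = z
  induction z using BT.ind with
  | ht m w =>
    rw [BT.contrR_t]
    induction w using BT.ind with
    | ht b h =>
      rw [contract_t, BT.contrR_t]
      change _ = S.ract (𝓐.counitAH (𝓐.ractL l (BT.t _ _ b h))) m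
      rw [ractL_t, counitAH_t, S.ract_mul]
      rfl
    | hadd x y hx hy => simp only [map_add, LinearMap.add_apply, hx, hy]
  | hadd x y hx hy => simp only [map_add, hx, hy]

theorem contractTwo_ractL {S : RightComodule 𝓐.coring M} (l : L)
    (z : BT S.ract (BT.lact 𝓐.coring.toBimod 𝓐.coring.l)) :
    𝓐.contractTwo S.ract_mul
        (BT.ract S.ract (𝓐.coring.toBimod.tensor 𝓐.extension.bimod) l z)
      = BT.ract (𝓐.restrict S.ract) (𝓗.right.coring.toBimod.tensor 𝓗.extensionL.bimod) l
          (𝓐.contractTwo S.ract_mul z) := by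
  -- Rebracketing isolates the last factor, the only one on which `L` acts.
  rw [← BT.assoc_assocInv S.ract 𝓐.coring.toBimod 𝓐.coring.l z]
  generalize BT.assocInv S.ract 𝓐.coring.toBimod 𝓐.coring.l z = w
  induction w using BT.ind with
  | ht w c =>
    rw [← RightExtension.assoc_t_ract]
    induction c using BT.ind with
    | ht b h =>
      have h1 : 𝓐.extension.ract l (BT.t _ _ b h) = _ := 𝓐.ractL_t l b h
      rw [h1]
      refine (𝓐.contractTwo_assoc S.ract_mul w b _).trans ?_
      refine ((𝓗.extensionL.assoc_t_ract (𝓐.restrictComodule S) _ l h).trans ?_)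
      exact congrArg _ (𝓐.contractTwo_assoc S.ract_mul w b h).symm
    | hadd x y hx hy => simp only [map_add, hx, hy]
  | hadd x y hx hy => simp only [map_add, hx, hy]

variable (S : RightComodule 𝓐.coring M) (lam : L →ₗ[k] N →ₗ[k] N)

/-- The map `M ⊗_A (A ⊗_R H) ⊗_L N → M ⊗_R H ⊗_L N`. -/
noncomputable def contractMap : BT (BT.ract S.ract 𝓐.extension.bimod) lam
    →ₗ[k] BT (BT.ract (𝓐.restrictComodule S).ract 𝓗.extensionL.bimod) lam :=
  BT.map (𝓐.contract S.ract_mul) LinearMap.id 𝓐.contract_ractL (fun _ _ => rfl)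

theorem contractMap_injective : Function.Injective (𝓐.contractMap S lam) := by
  refine Function.LeftInverse.injective
    (g := BT.map (𝓐.expand S.ract) LinearMap.id 𝓐.expand_ractL (fun _ _ => rfl)) fun z => ?_
  induction z using BT.ind with
  | ht w n =>
    rw [contractMap, BT.map_t]
    refine (BT.map_t _ _ _ _ _ _).trans ?_
    rw [expand_contract]; rfl
  | hadd x y hx hy => simp only [map_add, hx, hy]

/-- The identity map of `M ⊗_L N`, for the two equal right `L`-actions on `M`. -/
noncomputable def idMap : BT (𝓐.extension.indAct S) lam
    →ₗ[k] BT (𝓗.extensionL.indAct (𝓐.restrictComodule S)) lam :=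
  BT.map LinearMap.id LinearMap.id (fun l m => (𝓐.indAct_restrictComodule S l m).symm)
    (fun _ _ => rfl)

/-- The inverse of `idMap`. -/
noncomputable def idMapInv : BT (𝓗.extensionL.indAct (𝓐.restrictComodule S)) lam
    →ₗ[k] BT (𝓐.extension.indAct S) lam :=
  BT.map LinearMap.id LinearMap.id (fun l m => 𝓐.indAct_restrictComodule S l m)
    (fun _ _ => rfl)

theorem idMapInv_idMap (z : BT (𝓐.extension.indAct S) lam) :
    𝓐.idMapInv S lam (𝓐.idMap S lam z) = z := by
  induction z using BT.ind with
  | ht m n => rw [idMap, BT.map_t, idMapInv, BT.map_t]; rfl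
  | hadd x y hx hy => simp only [map_add, hx, hy]

theorem idMap_idMapInv (z : BT (𝓗.extensionL.indAct (𝓐.restrictComodule S)) lam) :
    𝓐.idMap S lam (𝓐.idMapInv S lam z) = z := by
  induction z using BT.ind with
  | ht m n => rw [idMapInv, BT.map_t, idMap, BT.map_t]; rfl
  | hadd x y hx hy => simp only [map_add, hx, hy]

/-- This square and the two for `coactTensorMap` and `tensorComulMap` form a morphism between the
fork over `A ⊗_R H` and the fork over `H`, after tensoring with N. -/
theorem coactMap_idMap (z : BT (𝓐.extension.indAct S) lam) :
    𝓗.extensionL.coactMap (𝓐.restrictComodule S) lam (𝓐.idMap S lam z)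
      = 𝓐.contractMap S lam (𝓐.extension.coactMap S lam z) := by
  induction z using BT.ind with
  | ht m n =>
    rw [idMap, BT.map_t, RightExtension.coactMap, BT.map_t, RightExtension.coactMap, BT.map_t,
      contractMap, BT.map_t]
    rfl
  | hadd x y hx hy => simp only [map_add, hx, hy]

/-- The map `M ⊗_A (A ⊗_R H) ⊗_A (A ⊗_R H) ⊗_L N → M ⊗_R H ⊗_R H ⊗_L N`. -/
noncomputable def contractTwoMap :
    BT (BT.ract S.ract (𝓐.coring.toBimod.tensor 𝓐.extension.bimod)) lam
      →ₗ[k] BT (BT.ract (𝓐.restrictComodule S).ract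
        (𝓗.right.coring.toBimod.tensor 𝓗.extensionL.bimod)) lam :=
  BT.map (𝓐.contractTwo S.ract_mul) LinearMap.id 𝓐.contractTwo_ractL (fun _ _ => rfl)

theorem coactTensorMap_contractMap (z : BT (BT.ract S.ract 𝓐.extension.bimod) lam) :
    𝓗.extensionL.coactTensorMap (𝓐.restrictComodule S) lam (𝓐.contractMap S lam z)
      = 𝓐.contractTwoMap S lam (𝓐.extension.coactTensorMap S lam z) := by
  induction z using BT.ind with
  | ht w n =>
    rw [contractMap, BT.map_t, RightExtension.coactTensorMap, BT.map_t,
      RightExtension.coactTensorMap, BT.map_t, contractTwoMap, BT.map_t, contractTwo_coactTensor]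
    rfl
  | hadd x y hx hy => simp only [map_add, hx, hy]

theorem tensorComulMap_contractMap (z : BT (BT.ract S.ract 𝓐.extension.bimod) lam) :
    𝓗.extensionL.tensorComulMap (𝓐.restrictComodule S) lam (𝓐.contractMap S lam z)
      = 𝓐.contractTwoMap S lam (𝓐.extension.tensorComulMap S lam z) := by
  induction z using BT.ind with
  | ht w n =>
    rw [contractMap, BT.map_t, RightExtension.tensorComulMap, BT.map_t,
      RightExtension.tensorComulMap, BT.map_t, contractTwoMap, BT.map_t, contractTwo_tensorComul]
    rfl
  | hadd x y hx hy => simp only [map_add, hx, hy]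

/-- Purity of the extension of the coring `A ⊗_R H` is inherited from the Hopf algebroid. -/
theorem extension_isPure (h : 𝓗.extensionL.IsPure) : 𝓐.extension.IsPure := by
  intro M _ _ S
  obtain ⟨hinj, hex⟩ := h M (𝓐.restrictComodule S)
  refine ⟨fun z w hzw => ?_, fun z hz => ?_⟩
  -- Injectivity is reflected along the invertible left edge `idMap` of the comparison.
  · rw [← 𝓐.idMapInv_idMap S _ z, ← 𝓐.idMapInv_idMap S _ w]
    refine congrArg _ (hinj ?_)
    rw [coactMap_idMap, coactMap_idMap, hzw]
  -- An element equalised over `A ⊗_R H` contracts to one equalised over `H`. The preimage found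
  -- there is carried back, and injectivity of `contractMap` shows that it is a preimage of z.
  · obtain ⟨w, hw⟩ := hex (𝓐.contractMap S _ z) (by
      rw [coactTensorMap_contractMap, tensorComulMap_contractMap, hz])
    refine ⟨𝓐.idMapInv S _ w, 𝓐.contractMap_injective S _ ?_⟩
    rw [← coactMap_idMap, idMap_idMapInv, hw]

end Purity

end ComoduleAlgebra
end NC

namespace NC

/-- On x ⊗ y both sides are ε(x) f(y), by right linearity of ε and left linearity of f. Evaluated on
a coproduct, it says that ε(c^(1) f(c^(2))) = f(c), so f can be recovered from the map c ↦ c^(1)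
f(c^(2)). -/
theorem Coring.counit_contrR {k A C : Type u} [CommRing k] [Ring A] [Algebra k A]
    [AddCommGroup C] [Module k C] (𝒞 : Coring k A C) (f : C →ₗ[k] A)
    (hf : ∀ a c, f (𝒞.l a c) = a * f c) (z : BT 𝒞.r 𝒞.l) :
    𝒞.counit (BT.contrR 𝒞.r 𝒞.l 𝒞.r_mul f hf z)
      = f (BT.contrL 𝒞.r 𝒞.l 𝒞.l_mul 𝒞.counit 𝒞.counit_r z) := by
  induction z using BT.ind with
  | ht x y => rw [BT.contrR_t, BT.contrL_t, 𝒞.counit_r, hf]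
  | hadd x y hx hy => simp only [map_add, hx, hy]

namespace ComoduleAlgebra

variable {k L R H A : Type u} [CommRing k] [Ring L] [Algebra k L] [Ring R] [Algebra k R]
  [Ring H] [Algebra k H] [Ring A] [Algebra k A] {𝓗 : HopfAlgebroid k L R H}
  (𝓐 : ComoduleAlgebra 𝓗.right A)

/-! ### The induced `L`-action and `H_L`-coaction on `A` itself. -/

section Regular

theorem indAct_regular (l : L) (a : A) :
    𝓐.extension.indAct 𝓐.regular l a = 𝓐.counitAH (𝓐.ractL l (𝓐.comodule.coact a)) := by
  rw [RightExtension.indAct_apply]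
  change BT.contrR _ _ _ _ _ (BT.t (ractA A) 𝓐.bimodAH.l 1 (𝓐.comodule.coact a)) = _
  rw [BT.contrR_t, ractA_apply, one_mul]
  rfl

/-- The isomorphism `A ⊗_A (A ⊗_R H) → A ⊗_R H`, `a ⊗ z ↦ a z`. -/
noncomputable def collapse : BT (ractA (k := k) A) 𝓐.bimodAH.l →ₗ[k] 𝓐.AH :=
  BT.contrL (ractA A) 𝓐.bimodAH.l 𝓐.bimodAH.l_mul LinearMap.id
    (fun a b => by rw [ractA_apply, LinearMap.id_apply, LinearMap.id_apply])

theorem collapse_t (a : A) (z : 𝓐.AH) :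
    𝓐.collapse (BT.t _ _ a z) = 𝓐.bimodAH.l a z := by
  rw [collapse, BT.contrL_t]; rfl

theorem t_one_injective : Function.Injective (BT.t (ractA (k := k) A) 𝓐.bimodAH.l 1) := by
  refine Function.LeftInverse.injective (g := 𝓐.collapse) fun z => ?_
  rw [collapse_t, 𝓐.bimodAH.l_one]

/-- The general linearity `coact_indAct`, stripped of the leading factor 1 ∈ A by `t_one_injective`.
It makes `coactLeft` well defined. -/
theorem coact_indAct_regular (l : L) (a : A) :
    𝓐.comodule.coact (𝓐.extension.indAct 𝓐.regular l a) = 𝓐.ractL l (𝓐.comodule.coact a) := by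
  refine 𝓐.t_one_injective ((𝓐.extension.coact_indAct 𝓐.regular l a).trans ?_)
  exact BT.ract_t (ractA A) 𝓐.extension.bimod l 1 (𝓐.comodule.coact a)

/-- The map `a ⊗ h ↦ a^[0] ⊗ a^[1] ⊗ h`. -/
noncomputable def coactLeft : BT (𝓐.extension.indAct 𝓐.regular) 𝓗.left.coring.l
    →ₗ[k] BT 𝓐.ractL 𝓗.left.coring.l :=
  BT.map 𝓐.comodule.coact LinearMap.id 𝓐.coact_indAct_regular (fun _ _ => rfl)

/-- The map `z ⊗ h ↦ (1 ⊗ z) ⊗ h`. -/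
noncomputable def oneTensor : BT 𝓐.ractL 𝓗.left.coring.l
    →ₗ[k] BT (BT.ract (ractA A) 𝓐.extension.bimod) 𝓗.left.coring.l :=
  BT.assocInvAux (ractA A) 𝓐.extension.bimod 𝓗.left.coring.l 1

theorem collapse_ractL (l : L) (z : BT (ractA (k := k) A) 𝓐.bimodAH.l) :
    𝓐.collapse (BT.ract (ractA A) 𝓐.extension.bimod l z) = 𝓐.ractL l (𝓐.collapse z) := by
  induction z using BT.ind with
  | ht a w =>
    refine (congrArg _ (BT.ract_t (ractA A) 𝓐.extension.bimod l a w)).trans ?_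
    refine (𝓐.collapse_t a (𝓐.ractL l w)).trans ?_
    rw [collapse_t]
    exact 𝓐.lr_AH a l w
  | hadd x y hx hy => simp only [map_add, hx, hy]

theorem oneTensor_t (w : 𝓐.AH) (h : H) :
    𝓐.oneTensor (BT.t _ _ w h) = BT.t _ _ (BT.t (ractA A) 𝓐.bimodAH.l 1 w) h :=
  BT.assocInvAux_t (ractA A) 𝓐.extension.bimod 𝓗.left.coring.l 1 w h

theorem oneTensor_injective : Function.Injective 𝓐.oneTensor := by
  refine Function.LeftInverse.injective (g := BT.map 𝓐.collapse
    LinearMap.id 𝓐.collapse_ractL (fun _ _ => rfl)) fun z => ?_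
  induction z using BT.ind with
  | ht w h =>
    rw [oneTensor_t, BT.map_t, collapse_t, 𝓐.bimodAH.l_one]
    rfl
  | hadd x y hx hy => simp only [map_add, hx, hy]

/-- The coaction of the regular comodule is a ↦ 1 ⊗ a^[0] ⊗ a^[1]. Factoring out the injective
`oneTensor` here and in `coactCoact_regular` lets all later computations take place in (A ⊗_R H) ⊗_L
H. -/
theorem coactMap_regular (z : BT (𝓐.extension.indAct 𝓐.regular) 𝓗.left.coring.l) :
    𝓐.extension.coactMap 𝓐.regular 𝓗.left.coring.l z = 𝓐.oneTensor (𝓐.coactLeft z) := by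
  induction z using BT.ind with
  | ht a h =>
    rw [RightExtension.coactMap, BT.map_t, coactLeft, BT.map_t, LinearMap.id_apply]
    exact (BT.assocInvAux_t (ractA A) 𝓐.extension.bimod 𝓗.left.coring.l 1 _ h).symm
  | hadd x y hx hy => simp only [map_add, hx, hy]

theorem coactCoact_regular (a : A) :
    𝓐.extension.coactCoact 𝓐.regular a = 𝓐.oneTensor (𝓐.tau (𝓐.comodule.coact a)) := by
  change BT.assocInv (ractA A) 𝓐.extension.bimod 𝓗.left.coring.l
    (BT.map LinearMap.id 𝓐.tau (fun _ _ => rfl) 𝓐.tau_l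
      (BT.t (ractA A) 𝓐.bimodAH.l 1 (𝓐.comodule.coact a))) = _
  rw [BT.map_t, LinearMap.id_apply]
  generalize 𝓐.tau (𝓐.comodule.coact a) = w
  induction w using BT.ind with
  | ht x h =>
    refine (BT.assocInv_t (ractA A) 𝓐.extension.bimod 𝓗.left.coring.l 1 x h).trans ?_
    exact (BT.assocInvAux_t (ractA A) 𝓐.extension.bimod 𝓗.left.coring.l 1 x h).symm
  | hadd x y hx hy => simp only [map_add, hx, hy]

/-- The defining property of the induced coaction, read without the redundant tensor factor A. -/
theorem coactLeft_coaction (hE : 𝓐.extension.IsPure) (a : A) :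
    𝓐.coactLeft (hE.coaction 𝓐.regular a) = 𝓐.tau (𝓐.comodule.coact a) := by
  apply 𝓐.oneTensor_injective
  rw [← coactMap_regular, hE.coactMap_coaction, coactCoact_regular]

theorem coact_injective : Function.Injective 𝓐.comodule.coact :=
  Function.LeftInverse.injective (g := 𝓐.counitAH) 𝓐.counitAH_coact

theorem tau_injective : Function.Injective 𝓐.tau :=
  Function.LeftInverse.injective 𝓐.tau_counit

/-- Since `γ_L` is right `R`-linear, r acts on the last leg. Together with the injectivity of
`coact` and of `tau`, this yields the right `R`-linearity in `homD_ract`. -/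
theorem tau_ract (r : R) (z : 𝓐.AH) :
    𝓐.tau (BT.ract 𝓐.comodule.ract 𝓗.right.coring.toBimod r z)
      = BT.ract 𝓐.ractL 𝓗.bimodLR r (𝓐.tau z) := by
  induction z using BT.ind with
  | ht a h =>
    rw [BT.ract_t, tau_t, tau_t, 𝓗.comulL_r]
    generalize 𝓗.left.coring.comul h = w
    induction w using BT.ind with
    | ht y y' =>
      refine (congrArg _ (BT.ract_t 𝓗.left.coring.r 𝓗.bimodLR r y y')).trans ?_
      rw [tauAux_t, tauAux_t]
      exact (BT.ract_t 𝓐.ractL 𝓗.bimodLR r _ y').symm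
    | hadd x y hx hy => simp only [map_add, hx, hy]
  | hadd x y hx hy => simp only [map_add, hx, hy]

/-- A coinvariant element acts only on the A-leg. In the convolution argument this is what lets the
values of `η_L` pass across the tensor product. -/
theorem bimodAH_r_coinvariant {t : A} (ht : t ∈ 𝓐.coinvariants) (b : A) (h : H) :
    𝓐.bimodAH.r t (BT.t _ _ b h) = BT.t _ _ (b * t) h := by
  have h1 : 𝓐.bimodAH.r t (BT.t _ _ b h) = 𝓐.mulAH b h (𝓐.comodule.coact t) := 𝓐.ractAH_t t b h
  have h2 : 𝓐.comodule.coact t = BT.t _ _ t 1 := ht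
  rw [h1, h2, mulAH_t, mul_one]

theorem bimodAH_r_t_one (a b : A) :
    𝓐.bimodAH.r a (BT.t _ _ b 1) = 𝓐.bimodAH.l b (𝓐.comodule.coact a) :=
  𝓐.ractAH_t a b 1

end Regular

/-! ### One-sided cleavings: the part of the calculus common to both implications. -/

/-- A left cleaving: a pair of maps `λ, λ' : H → A` with the linearity properties of a cleaving, such
that `μ_A (λ' ⊗_L λ) γ_L = η_R π_R`. -/
structure LeftCleaving (ηL : L →ₐ[k] A) where
  toFun : H →ₗ[k] A
  map_l : ∀ l h, toFun (𝓗.left.coring.l l h) = ηL l * toFun h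
  map_r : ∀ r h, toFun (𝓗.right.coring.r r h) = 𝓐.comodule.ract r (toFun h)
  inv : H →ₗ[k] A
  inv_l : ∀ r h, inv (𝓗.right.coring.l r h) = 𝓐.η r * inv h
  inv_r : ∀ l h, inv (𝓗.left.coring.r l h) = inv h * ηL l
  inv_mul : ∀ h, BT.lift ((LinearMap.mul k A).compl₁₂ inv toFun)
      (by
        intro l x y
        simp only [LinearMap.compl₁₂_apply, LinearMap.mul_apply']
        rw [map_l, inv_r, mul_assoc])
      (𝓗.left.coring.comul h) = 𝓐.η (𝓗.right.coring.counit h)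

namespace LeftCleaving

variable {𝓐} {ηL : L →ₐ[k] A} (c : 𝓐.LeftCleaving ηL)

/-- The map `a ⊗ h ↦ a λ'(h)`. -/
noncomputable def invExt : 𝓐.AH →ₗ[k] A :=
  BT.lift ((LinearMap.mul k A).compl₂ c.inv) (by
    intro r a h
    simp only [LinearMap.compl₂_apply, LinearMap.mul_apply']
    rw [𝓐.ract_eq, c.inv_l, mul_assoc])

theorem invExt_t (a : A) (h : H) : c.invExt (BT.t _ _ a h) = a * c.inv h := by
  rw [invExt, BT.lift_t]; rfl

theorem invExt_l (a : A) (z : 𝓐.AH) : c.invExt (𝓐.bimodAH.l a z) = a * c.invExt z := by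
  induction z using BT.ind with
  | ht b h => rw [bimodAH_l_t, invExt_t, invExt_t, mul_assoc]
  | hadd x y hx hy => simp only [map_add, hx, hy, mul_add]

theorem invExt_ractL (l : L) (z : 𝓐.AH) : c.invExt (𝓐.ractL l z) = c.invExt z * ηL l := by
  induction z using BT.ind with
  | ht b h => rw [ractL_t, invExt_t, invExt_t, c.inv_r, mul_assoc]
  | hadd x y hx hy => simp only [map_add, hx, hy, add_mul]

/-- The product `x ⊗ y ↦ λ'(x) λ(y)`. -/
noncomputable def invMul : BT 𝓗.left.coring.r 𝓗.left.coring.l →ₗ[k] A :=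
  BT.lift ((LinearMap.mul k A).compl₁₂ c.inv c.toFun) (by
    intro l x y
    simp only [LinearMap.compl₁₂_apply, LinearMap.mul_apply']
    rw [c.map_l, c.inv_r, mul_assoc])

theorem invMul_t (x y : H) : c.invMul (BT.t _ _ x y) = c.inv x * c.toFun y := by
  rw [invMul, BT.lift_t]; rfl

theorem invMul_comul (h : H) :
    c.invMul (𝓗.left.coring.comul h) = 𝓐.η (𝓗.right.coring.counit h) := c.inv_mul h

/-- The product `x ⊗ y ↦ λ(x) λ'(y)`. -/
noncomputable def mulInv : BT 𝓗.right.coring.r 𝓗.right.coring.l →ₗ[k] A :=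
  BT.lift ((LinearMap.mul k A).compl₁₂ c.toFun c.inv) (by
    intro r x y
    simp only [LinearMap.compl₁₂_apply, LinearMap.mul_apply']
    rw [c.map_r, c.inv_l, 𝓐.ract_eq, mul_assoc])

theorem mulInv_t (x y : H) : c.mulInv (BT.t _ _ x y) = c.toFun x * c.inv y := by
  rw [mulInv, BT.lift_t]; rfl

theorem mulInv_lact (l : L) (z : BT 𝓗.right.coring.r 𝓗.right.coring.l) :
    c.mulInv (BT.lact 𝓗.bimodLR 𝓗.right.coring.l l z) = ηL l * c.mulInv z := by
  induction z using BT.ind with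
  | ht x y =>
    refine (congrArg _ (BT.lact_t 𝓗.bimodLR 𝓗.right.coring.l l x y)).trans ?_
    rw [mulInv_t, mulInv_t, c.map_l, mul_assoc]
  | hadd x y hx hy => simp only [map_add, hx, hy, mul_add]

/-- The map `x ⊗ y ↦ λ(x) ⊗ y`. -/
noncomputable def tensorRight : BT 𝓗.right.coring.r 𝓗.right.coring.l →ₗ[k] 𝓐.AH :=
  BT.map c.toFun LinearMap.id c.map_r (fun _ _ => rfl)

theorem tensorRight_t (x y : H) : c.tensorRight (BT.t _ _ x y) = BT.t _ _ (c.toFun x) y := by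
  rw [tensorRight, BT.map_t]; rfl

theorem tensorRight_lact (l : L) (z : BT 𝓗.right.coring.r 𝓗.right.coring.l) :
    c.tensorRight (BT.lact 𝓗.bimodLR 𝓗.right.coring.l l z)
      = 𝓐.bimodAH.l (ηL l) (c.tensorRight z) := by
  induction z using BT.ind with
  | ht x y =>
    refine (congrArg _ (BT.lact_t 𝓗.bimodLR 𝓗.right.coring.l l x y)).trans ?_
    rw [tensorRight_t, tensorRight_t, c.map_l, bimodAH_l_t]
  | hadd x y hx hy => simp only [map_add, hx, hy]

theorem invExt_tensorRight (z : BT 𝓗.right.coring.r 𝓗.right.coring.l) :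
    c.invExt (c.tensorRight z) = c.mulInv z := by
  induction z using BT.ind with
  | ht x y => rw [tensorRight_t, invExt_t, mulInv_t]
  | hadd x y hx hy => simp only [map_add, hx, hy]

/-- The map `x ⊗ y ⊗ y' ↦ λ'(x) λ(y) ⊗ y'`. -/
noncomputable def invMulTensor :
    BT 𝓗.left.coring.r (BT.lact 𝓗.bimodLR 𝓗.right.coring.l) →ₗ[k] 𝓐.AH :=
  BT.lift ((𝓐.bimodAH.l.comp c.inv).compl₂ c.tensorRight) (by
    intro l x z
    simp only [LinearMap.compl₂_apply, LinearMap.comp_apply]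
    rw [c.inv_r, 𝓐.bimodAH.l_mul, tensorRight_lact])

theorem invMulTensor_t (x : H) (z : BT 𝓗.right.coring.r 𝓗.right.coring.l) :
    c.invMulTensor (BT.t _ _ x z) = 𝓐.bimodAH.l (c.inv x) (c.tensorRight z) := by
  rw [invMulTensor, BT.lift_t]; rfl

theorem invMulTensor_assoc (z : BT 𝓗.left.coring.r 𝓗.left.coring.l) (y : H) :
    c.invMulTensor (BT.assoc 𝓗.left.coring.r 𝓗.bimodLR 𝓗.right.coring.l (BT.t _ _ z y))
      = BT.t _ _ (c.invMul z) y := by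
  induction z using BT.ind with
  | ht x x' =>
    refine (congrArg _ (BT.assoc_t 𝓗.left.coring.r 𝓗.bimodLR 𝓗.right.coring.l x x' y)).trans ?_
    rw [invMulTensor_t, tensorRight_t, bimodAH_l_t, invMul_t]
  | hadd x y hx hy => simp only [map_add, LinearMap.add_apply, hx, hy]

/-- In Sweedler notation: λ'(h_(1)) λ(h_(2)^(1)) ⊗ h_(2)^(2) = λ'(h^(1)_(1)) λ(h^(1)_(2)) ⊗ h^(2) =
`η_R π_R`(h^(1)) ⊗ h^(2) = 1 ⊗ h. Only the identity for the product λ'λ enters, so the result is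
available before colinearity of λ is known. -/
theorem invMulTensor_comul (h : H) :
    c.invMulTensor (BT.map LinearMap.id 𝓗.right.coring.comul (fun _ _ => rfl) 𝓗.comulR_l
      (𝓗.left.coring.comul h)) = BT.t _ _ 1 h := by
  rw [← 𝓗.coassoc_LR]
  refine Eq.trans ?_ (congrArg (BT.t 𝓐.comodule.ract 𝓗.right.coring.l 1)
    (𝓗.right.coring.counit_comul h))
  generalize 𝓗.right.coring.comul h = w
  induction w using BT.ind with
  | ht x y =>
    rw [BT.map_t, invMulTensor_assoc, invMul_comul, BT.contrL_t, ← BT.t_bal, 𝓐.ract_eq, one_mul]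
    rfl
  | hadd x y hx hy => simp only [map_add, hx, hy]

end LeftCleaving

end ComoduleAlgebra
end NC

/-! ### From a cleaving to a cleft bicomodule. -/

namespace NC
namespace ComoduleAlgebra

variable {k L R H A : Type u} [CommRing k] [Ring L] [Algebra k L] [Ring R] [Algebra k R]
  [Ring H] [Algebra k H] [Ring A] [Algebra k A] {𝓗 : HopfAlgebroid k L R H}
  {𝓐 : ComoduleAlgebra 𝓗.right A} {ηL : L →ₐ[k] A}

/-- One direction evaluates linearity at a = 1; the other uses that the coaction is multiplicative.
-/
theorem isLeftLinear_iff : 𝓐.IsLeftLinear ηL ↔ ∀ l, ηL l ∈ 𝓐.coinvariants := by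
  refine ⟨fun h l => ?_, fun h l a => ?_⟩
  · have h1 := h l 1
    rw [mul_one, 𝓐.coact_one, bimodAH_l_t, mul_one] at h1
    exact h1
  · have h1 : 𝓐.comodule.coact (ηL l) = BT.t _ _ (ηL l) 1 := h l
    rw [coact_mul', h1, ractAH_t]
    rfl

namespace Cleaving

/-- The left cleaving underlying a cleaving. -/
@[reducible] def toLeftCleaving (c : 𝓐.Cleaving ηL) : 𝓐.LeftCleaving ηL where
  toFun := c.toFun
  map_l := c.map_l
  map_r := c.map_r
  inv := c.inv
  inv_l := c.inv_l
  inv_r := c.inv_r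
  inv_mul := c.inv_mul

variable (c : 𝓐.Cleaving ηL)

theorem coact_toFun (h : H) :
    𝓐.comodule.coact (c.toFun h) = c.toLeftCleaving.tensorRight (𝓗.right.coring.comul h) :=
  c.colinear h

theorem mulInv_comul (h : H) :
    c.toLeftCleaving.mulInv (𝓗.right.coring.comul h) = ηL (𝓗.left.coring.counit h) :=
  c.mul_inv h

/-- The right `L`-action on H is itself induced from the regular `H_R`-coaction, h l = h^(1)
π_R(h^(2) l) (`contr_comul`). An `H_R`-colinear map therefore preserves the induced actions. -/
theorem map_ractL (l : L) (h : H) : c.toFun (𝓗.left.coring.r l h)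
    = 𝓐.extension.indAct 𝓐.regular l (c.toFun h) := by
  rw [indAct_regular, coact_toFun]
  refine (congrArg c.toFun (𝓗.extensionL.contr_comul l h).symm).trans ?_
  generalize 𝓗.right.coring.comul h = z
  induction z using BT.ind with
  | ht x y =>
    rw [BT.contrR_t, c.toLeftCleaving.tensorRight_t, ractL_t, counitAH_t, c.map_r, 𝓐.ract_eq]
    rfl
  | hadd x y hx hy => simp only [map_add, hx, hy]

/-- The map `x ⊗ y ⊗ y' ↦ (λ(x) ⊗ y) ⊗ y'`. -/
noncomputable def tensorTwo :
    BT 𝓗.right.coring.r (BT.lact 𝓗.bimodRL 𝓗.left.coring.l)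
      →ₗ[k] BT 𝓐.ractL 𝓗.left.coring.l :=
  BT.lift
    { toFun := fun x => 𝓐.tauAux (c.toFun x)
      map_add' := fun x x' => BT.ext (by simp [tauAux_t])
      map_smul' := fun a x => BT.ext (by simp [tauAux_t]) } (by
    intro r x z
    simp only [LinearMap.coe_mk, AddHom.coe_mk]
    rw [c.map_r, tauAux_bal])

theorem tensorTwo_t (x : H) (z : BT 𝓗.left.coring.r 𝓗.left.coring.l) :
    c.tensorTwo (BT.t _ _ x z) = 𝓐.tauAux (c.toFun x) z := by
  exact BT.lift_t _ _ x z

theorem tau_tensorRight (z : BT 𝓗.right.coring.r 𝓗.right.coring.l) :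
    𝓐.tau (c.toLeftCleaving.tensorRight z)
      = c.tensorTwo (BT.map LinearMap.id 𝓗.left.coring.comul (fun _ _ => rfl) 𝓗.comulL_l z) := by
  induction z using BT.ind with
  | ht x y =>
    rw [LeftCleaving.tensorRight_t, tau_t, BT.map_t, tensorTwo_t]
    rfl
  | hadd x y hx hy => simp only [map_add, hx, hy]

theorem tensorTwo_assoc (z : BT 𝓗.right.coring.r 𝓗.right.coring.l) (y : H) :
    c.tensorTwo (BT.assoc 𝓗.right.coring.r 𝓗.bimodRL 𝓗.left.coring.l (BT.t _ _ z y))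
      = BT.t _ _ (c.toLeftCleaving.tensorRight z) y := by
  induction z using BT.ind with
  | ht x x' =>
    refine (congrArg _ (BT.assoc_t 𝓗.right.coring.r 𝓗.bimodRL 𝓗.left.coring.l x x' y)).trans ?_
    rw [tensorTwo_t, LeftCleaving.tensorRight_t, tauAux_t]
  | hadd x y hx hy => simp only [map_add, LinearMap.add_apply, hx, hy]

/-- A cleaving is colinear for the induced coaction of the left bialgebroid. -/
theorem coaction_toFun (hE : 𝓐.extension.IsPure) (h : H) :
    hE.coaction 𝓐.regular (c.toFun h)
      = BT.map c.toFun LinearMap.id c.map_ractL (fun _ _ => rfl) (𝓗.left.coring.comul h) := by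
  -- By purity the comparison map ϱ ⊗_L H is injective, so the claim may be tested in (A ⊗_R H) ⊗_L
  -- H. There the sides are λ(h^(1)) ⊗ h^(2)_(1) ⊗ h^(2)_(2) and λ(h_(1)^(1)) ⊗ h_(1)^(2) ⊗ h_(2),
  -- equal by mixed coassociativity.
  apply hE.injective
  rw [hE.coactMap_coaction, coactCoact_regular, coactMap_regular, coact_toFun, tau_tensorRight,
    ← 𝓗.coassoc_RL]
  refine congrArg _ ?_
  generalize 𝓗.left.coring.comul h = z
  induction z using BT.ind with
  | ht x y =>
    rw [BT.map_t, BT.map_t, tensorTwo_assoc, coactLeft, BT.map_t, coact_toFun]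
    rfl
  | hadd x y hx hy => simp only [map_add, hx, hy]

/-- The map `x ⊗ y ↦ (1 ⊗ x) λ'(y)`. -/
noncomputable def ractInv : BT 𝓗.right.coring.r 𝓗.right.coring.l →ₗ[k] 𝓐.AH :=
  BT.lift ((𝓐.bimodAH.r.comp c.inv).flip.comp (BT.t 𝓐.comodule.ract 𝓗.right.coring.l 1)) (by
    intro r x y
    simp only [LinearMap.comp_apply, LinearMap.flip_apply]
    rw [c.inv_l, 𝓐.bimodAH.r_mul, bimodAH_r_η])

theorem ractInv_t (x y : H) :
    c.ractInv (BT.t _ _ x y) = 𝓐.bimodAH.r (c.inv y) (BT.t _ _ 1 x) := by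
  rw [ractInv, BT.lift_t]; rfl

/-- The map `x ⊗ y ⊗ y' ↦ (λ'(x) ⊗ 1) λ(y) λ'(y')`. -/
noncomputable def invMulInv (hη : ∀ l, ηL l ∈ 𝓐.coinvariants) :
    BT 𝓗.left.coring.r (BT.lact 𝓗.bimodLR 𝓗.right.coring.l) →ₗ[k] 𝓐.AH :=
  BT.lift ((𝓐.bimodAH.r.comp c.toLeftCleaving.mulInv).flip.comp
      (((BT.t 𝓐.comodule.ract 𝓗.right.coring.l).flip 1).comp c.inv)) (by
    intro l x z
    simp only [LinearMap.comp_apply, LinearMap.flip_apply]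
    rw [c.inv_r, c.toLeftCleaving.mulInv_lact, 𝓐.bimodAH.r_mul,
      𝓐.bimodAH_r_coinvariant (hη l)])

theorem invMulInv_t (hη : ∀ l, ηL l ∈ 𝓐.coinvariants) (x : H)
    (z : BT 𝓗.right.coring.r 𝓗.right.coring.l) : c.invMulInv hη (BT.t _ _ x z)
      = 𝓐.bimodAH.r (c.toLeftCleaving.mulInv z) (BT.t _ _ (c.inv x) 1) := by
  rw [invMulInv, BT.lift_t]; rfl

/-- The product λ(x') λ'(y) acts on λ'(x) ⊗ 1 one factor at a time. By colinearity, λ(x') produces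
λ'(x) λ(x'^(1)) ⊗ x'^(2), and λ'(y) is left acting from outside. -/
theorem invMulInv_assoc (hη : ∀ l, ηL l ∈ 𝓐.coinvariants)
    (z : BT 𝓗.left.coring.r 𝓗.left.coring.l) (y : H) :
    c.invMulInv hη (BT.assoc 𝓗.left.coring.r 𝓗.bimodLR 𝓗.right.coring.l (BT.t _ _ z y))
      = 𝓐.bimodAH.r (c.inv y) (c.toLeftCleaving.invMulTensor
          (BT.map LinearMap.id 𝓗.right.coring.comul (fun _ _ => rfl) 𝓗.comulR_l z)) := by
  induction z using BT.ind with
  | ht x x' =>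
    refine (congrArg _ (BT.assoc_t 𝓗.left.coring.r 𝓗.bimodLR 𝓗.right.coring.l x x' y)).trans ?_
    rw [invMulInv_t, LeftCleaving.mulInv_t, 𝓐.bimodAH.r_mul, bimodAH_r_t_one, coact_toFun,
      BT.map_t, LeftCleaving.invMulTensor_t]
    rfl
  | hadd x y hx hy => simp only [map_add, LinearMap.add_apply, hx, hy]

/-- The identity `(1 ⊗ h^(1)) λ'(h^(2)) = λ'(h) ⊗ 1`. -/
theorem ractInv_comul (hη : ∀ l, ηL l ∈ 𝓐.coinvariants) (h : H) :
    c.ractInv (𝓗.right.coring.comul h) = BT.t _ _ (c.inv h) 1 := by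
  -- First evaluation of (λ'(h_(1)) ⊗ 1) λ(h_(2)^(1)) λ'(h_(2)^(2)): the last two factors multiply
  -- to `η_L π_L`(h_(2)), which is coinvariant and is absorbed into λ' by the counit law.
  have h1 : c.invMulInv hη (BT.map LinearMap.id 𝓗.right.coring.comul (fun _ _ => rfl) 𝓗.comulR_l
      (𝓗.left.coring.comul h)) = BT.t _ _ (c.inv h) 1 := by
    refine Eq.trans ?_ (congrArg (fun x => BT.t 𝓐.comodule.ract 𝓗.right.coring.l (c.inv x) 1)
      (𝓗.left.coring.comul_counit h))
    generalize 𝓗.left.coring.comul h = z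
    induction z using BT.ind with
    | ht x y =>
      rw [BT.map_t, invMulInv_t, mulInv_comul, 𝓐.bimodAH_r_coinvariant (hη _), BT.contrR_t,
        c.inv_r]
      rfl
    | hadd x y hx hy => simp only [map_add, LinearMap.add_apply, hx, hy]
  -- Second evaluation: mixed coassociativity regroups the first two factors into 1 ⊗ h^(1), on
  -- which λ'(h^(2)) acts.
  rw [← h1, ← 𝓗.coassoc_LR]
  generalize 𝓗.right.coring.comul h = z
  induction z using BT.ind with
  | ht x y =>
    rw [BT.map_t, invMulInv_assoc, LeftCleaving.invMulTensor_comul, ractInv_t]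
    rfl
  | hadd x y hx hy => simp only [map_add, hx, hy]

/-- The left `L`-linear right `H_L`-colinear map given by a cleaving. -/
noncomputable def toHomD (hE : 𝓐.extension.IsPure) (hη : 𝓐.IsLeftLinear ηL) :
    Bicomodule.HomD hE (𝓐.bicomodule ηL hη) where
  toFun := c.toFun
  map_l := c.map_l
  map_r := c.map_ractL
  colinear := c.coaction_toFun hE

/-- The map `a ⊗ h ↦ a λ'(h)`, as an element of `Q̃`. -/
noncomputable def toQ (hη : 𝓐.IsLeftLinear ηL) :
    Bicomodule.Q 𝓐.extension (𝓐.bicomodule ηL hη) where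
  toFun := (LinearMap.mul k A).comp c.toLeftCleaving.invExt
  apply_r z a x := by
    simp only [LinearMap.comp_apply, LinearMap.mul_apply', ractA_apply, mul_assoc]
  map_l a z x := by
    simp only [LinearMap.comp_apply, LinearMap.mul_apply']
    rw [LeftCleaving.invExt_l, mul_assoc]
  map_r l z x := by
    simp only [LinearMap.comp_apply, LinearMap.mul_apply']
    rw [LeftCleaving.invExt_ractL, lactA_apply, mul_assoc]
  compat z x := by
    -- The coaction of x is 1 ⊗ x^[0] ⊗ x^[1], so the right side of the compatibility is q(z)(1)
    -- acting on the left of the given coaction of x.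
    refine Eq.trans ?_ (BT.contrL_t (ractA A) 𝓐.bimodAH.l 𝓐.bimodAH.l_mul _ _ 1
      (𝓐.comodule.coact x)).symm
    simp only [LinearMap.comp_apply, LinearMap.mul_apply', mul_one]
    induction z using BT.ind with
    | ht a h =>
      have h1 : c.toLeftCleaving.invExt (BT.t _ _ a h) = a * c.inv h :=
        LeftCleaving.invExt_t _ a h
      -- For z = a ⊗ h the right side is (a λ'(h) ⊗ 1) x. Replacing λ'(h) ⊗ 1 by (1 ⊗ h^(1))
      -- λ'(h^(2)) turns it into (a ⊗ h^(1)) λ'(h^(2)) x, which is the left side.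
      rw [h1, ← bimodAH_r_t_one, ← bimodAH_l_t, ← c.ractInv_comul (isLeftLinear_iff.1 hη),
        comulAH_t]
      generalize 𝓗.right.coring.comul h = w
      induction w using BT.ind with
      | ht y y' =>
        rw [kappaAux_t, ractInv_t]
        refine (BT.contrR_t _ _ _ _ _ _ _).trans ?_
        simp only [LinearMap.comp_apply, LinearMap.flip_apply, LinearMap.mul_apply']
        rw [LeftCleaving.invExt_t, one_mul, 𝓐.bimodAH.r_mul, 𝓐.bimodAH.lr, bimodAH_l_t, mul_one]
      | hadd x y hx hy => simp only [map_add, hx, hy]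
    | hadd x y hx hy => simp only [map_add, LinearMap.add_apply, hx, hy]

end Cleaving

/-- Each cleaving identity gives one cleftness identity: the product λ'λ gives j' ⧫ j = id and the
product λλ' gives j ◇ j' = `ε`. -/
theorem IsCleftVia.isCleftBicomodule (hE : 𝓐.extension.IsPure) (h : 𝓐.IsCleftVia ηL) :
    𝓐.IsCleftBicomodule ηL := by
  obtain ⟨hη, ⟨c⟩⟩ := h
  have hl : 𝓐.IsLeftLinear ηL := isLeftLinear_iff.2 hη
  refine ⟨hl, hE, c.toHomD hE hl, c.toQ hl, fun z => ?_, fun h x => ?_⟩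
  -- On a ⊗ h the left side is a λ'(h_(1)) λ(h_(2)) = a `η_R π_R(h)`. Once it is the counit, the
  -- black diamond is the identity by the counit law of the coring.
  · have h1 : ∀ z, Bicomodule.evalCoact (c.toQ hl) (c.toHomD hE hl) z = 𝓐.coring.counit z := by
      intro z
      rw [Bicomodule.evalCoact, LinearMap.comp_apply]
      induction z using BT.ind with
      | ht a h =>
        rw [counitAH_t, ← c.toLeftCleaving.invMul_comul h, tau_t]
        generalize 𝓗.left.coring.comul h = w
        induction w using BT.ind with
        | ht x y =>
          rw [tauAux_t, BT.lift_t, LeftCleaving.invMul_t, ← mul_assoc]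
          exact congrArg (· * c.toFun y) (c.toLeftCleaving.invExt_t a x)
        | hadd x y hx hy => simp only [map_add, hx, hy, mul_add]
      | hadd x y hx hy => simp only [map_add, hx, hy]
    refine Eq.trans ?_ (𝓐.coring.comul_counit z)
    rw [Bicomodule.blackDiamond, LinearMap.comp_apply]
    generalize 𝓐.coring.comul z = w
    induction w using BT.ind with
    | ht x y => rw [BT.contrR_t, BT.contrR_t, h1]
    | hadd x y hx hy => simp only [map_add, hx, hy]
  · refine (BT.contrR_t (ractA A) 𝓐.bimodAH.l _ _ _ 1 (𝓐.comodule.coact (c.toFun h))).trans ?_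
    rw [c.coact_toFun]
    change 1 * (c.toLeftCleaving.invExt (c.toLeftCleaving.tensorRight _) * x) = _
    rw [LeftCleaving.invExt_tensorRight, c.mulInv_comul, one_mul]
    rfl

end ComoduleAlgebra
end NC

/-! ### From a cleft bicomodule to a cleaving. -/

namespace NC
namespace ComoduleAlgebra

variable {k L R H A : Type u} [CommRing k] [Ring L] [Algebra k L] [Ring R] [Algebra k R]
  [Ring H] [Algebra k H] [Ring A] [Algebra k A] {𝓗 : HopfAlgebroid k L R H}
  {𝓐 : ComoduleAlgebra 𝓗.right A} {ηL : L →ₐ[k] A}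

namespace LeftCleaving

variable (c : 𝓐.LeftCleaving ηL)

/-- The map `z ⊗ h ↦ (id_A · λ')(z) λ(h^(1)) ⊗ h^(2)`. -/
noncomputable def recover : BT 𝓐.ractL 𝓗.left.coring.l →ₗ[k] 𝓐.AH :=
  BT.lift ((𝓐.bimodAH.l.comp c.invExt).compl₂ (c.tensorRight.comp 𝓗.right.coring.comul)) (by
    intro l z h
    simp only [LinearMap.compl₂_apply, LinearMap.comp_apply]
    rw [invExt_ractL, 𝓐.bimodAH.l_mul, 𝓗.comulR_l, tensorRight_lact])

theorem recover_t (z : 𝓐.AH) (h : H) : c.recover (BT.t _ _ z h)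
    = 𝓐.bimodAH.l (c.invExt z) (c.tensorRight (𝓗.right.coring.comul h)) := by
  rw [recover, BT.lift_t]; rfl

/-- On a ⊗ h the composite is a λ'(h_(1)) λ(h_(2)^(1)) ⊗ h_(2)^(2), which is a ⊗ h by
`invMulTensor_comul`. This inverse of `tau` turns colinearity over `H_L` into colinearity over
`H_R`. -/
theorem recover_tau (z : 𝓐.AH) : c.recover (𝓐.tau z) = z := by
  induction z using BT.ind with
  | ht a h =>
    have h1 : ∀ w, c.recover (𝓐.tauAux a w) = 𝓐.bimodAH.l a (c.invMulTensor
        (BT.map LinearMap.id 𝓗.right.coring.comul (fun _ _ => rfl) 𝓗.comulR_l w)) := by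
      intro w
      induction w using BT.ind with
      | ht x y =>
        rw [tauAux_t, recover_t, invExt_t, BT.map_t, invMulTensor_t, 𝓐.bimodAH.l_mul]
        rfl
      | hadd x y hx hy => simp only [map_add, hx, hy]
    rw [tau_t, h1, invMulTensor_comul, bimodAH_l_t, mul_one]
  | hadd x y hx hy => simp only [map_add, hx, hy]

/-- A left cleaving is colinear if its first component is colinear for the left bialgebroid and
satisfies `λ(h)^[0] λ'(λ(h)^[1]) = η_L(π_L(h))`. -/
theorem coact_toFun
    (map_ractL : ∀ l h, c.toFun (𝓗.left.coring.r l h)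
      = 𝓐.extension.indAct 𝓐.regular l (c.toFun h))
    (colinear : ∀ h, 𝓐.tau (𝓐.comodule.coact (c.toFun h))
      = 𝓐.coactLeft (BT.map c.toFun LinearMap.id map_ractL (fun _ _ => rfl)
          (𝓗.left.coring.comul h)))
    (mul_inv : ∀ h, c.invExt (𝓐.comodule.coact (c.toFun h)) = ηL (𝓗.left.coring.counit h))
    (h : H) : 𝓐.comodule.coact (c.toFun h) = c.tensorRight (𝓗.right.coring.comul h) := by
  -- The coaction of λ(h) becomes `recover` of λ(h_(1))^[0] ⊗ λ(h_(1))^[1] ⊗ h_(2). By `mul_inv`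
  -- this is `η_L π_L`(h_(1)) λ(h_(2)^(1)) ⊗ h_(2)^(2), and left `L`-linearity with the counit law
  -- of `γ_L` leaves λ(h^(1)) ⊗ h^(2).
  rw [← c.recover_tau (𝓐.comodule.coact (c.toFun h)), colinear]
  refine Eq.trans ?_ (congrArg (fun x => c.tensorRight (𝓗.right.coring.comul x))
    (𝓗.left.coring.counit_comul h))
  generalize 𝓗.left.coring.comul h = z
  induction z using BT.ind with
  | ht x y =>
    rw [BT.map_t, coactLeft, BT.map_t, recover_t, mul_inv, BT.contrL_t, 𝓗.comulR_l,
      tensorRight_lact]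
    rfl
  | hadd x y hx hy => simp only [map_add, hx, hy]

/-- A left cleaving with the two missing properties is a cleaving. -/
noncomputable def toCleaving
    (colinear : ∀ h, 𝓐.comodule.coact (c.toFun h) = c.tensorRight (𝓗.right.coring.comul h))
    (mul_inv : ∀ h, c.invExt (𝓐.comodule.coact (c.toFun h)) = ηL (𝓗.left.coring.counit h)) :
    𝓐.Cleaving ηL where
  toFun := c.toFun
  map_l := c.map_l
  map_r := c.map_r
  colinear := colinear
  inv := c.inv
  inv_l := c.inv_l
  inv_r := c.inv_r
  mul_inv h := by
    rw [← mul_inv h, colinear, invExt_tensorRight]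
    rfl
  inv_mul := c.inv_mul

end LeftCleaving

section OfBicomodule

variable {hE : 𝓐.extension.IsPure} {hη : 𝓐.IsLeftLinear ηL}
  (j : Bicomodule.HomD hE (𝓐.bicomodule ηL hη)) (q : Bicomodule.Q 𝓐.extension (𝓐.bicomodule ηL hη))

theorem homD_tau (h : H) : 𝓐.tau (𝓐.comodule.coact (j.toFun h))
    = 𝓐.coactLeft (BT.map j.toFun LinearMap.id j.map_r (fun _ _ => rfl)
        (𝓗.left.coring.comul h)) := by
  rw [← j.colinear h]
  exact (𝓐.coactLeft_coaction hE (j.toFun h)).symm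

/-- Right `R`-linearity is not part of the data of j. Under the injective map `tau ∘ coact` both
sides become coact(j(h_(1))) ⊗ h_(2) r, because `γ_L` is right `R`-linear. -/
theorem homD_ract (r : R) (h : H) :
    j.toFun (𝓗.right.coring.r r h) = 𝓐.comodule.ract r (j.toFun h) := by
  apply 𝓐.coact_injective
  apply 𝓐.tau_injective
  rw [𝓐.comodule.coact_r, tau_ract, homD_tau, homD_tau, 𝓗.comulL_r]
  generalize 𝓗.left.coring.comul h = z
  induction z using BT.ind with
  | ht x y =>
    refine (congrArg (fun z => 𝓐.coactLeft (BT.map j.toFun LinearMap.id j.map_r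
      (fun _ _ => rfl) z)) (BT.ract_t 𝓗.left.coring.r 𝓗.bimodLR r x y)).trans ?_
    rw [BT.map_t, BT.map_t, coactLeft, BT.map_t, BT.map_t]
    exact (BT.ract_t 𝓐.ractL 𝓗.bimodLR r _ y).symm
  | hadd x y hx hy => simp only [map_add, hx, hy]

/-- Hom_A(A, A) ≅ A by evaluation at 1; this is why q reduces to a map into `A`. -/
theorem q_apply (z : 𝓐.AH) (x : A) : q.toFun z x = q.toFun z 1 * x := by
  have h1 := q.apply_r z x 1
  rwa [ractA_apply, one_mul] at h1

/-- The map `h ↦ q(1 ⊗ h)(1)`. -/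
noncomputable def qInv : H →ₗ[k] A :=
  (q.toFun.flip 1).comp (BT.t 𝓐.comodule.ract 𝓗.right.coring.l 1)

theorem qInv_apply (h : H) : qInv q h = q.toFun (BT.t _ _ 1 h) 1 := rfl

theorem qInv_l (r : R) (h : H) : qInv q (𝓗.right.coring.l r h) = 𝓐.η r * qInv q h := by
  rw [qInv_apply, qInv_apply, ← q.map_l]
  refine congrArg (fun z => q.toFun z 1) ?_
  refine Eq.trans ?_ (𝓐.bimodAH_l_t (𝓐.η r) 1 h).symm
  rw [← BT.t_bal, 𝓐.ract_eq, mul_one, one_mul]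

theorem qInv_r (l : L) (h : H) : qInv q (𝓗.left.coring.r l h) = qInv q h * ηL l := by
  rw [qInv_apply, qInv_apply, ← q_apply, ← ractL_t]
  refine (q.map_r l _ 1).trans ?_
  rw [lactA_apply, mul_one]

/-- Apply the counit to c^(1) f(c^(2)) = c, with f the evaluation map: `counit_contrR` and the
counit law return f(c) on the left. -/
theorem evalCoact_eq_counit (hq : ∀ z, Bicomodule.blackDiamond q j z = z) (z : 𝓐.AH) :
    Bicomodule.evalCoact q j z = 𝓐.counitAH z := by
  have h1 := 𝓐.coring.counit_contrR (Bicomodule.evalCoact q j) (Bicomodule.evalCoact_l q j)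
    (𝓐.coring.comul z)
  rw [𝓐.coring.counit_comul] at h1
  exact h1.symm.trans (congrArg 𝓐.coring.counit (hq z))

/-- Identifies the evaluation map on 1 ⊗ h with λ'(h_(1)) λ(h_(2)). The balancedness proof `hb` is
left free so that the statement applies to the product appearing in `LeftCleaving.inv_mul`. -/
theorem evalCoact_t (h : H) (hb) : Bicomodule.evalCoact q j (BT.t _ _ 1 h)
    = BT.lift ((LinearMap.mul k A).compl₁₂ (qInv q) j.toFun) hb (𝓗.left.coring.comul h) := by
  rw [Bicomodule.evalCoact, LinearMap.comp_apply, tau_t]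
  generalize 𝓗.left.coring.comul h = z
  induction z using BT.ind with
  | ht x y =>
    rw [tauAux_t, BT.lift_t, BT.lift_t]
    exact q_apply q _ _
  | hadd x y hx hy => simp only [map_add, hx, hy]

/-- The left cleaving given by a cleft bicomodule. -/
noncomputable def leftCleavingOfBicomodule (hq : ∀ z, Bicomodule.blackDiamond q j z = z) :
    𝓐.LeftCleaving ηL where
  toFun := j.toFun
  map_l := j.map_l
  map_r := homD_ract j
  inv := qInv q
  inv_l := qInv_l q
  inv_r := qInv_r q
  inv_mul h := by
    rw [← evalCoact_t, evalCoact_eq_counit j q hq, counitAH_t, one_mul]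

theorem leftCleavingOfBicomodule_invExt (hq : ∀ z, Bicomodule.blackDiamond q j z = z)
    (z : 𝓐.AH) : (leftCleavingOfBicomodule j q hq).invExt z = q.toFun z 1 := by
  induction z using BT.ind with
  | ht a h =>
    rw [LeftCleaving.invExt_t]
    refine (q.map_l a _ 1).symm.trans (congrArg (fun z => q.toFun z 1) ?_)
    refine (𝓐.bimodAH_l_t a 1 h).trans ?_
    rw [mul_one]
  | hadd x y hx hy => simp only [map_add, LinearMap.add_apply, hx, hy]

end OfBicomodule

/-- The black diamond identity supplies the left cleaving; the white one supplies what is missing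
for a full cleaving. -/
theorem IsCleftBicomodule.isCleftVia (h : 𝓐.IsCleftBicomodule ηL) : 𝓐.IsCleftVia ηL := by
  obtain ⟨hη, hE, j, q, hq, hj⟩ := h
  have h1 : ∀ h, (leftCleavingOfBicomodule j q hq).invExt (𝓐.comodule.coact (j.toFun h))
      = ηL (𝓗.left.coring.counit h) := by
    intro h
    rw [leftCleavingOfBicomodule_invExt]
    -- This is j ◇ j' evaluated at x = 1; the factor 1 on the left is the leading tensor factor of
    -- the regular coaction.
    have h2 : 1 * q.toFun (𝓐.comodule.coact (j.toFun h)) 1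
        = ηL (𝓗.left.coring.counit h) * 1 :=
      (BT.contrR_t (ractA A) 𝓐.bimodAH.l _ _ _ 1 (𝓐.comodule.coact (j.toFun h))).symm.trans
        (hj h 1)
    rwa [one_mul, mul_one] at h2
  exact ⟨isLeftLinear_iff.1 hη, ⟨(leftCleavingOfBicomodule j q hq).toCleaving
    ((leftCleavingOfBicomodule j q hq).coact_toFun j.map_r (homD_tau j) h1) h1⟩⟩

/-- For an `L`-ring structure of `A`, cleftness of the extension is equivalent to cleftness of the
bicomodule. -/
theorem isCleftVia_iff (h : 𝓗.extensionL.IsPure) (ηL : L →ₐ[k] A) :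
    𝓐.IsCleftVia ηL ↔ 𝓐.IsCleftBicomodule ηL :=
  ⟨fun hc => hc.isCleftBicomodule (𝓐.extension_isPure h), fun hc => hc.isCleftVia⟩

end ComoduleAlgebra
end NC

theorem mainTheorem11 {k L R H A : Type u} [CommRing k] [Ring L] [Algebra k L]
    [Ring R] [Algebra k R] [Ring H] [Algebra k H] [Ring A] [Algebra k A]
    (𝓗 : NC.HopfAlgebroid k L R H) (hpure : 𝓗.IsPure)
    (𝓐 : NC.ComoduleAlgebra 𝓗.right A) :
    (𝓐.IsCleftExtension ↔ ∃ ηL : L →ₐ[k] A, 𝓐.IsCleftBicomodule ηL) ∧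
      ∀ ηL : L →ₐ[k] A, 𝓐.IsCleftVia ηL ↔ 𝓐.IsCleftBicomodule ηL :=
  ⟨exists_congr (NC.ComoduleAlgebra.isCleftVia_iff hpure.1),
    NC.ComoduleAlgebra.isCleftVia_iff hpure.1⟩
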